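/- **Conventions.** For integers $A\ge 0$, $m\ge 1$ put $L_A(m)=A(1+\log m)^A$. All algorithms are programs for a real RAM (index registers and real arrays; comparisons, $+,-,\times,\div$, powers $|x|^y$, $\exp$, $\log$ at unit cost) with oracle calls. *Computable functions.* Fix constants $C\in\mathbb N$ and $H:\mathbb N\to\mathbb N$. A convex $c:\mathbb R\to\mathbb R\cup\{+\infty\}$ is $(m,K)$-computable if $|c(x)|\le C(m^K+|x|^K)$ wherever $c(x)$ is finite, and there is a $C^3$ function $\phi$ on the (non-empty) interior of the epigraph $D_c=\{(x,t):c(x)\le t\}$ such that: (i) for some $0<\nu\le K$, $\phi$ is a $\nu$-self-concordant barrier, i.e. $\phi(u)\to\infty$ as $u$ tends to the boundary of $D_c$, $|\nabla^3\phi(u)[v,v,v]|\le 2(\nabla^2\phi(u)[v,v])^{3/2}$ and $\langle\nabla\phi(u),v\rangle^2\le\nu\nabla^2\phi(u)[v,v]$; (ii) for every $a\in\mathbb N$, at all points with $|x|,|t|\le m^K$ and $\phi(x,t)\le L_a(m)$ one has $\nabla^2\phi(x,t)\preceq \exp(L_{H(a)}(m))I$; (iii) the entries of $\nabla\phi$ and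 $\nabla^2\phi$ are computed with at most $L_C(m)$ arithmetic operations. *Decomposable functions.* A convex $c:\mathbb R\to\mathbb R\cup\{+\infty\}$ is $m$-decomposable (with constants $C,H$) if it is a sum of at most $C$ functions, each of the form $x\mapsto\min\{c_1(a)+c_2(b): a+b=x,\ a\in[\theta_\ell,\theta_u]\}$ with $0\le\theta_\ell\le\theta_u$ and $c_1,c_2$ being $(m,K_1)$- and $(m,K_2)$-computable for some $K_1,K_2\le L_C(m)$. *Oracles.* A $(\mathcal T,\delta)$-separable convex minimization oracle (SCO) for $\mathcal X\subseteq\mathbb R^m$ and $\psi:\mathcal X\to\mathbb R$, when queried with $m$-decomposable functions $c_1,\dots,c_m$, returns in time $\mathcal T$ a point $\hat x\in\mathcal X$ with $\psi(\hat x)+\sum_i c_i(\hat x_i)\le\inf_{x\in\mathcal X}\big(\psi(x)+\sum_i c_i(x_i)\big)+\delta$. *Problem.* Given $\mathcal X=\{X\in\mathbb R^{m\times k}: X_j\in\mathcal X_j\ \forall j\in[k]\}$ ($X_j$ is the $j$-th column), where each $\mathcal X_j\subseteq\mathbb R^m$ is non-empty, convex and compact, and convex $\psi_j:\mathcal X_j\to\mathbb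 R$, composite $\ell_{q,p}$-regression asks to minimize $$\mathcal E(X)=\psi(X)+\lambda\|X\|_{q,p}^{pq},\qquad \psi(X)=\sum_{j}\psi_j(X_j),\qquad \|X\|_{q,p}=\Big(\sum_{i\in[m]}\Big(\sum_{j\in[k]}|X_{ij}|^q\Big)^p\Big)^{1/(pq)}$$ over $X\in\mathcal X$. Let $\mathrm{OPT}=\inf_{\mathcal X}\mathcal E$ and $\psi^-=\max(0,-\inf_{\mathcal X}\psi)$, which is $0$ if $\psi\ge0$. **Theorem.** There are a single program $P$ and an absolute constant $B$ such that for every constant $A\in\mathbb N$ there are constants $C,H$ (for the notion of $m$-decomposability) with the following property. Let $k\ge1$, $1<q\le2\le p$ with $p$ an odd integer, $p\le A\sqrt{\log m}$, $0<\lambda\le\exp(L_A(m))$, $k\le\exp(L_A(m))$, and $|x_i|\le\exp(L_A(m))$ for all $x\in\mathcal X_j$, $j\in[k]$, $i\in[m]$; let $\delta_{\mathrm{SCO}}>0$, and for each $j\in[k]$ let a $(\mathcal T_j,\delta_{\mathrm{SCO}})$-SCO for $\mathcal X_j$ and $\psi_j$ be given. Then $P$, on input $m,k,p,q,\lambda,\delta_{\mathrm{SCO}}$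 and with these oracles, outputs $\hat X\in\mathcal X$ with $$\mathcal E(\hat X)\le\inf_{X\in\mathcal X}\mathcal E(X)+3k\,\delta_{\mathrm{SCO}}$$ in time at most $$B\sum_{j\in[k]}(\mathcal T_j+m)\cdot\Big(\frac{p}{q-1}\Big)^{B/(q-1)}\cdot\log\Big(2+k\Big(1+\frac{|\mathrm{OPT}|+\psi^-}{\delta_{\mathrm{SCO}}}\Big)\Big),$$ and it queries each of the $k$ oracles at most $B\,\big(\frac{p}{q-1}\big)^{B/(q-1)}\log\big(2+k(1+\frac{|\mathrm{OPT}|+\psi^-}{\delta_{\mathrm{SCO}}})\big)$ times. -/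

import Mathlib

open scoped BigOperators Topology

noncomputable section

namespace LqpRegression

/-! ### Arithmetic expressions of the real RAM -/

/-- Binary real operations; `pow` sends `x, y` to `|x| ^ y`. -/
inductive BinOp
  | add | sub | mul | div | pow

/-- Unary real operations. -/
inductive UnOp
  | neg | abs | exp | log

def BinOp.eval : BinOp → ℝ → ℝ → ℝ
  | .add, x, y => x + y
  | .sub, x, y => x - y
  | .mul, x, y => x * y
  | .div, x, y => x / y
  | .pow, x, y => |x| ^ y

def UnOp.eval : UnOp → ℝ → ℝ
  | .neg, x => -x
  | .abs, x => |x|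
  | .exp, x => Real.exp x
  | .log, x => Real.log x

/-- Arithmetic expressions. `ifLe a b c d` is "if `a ≤ b` then `c` else `d`"; `letIn a b` evaluates
`b` with variable `0` bound to the value of `a` and the old variable `n` renamed `n + 1`
(so that intermediate results can be shared, as in a straight-line program). -/
inductive RExpr
  | var (n : ℕ)
  | lit (n : ℕ)
  | un (op : UnOp) (a : RExpr)
  | bin (op : BinOp) (a b : RExpr)
  | ifLe (a b c d : RExpr)
  | letIn (a b : RExpr)

/-- Put `x` in front of the list of variables `env`. -/
def consEnv (x : ℝ) (env : ℕ → ℝ) : ℕ → ℝ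
  | 0 => x
  | n + 1 => env n

open Classical in
def RExpr.eval : RExpr → (ℕ → ℝ) → ℝ
  | .var n, env => env n
  | .lit n, _ => (n : ℝ)
  | .un op a, env => op.eval (a.eval env)
  | .bin op a b, env => op.eval (a.eval env) (b.eval env)
  | .ifLe a b c d, env => if a.eval env ≤ b.eval env then c.eval env else d.eval env
  | .letIn a b, env => b.eval (consEnv (a.eval env) env)

/-- Number of elementary operations in an expression. -/
def RExpr.size : RExpr → ℕ
  | .var _ => 1
  | .lit _ => 1
  | .un _ a => a.size + 1
  | .bin _ a b => a.size + b.size + 1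
  | .ifLe a b c d => a.size + b.size + c.size + d.size + 1
  | .letIn a b => a.size + b.size + 1

/-! ### Computable and decomposable functions -/

/-- The explicit `log^{O(1)} m` bound with constant `A`. -/
def polylog (A m : ℕ) : ℝ := A * (1 + Real.log m) ^ A

/-- The epigraph of an extended-valued function. -/
def epi (c : ℝ → WithTop ℝ) : Set (ℝ × ℝ) := {z | c z.1 ≤ (z.2 : WithTop ℝ)}

/-- Convexity of an extended-valued function, through its epigraph. -/
def IsConvexFun (c : ℝ → WithTop ℝ) : Prop := Convex ℝ (epi c)

/-- `D φ(u)[v]`. -/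
def D1 (φ : ℝ × ℝ → ℝ) (v u : ℝ × ℝ) : ℝ := lineDeriv ℝ φ u v

/-- `D² φ(u)[v, w]`. -/
def D2 (φ : ℝ × ℝ → ℝ) (v w u : ℝ × ℝ) : ℝ := D1 (D1 φ v) w u

/-- `D³ φ(u)[v, v, v]`. -/
def D3 (φ : ℝ × ℝ → ℝ) (v u : ℝ × ℝ) : ℝ := D1 (D1 (D1 φ v) v) v u

/-- `φ` is a `ν`-self-concordant barrier for the closed convex region `D` (it is used only on the
interior of `D`). -/
structure IsSelfConcordantBarrier (D : Set (ℝ × ℝ)) (φ : ℝ × ℝ → ℝ) (ν : ℝ) : Prop where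
  nonempty : (interior D).Nonempty
  smooth : ContDiffOn ℝ 3 φ (interior D)
  blowup : ∀ z ∈ frontier D, Filter.Tendsto φ (𝓝[interior D] z) Filter.atTop
  third : ∀ u ∈ interior D, ∀ v, |D3 φ v u| ≤ 2 * (D2 φ v v u) ^ (3 / 2 : ℝ)
  pos : 0 < ν
  grad : ∀ u ∈ interior D, ∀ v, (D1 φ v u) ^ 2 ≤ ν * D2 φ v v u

/-- On `S`, the function `F` of `(x, t)` is computed with at most `n` arithmetic operations, using
real constants `θ` that do not depend on `(x, t)`. -/
def ComputedWithin (n : ℝ) (S : Set (ℝ × ℝ)) (F : ℝ × ℝ → ℝ) : Prop :=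
  ∃ (e : RExpr) (θ : ℕ → ℝ), (e.size : ℝ) ≤ n ∧
    ∀ z ∈ S, e.eval (consEnv z.1 (consEnv z.2 θ)) = F z

/-- The two coordinate directions of the `(x, t)`-plane. -/
def coordDir : Bool → ℝ × ℝ
  | true => (1, 0)
  | false => (0, 1)

/-- `(m, K)`-computable functions. The constant `C` is the one hidden in `|c(x)| = O(m^K + |x|^K)`
and in the time bound for the derivatives of the barrier, and `H` gives, for each constant `a` in the
`log^{O(1)} m` bound on the barrier value, the constant in the quasi-polynomial bound on its
Hessian. -/
def IsComputable (C : ℕ) (H : ℕ → ℕ) (m : ℕ) (K : ℝ) (c : ℝ → WithTop ℝ) : Prop :=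
  IsConvexFun c ∧
  (∀ x r : ℝ, c x = (r : WithTop ℝ) → |r| ≤ C * ((m : ℝ) ^ K + |x| ^ K)) ∧
  ∃ φ : ℝ × ℝ → ℝ,
    (∃ ν : ℝ, ν ≤ K ∧ IsSelfConcordantBarrier (epi c) φ ν) ∧
    (∀ a : ℕ, ∀ u ∈ interior (epi c), |u.1| ≤ (m : ℝ) ^ K → |u.2| ≤ (m : ℝ) ^ K →
      φ u ≤ polylog a m →
        ∀ v : ℝ × ℝ, D2 φ v v u ≤ Real.exp (polylog (H a) m) * (v.1 ^ 2 + v.2 ^ 2)) ∧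
    (∀ b : Bool, ComputedWithin (polylog C m) (interior (epi c)) (D1 φ (coordDir b))) ∧
    (∀ b b' : Bool, ComputedWithin (polylog C m) (interior (epi c))
      (D2 φ (coordDir b) (coordDir b')))

/-- `c(x) = min_{a + b = x, a ∈ [θₗ, θᵤ]} c₁(a) + c₂(b)` for some `0 ≤ θₗ ≤ θᵤ` and
`(m, log^{O(1)} m)`-computable `c₁, c₂`. -/
def IsSplit (C : ℕ) (H : ℕ → ℕ) (m : ℕ) (c : ℝ → WithTop ℝ) : Prop :=
  ∃ (lo hi K₁ K₂ : ℝ) (c₁ c₂ : ℝ → WithTop ℝ),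
    0 ≤ lo ∧ lo ≤ hi ∧ K₁ ≤ polylog C m ∧ K₂ ≤ polylog C m ∧
    IsComputable C H m K₁ c₁ ∧ IsComputable C H m K₂ c₂ ∧
    ∀ x, IsLeast {v | ∃ a ∈ Set.Icc lo hi, v = c₁ a + c₂ (x - a)} (c x)

/-- `m`-decomposable functions with hidden constants `C, H`: convex sums of at most `C` functions
of the split form. -/
def IsDecomposable (C : ℕ) (H : ℕ → ℕ) (m : ℕ) (c : ℝ → WithTop ℝ) : Prop :=
  IsConvexFun c ∧ ∃ (n : ℕ) (f : Fin n → ℝ → WithTop ℝ), n ≤ C ∧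
    (∀ l, IsSplit C H m (f l)) ∧ ∀ x, c x = ∑ l, f l x

/-! ### Separable convex minimization oracles -/

/-- An oracle maps a collection of `m` univariate functions to a point of `ℝ^m`. -/
abbrev Oracle (m : ℕ) : Type := (Fin m → ℝ → WithTop ℝ) → Fin m → ℝ

/-- `O` answers each query with `m`-decomposable functions by a `δ`-minimizer of
`ψ(x) + ∑ i, c i (x i)` over `X`. (The time `𝒯` of a query is charged by the machine, below.) -/
def IsSCO (C : ℕ) (H : ℕ → ℕ) {m : ℕ} (δ : ℝ) (X : Set (Fin m → ℝ)) (ψ : (Fin m → ℝ) → ℝ)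
    (O : Oracle m) : Prop :=
  ∀ c : Fin m → ℝ → WithTop ℝ, (∀ i, IsDecomposable C H m (c i)) →
    O c ∈ X ∧ ∀ y ∈ X,
      (ψ (O c) : WithTop ℝ) + ∑ i, c i (O c i) ≤ (ψ y : WithTop ℝ) + ∑ i, c i (y i) + (δ : WithTop ℝ)

/-! ### The machine: structured programs on a real RAM with oracle access -/

/-- The cell of real array `arr` whose row and column are the contents of index registers
`row` and `col`. -/
structure Ref where
  arr : ℕ
  row : ℕ
  col : ℕ

/-- Tests: comparison of two index registers, or of two real cells. -/
inductive Test
  | natLt (r s : ℕ)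
  | realLe (a b : Ref)

/-- Programs. In `query r params e dst`, the block is `j =` content of index register `r`; the `i`-th
function of the query is `x ↦ e(x, A₁[i,j], …, Aₙ[i,j])` where `A₁, …, Aₙ` are the arrays listed in
`params`; the answer is stored in column `j` of array `dst`. -/
inductive Cmd
  | setNat (r n : ℕ)
  | addNat (r s t : ℕ)
  | setReal (dst : Ref) (args : List Ref) (e : RExpr)
  | cast (dst : Ref) (r : ℕ)
  | query (r : ℕ) (params : List ℕ) (e : RExpr) (dst : ℕ)
  | seq (P Q : Cmd)
  | ite (b : Test) (P Q : Cmd)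
  | while (b : Test) (P : Cmd)

/-- Memory (index registers and two-dimensional real arrays) together with the number of elementary
steps and the number of queries to each block made so far. -/
structure State where
  nat : ℕ → ℕ
  real : ℕ → ℕ → ℕ → ℝ
  steps : ℕ
  calls : ℕ → ℕ

def State.read (s : State) (a : Ref) : ℝ := s.real a.arr (s.nat a.row) (s.nat a.col)

def State.write (s : State) (a : Ref) (x : ℝ) : State :=
  { s with real := fun b i l =>
      if b = a.arr ∧ i = s.nat a.row ∧ l = s.nat a.col then x else s.real b i l }

def State.tick (s : State) (n : ℕ) : State := { s with steps := s.steps + n }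

def Test.holds (s : State) : Test → Prop
  | .natLt r t => s.nat r < s.nat t
  | .realLe a b => s.read a ≤ s.read b

/-- The variables that hold the entries of a list. -/
def listEnv (l : List ℝ) : ℕ → ℝ := fun n => l.getD n 0

/-- The collection of functions described by a query. -/
def queryFun (m : ℕ) (s : State) (j : ℕ) (params : List ℕ) (e : RExpr) :
    Fin m → ℝ → WithTop ℝ :=
  fun i x => (e.eval (consEnv x (listEnv (params.map fun a => s.real a i j))) : ℝ)

/-- The state after a query to block `j` has been answered by `x`. -/
def State.answer {m : ℕ} (s : State) (j dst : ℕ) (x : Fin m → ℝ) : State :=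
  { s with
    real := fun b i l =>
      if h : i < m then (if b = dst ∧ l = j then x ⟨i, h⟩ else s.real b i l) else s.real b i l
    calls := Function.update s.calls j (s.calls j + 1) }

/-- `Exec O P s s'`: started in state `s`, the program `P` with oracles `O` halts in state `s'`. -/
inductive Exec {m k : ℕ} (O : Fin k → Oracle m) : Cmd → State → State → Prop
  | setNat (s : State) (r n : ℕ) :
      Exec O (.setNat r n) s ({ s with nat := Function.update s.nat r n }.tick 1)
  | addNat (s : State) (r t u : ℕ) :
      Exec O (.addNat r t u) s
        ({ s with nat := Function.update s.nat r (s.nat t + s.nat u) }.tick 1)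
  | setReal (s : State) (dst : Ref) (args : List Ref) (e : RExpr) :
      Exec O (.setReal dst args e) s
        ((s.write dst (e.eval (listEnv (args.map s.read)))).tick (1 + args.length + e.size))
  | cast (s : State) (dst : Ref) (r : ℕ) :
      Exec O (.cast dst r) s ((s.write dst (s.nat r : ℝ)).tick 1)
  | query (s : State) (r : ℕ) (params : List ℕ) (e : RExpr) (dst : ℕ) (j : Fin k)
      (hj : s.nat r = j) :
      Exec O (.query r params e dst) s
        ((s.answer j dst (O j (queryFun m s j params e))).tick
          (1 + m * (1 + params.length + e.size)))
  | seq {P Q : Cmd} {s s' s'' : State} (h₁ : Exec O P s s') (h₂ : Exec O Q s' s'') :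
      Exec O (.seq P Q) s s''
  | iteTrue {b : Test} {P Q : Cmd} {s s' : State} (hb : b.holds s)
      (h : Exec O P (s.tick 1) s') : Exec O (.ite b P Q) s s'
  | iteFalse {b : Test} {P Q : Cmd} {s s' : State} (hb : ¬ b.holds s)
      (h : Exec O Q (s.tick 1) s') : Exec O (.ite b P Q) s s'
  | whileFalse {b : Test} {P : Cmd} {s : State} (hb : ¬ b.holds s) :
      Exec O (.while b P) s (s.tick 1)
  | whileTrue {b : Test} {P : Cmd} {s s' s'' : State} (hb : b.holds s)
      (h₁ : Exec O P (s.tick 1) s') (h₂ : Exec O (.while b P) s' s'') :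
      Exec O (.while b P) s s''

/-- Initial state: index registers `0, 1, 2` hold `m, k, p`; the cells `[0,0], [0,1], [0,2]` of
array `0` hold `q, lam, δ`; everything else is `0`. -/
def initState (m k p : ℕ) (q lam δ : ℝ) : State where
  nat := fun n => [m, k, p].getD n 0
  real := fun a i l => if a = 0 ∧ i = 0 then listEnv [q, lam, δ] l else 0
  steps := 0
  calls := fun _ => 0

/-- The output matrix is read off array `1`. -/
def State.output (s : State) (m k : ℕ) : Fin m → Fin k → ℝ := fun i j => s.real 1 i j

/-- Total running time when a query to block `j` takes time `T j`. -/
def State.time (s : State) {k : ℕ} (T : Fin k → ℝ) : ℝ :=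
  (s.steps : ℝ) + ∑ j : Fin k, (s.calls j : ℝ) * T j

/-! ### Composite regression -/

/-- `‖X‖_{q,p} = (∑ᵢ (∑ⱼ |Xᵢⱼ|^q)^p)^{1/(pq)}`. -/
def lqpNorm {m k : ℕ} (q : ℝ) (p : ℕ) (Y : Fin m → Fin k → ℝ) : ℝ :=
  (∑ i, (∑ j, |Y i j| ^ q) ^ p) ^ (1 / (p * q) : ℝ)

/-- The matrices whose `j`-th column lies in `X j` for every `j`. -/
def feasible {m k : ℕ} (X : Fin k → Set (Fin m → ℝ)) : Set (Fin m → Fin k → ℝ) :=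
  {Y | ∀ j, (fun i => Y i j) ∈ X j}

/-- `ψ(Y) = ∑ⱼ ψⱼ(Yⱼ)`. -/
def totalCost {m k : ℕ} (ψ : Fin k → (Fin m → ℝ) → ℝ) (Y : Fin m → Fin k → ℝ) : ℝ :=
  ∑ j, ψ j (fun i => Y i j)

/-- `ℰ(Y) = ψ(Y) + lam ‖Y‖_{q,p}^{pq}`. -/
def objective {m k : ℕ} (ψ : Fin k → (Fin m → ℝ) → ℝ) (q : ℝ) (p : ℕ) (lam : ℝ)
    (Y : Fin m → Fin k → ℝ) : ℝ :=
  totalCost ψ Y + lam * lqpNorm q p Y ^ (p * q : ℝ)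

/-- The optimal value. -/
def optVal {m k : ℕ} (X : Fin k → Set (Fin m → ℝ)) (ψ : Fin k → (Fin m → ℝ) → ℝ) (q : ℝ) (p : ℕ)
    (lam : ℝ) : ℝ :=
  sInf (objective ψ q p lam '' feasible X)

/-- The negative part of the least value of `ψ` on the feasible set; it is `0` if `ψ ≥ 0` there. -/
def costDeficit {m k : ℕ} (X : Fin k → Set (Fin m → ℝ)) (ψ : Fin k → (Fin m → ℝ) → ℝ) : ℝ :=
  max 0 (-sInf (totalCost ψ '' feasible X))

/-- `(p/(q-1))^{B/(q-1)} · log(k |OPT| / δ)`, with the logarithm kept away from `0` when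
`|OPT| < δ`, and with the negative part of `min ψ` added to `|OPT|`. -/
def roundBound {m k : ℕ} (B : ℕ) (X : Fin k → Set (Fin m → ℝ)) (ψ : Fin k → (Fin m → ℝ) → ℝ)
    (q : ℝ) (p : ℕ) (lam δ : ℝ) : ℝ :=
  (p / (q - 1)) ^ (B / (q - 1) : ℝ) *
    Real.log (2 + k * (1 + (|optVal X ψ q p lam| + costDeficit X ψ) / δ))

end LqpRegression

end

open scoped BigOperators Topology

noncomputable section

namespace LqpRegression

/-! Call `z_i = ∑_j |x_ij|^q` the load of row `i`; the objective is `ψ + lam ∑_i z_i^p`. The method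
is a damped block Gauss–Seidel scheme. When block `j` is processed, a row with current load `u` and
current entry `x` is charged, up to a constant, `lam (p u^(p-1) (s + D/2) + c N)`. Here `s` is the
derivative term of `|·|^q` along the proposed move, `D` its Bregman divergence, `N` the `(p q)`-th
power of the length of the move and `c` is `tailWeight`. This is `modelCost`; it is separable over
rows, so the oracle can minimize it together with `ψ_j`. The block then moves only the fraction `β`
of the way to the answer, and the loads are updated before the next block.

The heart is `pass_contraction`: one pass gives `E(x⁺) - E(y) ≤ (1 - β) (E(x) - E(y)) + β k δ` for
every feasible `y`. Two estimates meet in it. Let `G` denote the nonlinear part `p/2 u^(p-1) D + c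
N` of the model at the oracle's answer. Damping scales the linear part by `β` but `D` by about
`β^q`, which is far smaller. Hence (`load_step`) the true growth of `u^p` is at most `β` times the
linear part plus half of `G`, and the other half of `G` is a reserve. On the other side
(`PassRow.bound`), the models queried during a pass use loads that drift; summed over the pass and
evaluated at `y`, they exceed the true change of the `p`-th power of the load by at most half of the
total `G`. The reserve pays exactly for the drift.

`PassRow.bound` is a dichotomy on the size of the total `G` of the row against `z^p`, with `z` the
initial load. If `G` is large (`PassRow.bound_of_large`), every load met during the pass has its
`p`-th power controlled by `G`, so crude bounds suffice. If `G` is small (`PassRow.bound_of_small`),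
a bootstrap shows that the loads stay within a factor close to one of `z`; the error of replacing
`u^(p-1)` by `z^(p-1)` is then split between `G` and the slack in the convexity inequality at `z`.

The program cannot evaluate `ψ`, yet it has to know when to stop. Its first pass uses step `1`, no
load term and weight `lam k^(p-1)` on `|v|^(p q)`. It thus nearly minimizes a separable surrogate
that agrees with the row cost up to the factor `k^(p-1)`. After one damped pass the row cost `F` is
measured. Since the first point nearly minimizes the surrogate, the decrease of the objective in
that damped pass is bounded in terms of `F`; contraction turns a bound on the decrease into a bound
on the remaining gap (`Instance.gap_le`). This fixes the number of passes, and `Instance.rowCost_le`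
bounds `F` by the optimal value for the running time.

It remains to see that the queries are legal and the program does what is claimed. Every queried
function is a sum of two functions `g x + w |x - x₀|^r`, whose epigraphs carry an explicit
self-concordant barrier (`PowBarrier.phi`). The execution is followed with loop invariants. -/

/-! ### The Bregman divergence of `|x| ^ q` -/

/-- Derivative of `|x| ^ q`. -/
def powDeriv (q x : ℝ) : ℝ := q * x * |x| ^ (q - 2)

/-- Bregman divergence of `|·| ^ q` from `x` to `x + d`. -/
def breg (q x d : ℝ) : ℝ := |x + d| ^ q - |x| ^ q - powDeriv q x * d

open Classical in
/-- The function that is quadratic for `|d| ≤ |x|` and of order `|d| ^ q` otherwise. -/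
def quadPow (q x d : ℝ) : ℝ := if |d| ≤ |x| then d ^ 2 * |x| ^ (q - 2) else |d| ^ q

/-- Bernoulli twice: the tangent at the midpoint `1 + t/2` bounds the endpoint, and the tangent at
`1` bounds the midpoint value. Compared with the tangent at `1` alone the gain is `q (t/2) ((1 +
t/2)^(q-1) - 1)`, which is how curvature is extracted without second derivatives. -/
lemma midpoint_tangent {q t : ℝ} (hq : 1 < q) (ht : -1 ≤ t) :
    1 + q * t / 2 + q * (1 + t / 2) ^ (q - 1) * (t / 2) ≤ (1 + t) ^ q := by
  set a := 1 + t / 2 with ha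
  have ha0 : 0 < a := by rw [ha]; linarith
  have hr : -1 ≤ t / 2 / a := by
    rw [le_div_iff₀ ha0]; rw [ha]; linarith
  have h1 := one_add_mul_self_le_rpow_one_add hr hq.le
  have h2 := one_add_mul_self_le_rpow_one_add (s := t / 2) (by linarith) hq.le
  have h3 : (1 + t) = a * (1 + t / 2 / a) := by field_simp; rw [ha]; ring
  rw [h3, Real.mul_rpow ha0.le (by linarith)]
  have h4 : a ^ q = a ^ (q - 1) * a := by
    rw [← Real.rpow_add_one ha0.ne']; ring_nf
  have h5 : a ^ q * (1 + q * (t / 2 / a)) = a ^ q + q * a ^ (q - 1) * (t / 2) := by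
    rw [h4]; field_simp
  have h6 : 0 ≤ a ^ q := by positivity
  nlinarith [mul_le_mul_of_nonneg_left h1 h6]

/-- For exponents in `[0, 1]` Bernoulli only bounds powers from above; applied at `1/a` and
inverted, with `one_le_mul_of_inv_le`, it yields a lower bound for `a^s`. -/
lemma rpow_sub_one_lower {a s : ℝ} (ha : 1 ≤ a) (hs : 0 ≤ s) (hs1 : s ≤ 1) :
    (a ^ s)⁻¹ ≤ 1 - s * (1 - 1 / a) := by
  have ha0 : 0 < a := by linarith
  have h := rpow_one_add_le_one_add_mul_self (s := 1 / a - 1)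
    (by have : 0 < 1 / a := by positivity
        linarith) hs hs1
  rw [← Real.inv_rpow ha0.le]
  calc (a⁻¹) ^ s = (1 + (1 / a - 1)) ^ s := by congr 1; rw [one_div]; ring
    _ ≤ _ := h
    _ = _ := by ring

lemma one_le_mul_of_inv_le {A e : ℝ} (hA : 0 < A) (h : A⁻¹ ≤ 1 - e) : 1 + e ≤ A := by
  have h1 : 1 ≤ A * (1 - e) := by
    have := mul_le_mul_of_nonneg_left h hA.le
    rwa [mul_inv_cancel₀ hA.ne'] at this
  by_cases he : e ≤ -1
  · linarith
  · push Not at he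
    by_contra hc
    push Not at hc
    have : e < 1 := by
      by_contra h'
      push Not at h'
      nlinarith
    nlinarith [sq_nonneg e]

/-- Lower bound at `x = 1`. -/
lemma breg_one_lower {q t : ℝ} (hq : 1 < q) (hq2 : q ≤ 2) :
    (q - 1) / 16 * quadPow q 1 t ≤ |1 + t| ^ q - 1 - q * t := by
  unfold quadPow
  rw [abs_one, Real.one_rpow, mul_one]
  have hs : 0 < q - 1 := by linarith
  have hs1 : q - 1 ≤ 1 := by linarith
  split_ifs with ht
  · obtain ⟨h1, h2⟩ := abs_le.1 ht
    rw [abs_of_nonneg (by linarith)]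
    -- It remains to see that `(t/2) ((1 + t/2)^(q-1) - 1)` is at least a multiple of `(q-1) t^2`.
    -- For `t ≤ 0` this is concave Bernoulli, for `t ≥ 0` its inverted form.
    have hm := midpoint_tangent hq h1
    rcases le_total t 0 with h0 | h0
    · have := rpow_one_add_le_one_add_mul_self (s := t / 2) (by linarith) hs.le hs1
      nlinarith [mul_le_mul_of_nonneg_left this (mul_nonneg (by linarith) (by linarith) : 0 ≤ q * (-t / 2)),
        mul_nonneg hs.le (sq_nonneg t), mul_nonneg (mul_nonneg hs.le hs.le) (sq_nonneg t)]
    · have ha : 1 ≤ 1 + t / 2 := by linarith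
      have h3 := rpow_sub_one_lower ha hs.le hs1
      have h4 := one_le_mul_of_inv_le (Real.rpow_pos_of_pos (by linarith) _) h3
      have h5 : t / 3 ≤ 1 - 1 / (1 + t / 2) := by
        have : 1 - 1 / (1 + t / 2) = (t / 2) / (1 + t / 2) := by field_simp; ring
        rw [this, le_div_iff₀ (by linarith)]
        nlinarith
      have h6 : 1 + (q - 1) * (t / 3) ≤ (1 + t / 2) ^ (q - 1) := by nlinarith
      nlinarith [mul_le_mul_of_nonneg_left h6 (by positivity : 0 ≤ q * (t / 2)),
        mul_nonneg hs.le (sq_nonneg t), mul_nonneg (mul_nonneg hs.le hs.le) (sq_nonneg t)]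
  · push Not at ht
    rcases lt_abs.1 ht with h | h
    · rw [abs_of_pos (by linarith : 0 < t), abs_of_pos (by linarith : 0 < 1 + t)]
      have hm := midpoint_tangent hq (by linarith : -1 ≤ t)
      have ha : 1 ≤ 1 + t / 2 := by linarith
      have h3 := rpow_sub_one_lower ha hs.le hs1
      have hpos : 0 < (1 + t / 2) ^ (q - 1) := Real.rpow_pos_of_pos (by linarith) _
      have h5 : 1 / 3 ≤ 1 - 1 / (1 + t / 2) := by
        have : 1 - 1 / (1 + t / 2) = (t / 2) / (1 + t / 2) := by field_simp; ring
        rw [this, le_div_iff₀ (by linarith)]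
        linarith
      have h6 : ((1 + t / 2) ^ (q - 1))⁻¹ ≤ 1 - (q - 1) / 3 := by nlinarith
      have h7 : (q - 1) / 3 * (1 + t / 2) ^ (q - 1) ≤ (1 + t / 2) ^ (q - 1) - 1 := by
        have := mul_le_mul_of_nonneg_left h6 hpos.le
        rw [mul_inv_cancel₀ hpos.ne'] at this
        linarith
      have h8 : t ^ (q - 1) / 2 ≤ (1 + t / 2) ^ (q - 1) := by
        have e1 : (t / 2) ^ (q - 1) ≤ (1 + t / 2) ^ (q - 1) :=
          Real.rpow_le_rpow (by linarith) (by linarith) hs.le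
        have e2 : (t / 2) ^ (q - 1) = t ^ (q - 1) / 2 ^ (q - 1) :=
          Real.div_rpow (by linarith) (by norm_num) _
        have e3 : (2 : ℝ) ^ (q - 1) ≤ 2 := by
          calc (2 : ℝ) ^ (q - 1) ≤ 2 ^ (1 : ℝ) :=
                Real.rpow_le_rpow_of_exponent_le (by norm_num) hs1
            _ = 2 := by norm_num
        have e4 : 0 ≤ t ^ (q - 1) := Real.rpow_nonneg (by linarith) _
        have e5 : t ^ (q - 1) / 2 ≤ t ^ (q - 1) / 2 ^ (q - 1) :=
          div_le_div_of_nonneg_left e4 (by positivity) e3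
        linarith
      have h9 : t ^ q = t ^ (q - 1) * t := by
        rw [← Real.rpow_add_one (by linarith)]; ring_nf
      have h10 : 0 ≤ t ^ (q - 1) := Real.rpow_nonneg (by linarith) _
      have h11 : (q - 1) / 6 * t ^ (q - 1) ≤ (1 + t / 2) ^ (q - 1) - 1 := by nlinarith
      have h12 := mul_le_mul_of_nonneg_left h11 (by positivity : 0 ≤ q * (t / 2))
      have h13 : 0 ≤ (q - 1) * (t ^ (q - 1) * t) := by positivity
      rw [h9]
      nlinarith [mul_nonneg hs.le h13]
    -- Past the zero of `1 + t` the midpoint tangent is unavailable. Subadditivity of the `(q-1)`-th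
    -- power gives `u^q ≤ (u-1)^q + 2u`, and the linear term `q u` covers the rest.
    · obtain ⟨u, rfl⟩ : ∃ u, t = -u := ⟨-t, by ring⟩
      have hu : 1 < u := by linarith
      rw [abs_neg, abs_of_pos (by linarith : 0 < u),
        show |1 + -u| = u - 1 by rw [abs_of_neg (by linarith)]; ring]
      have h1 : u ^ (q - 1) ≤ (u - 1) ^ (q - 1) + 1 := by
        have := Real.rpow_add_le_add_rpow (a := u - 1) (b := 1) (by linarith) (by norm_num) hs.le hs1
        simpa using this
      have h2 : u ^ q = u ^ (q - 1) * u := by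
        rw [← Real.rpow_add_one (by linarith)]; ring_nf
      have h3 : (u - 1) ^ q = (u - 1) ^ (q - 1) * (u - 1) := by
        rw [← Real.rpow_add_one (by linarith)]; ring_nf
      have h4 : (u - 1) ^ (q - 1) ≤ u := by
        calc (u - 1) ^ (q - 1) ≤ u ^ (q - 1) := Real.rpow_le_rpow (by linarith) (by linarith) hs.le
          _ ≤ u ^ (1 : ℝ) := Real.rpow_le_rpow_of_exponent_le hu.le hs1
          _ = u := by simp
      have h5 : 0 ≤ (u - 1) ^ (q - 1) := Real.rpow_nonneg (by linarith) _
      have h6 : u ^ q ≤ (u - 1) ^ q + (u - 1) ^ (q - 1) + u := by rw [h2, h3]; nlinarith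
      have h7 : 0 ≤ (u - 1) ^ q := Real.rpow_nonneg (by linarith) _
      nlinarith [mul_le_mul_of_nonneg_left h6 hs.le, mul_le_mul_of_nonneg_left h4 hs.le,
        mul_le_mul_of_nonneg_right hs1 h7]

/-- Upper bound at `x = 1`. -/
lemma breg_one_upper {q t : ℝ} (hq : 1 < q) (hq2 : q ≤ 2) :
    |1 + t| ^ q - 1 - q * t ≤ 4 * quadPow q 1 t := by
  unfold quadPow
  rw [abs_one, Real.one_rpow, mul_one]
  have hs : 0 < q - 1 := by linarith
  have hs1 : q - 1 ≤ 1 := by linarith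
  split_ifs with ht
  · obtain ⟨h1, h2⟩ := abs_le.1 ht
    rw [abs_of_nonneg (by linarith)]
    rcases eq_or_lt_of_le h1 with h0 | h0
    · rw [← h0]; norm_num
      rw [Real.zero_rpow (by linarith)]; linarith
    · have h3 : (1 + t) ^ q = (1 + t) ^ (q - 1) * (1 + t) := by
        rw [← Real.rpow_add_one (by linarith)]; ring_nf
      have := rpow_one_add_le_one_add_mul_self h1 hs.le hs1
      rw [h3]
      nlinarith [mul_le_mul_of_nonneg_right this (by linarith : 0 ≤ 1 + t), sq_nonneg t]
  · push Not at ht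
    have hpos : 0 < |t| := by linarith
    have h1 : |t| ≤ |t| ^ q := by
      calc |t| = |t| ^ (1 : ℝ) := by simp
        _ ≤ |t| ^ q := Real.rpow_le_rpow_of_exponent_le ht.le hq.le
    rcases lt_abs.1 ht with h | h
    · have e : |1 + t| ≤ 2 * |t| := by
        rw [abs_of_pos (by linarith : 0 < 1 + t), abs_of_pos (by linarith : 0 < t)]; linarith
      have e1 : |1 + t| ^ q ≤ 2 ^ q * |t| ^ q := by
        rw [← Real.mul_rpow (by norm_num) hpos.le]
        exact Real.rpow_le_rpow (abs_nonneg _) e (by linarith)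
      have e3 : (2 : ℝ) ^ q ≤ 4 := by
        calc (2 : ℝ) ^ q ≤ 2 ^ (2 : ℝ) := Real.rpow_le_rpow_of_exponent_le (by norm_num) hq2
          _ = 4 := by norm_num
      nlinarith
    · have e1 : |1 + t| ^ q ≤ |t| ^ q := by
        apply Real.rpow_le_rpow (abs_nonneg _) _ (by linarith)
        rw [abs_of_neg (by linarith : 1 + t < 0), abs_of_neg (by linarith : t < 0)]; linarith
      have e2 : |t| = -t := abs_of_neg (by linarith)
      nlinarith

lemma quadPow_zero_left {q d : ℝ} (hq : 1 < q) : quadPow q 0 d = |d| ^ q := by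
  unfold quadPow
  split_ifs with h
  · have : d = 0 := by simpa using h
    subst this
    simp [Real.zero_rpow (by linarith : q ≠ 0)]
  · rfl

/-- Together with `breg_scale`: both sides of the comparison are homogeneous of degree `q`, so it
suffices to know it at `x = 1`. At `x = 0` both are `|d|^q`. -/
lemma quadPow_scale {q x d : ℝ} (hx : x ≠ 0) :
    quadPow q x d = |x| ^ q * quadPow q 1 (d / x) := by
  have hx' : 0 < |x| := abs_pos.2 hx
  unfold quadPow
  have : (|d / x| ≤ |(1 : ℝ)|) ↔ |d| ≤ |x| := by
    rw [abs_one, abs_div, div_le_one hx']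
  simp only [this]
  split_ifs with h
  · rw [abs_one, Real.one_rpow, Real.rpow_sub hx', Real.rpow_two, sq_abs]
    field_simp
  · rw [abs_div, Real.div_rpow (abs_nonneg _) hx'.le]
    field_simp

lemma breg_scale {q x d : ℝ} (hx : x ≠ 0) :
    breg q x d = |x| ^ q * (|1 + d / x| ^ q - 1 - q * (d / x)) := by
  have hx' : 0 < |x| := abs_pos.2 hx
  unfold breg powDeriv
  have h1 : |x + d| ^ q = |x| ^ q * |1 + d / x| ^ q := by
    rw [← Real.mul_rpow hx'.le (abs_nonneg _), ← abs_mul]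
    congr 2; field_simp
  have h2 : |x| ^ (q - 2) = |x| ^ q / x ^ 2 := by
    rw [Real.rpow_sub hx', Real.rpow_two, sq_abs]
  rw [h1, h2]
  field_simp

lemma breg_zero_left {q d : ℝ} (hq : 1 < q) : breg q 0 d = |d| ^ q := by
  unfold breg powDeriv
  rw [abs_zero, Real.zero_rpow (by linarith)]; simp

lemma breg_lower {q : ℝ} (hq : 1 < q) (hq2 : q ≤ 2) (x d : ℝ) :
    (q - 1) / 16 * quadPow q x d ≤ breg q x d := by
  by_cases hx : x = 0
  · subst hx
    rw [quadPow_zero_left hq, breg_zero_left hq]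
    have : 0 ≤ |d| ^ q := by positivity
    nlinarith
  · rw [quadPow_scale hx, breg_scale hx]
    have h := breg_one_lower (t := d / x) hq hq2
    have h0 : 0 ≤ |x| ^ q := by positivity
    nlinarith [mul_le_mul_of_nonneg_left h h0]

lemma breg_upper {q : ℝ} (hq : 1 < q) (hq2 : q ≤ 2) (x d : ℝ) :
    breg q x d ≤ 4 * quadPow q x d := by
  by_cases hx : x = 0
  · subst hx
    rw [quadPow_zero_left hq, breg_zero_left hq]
    have : 0 ≤ |d| ^ q := by positivity
    nlinarith
  · rw [quadPow_scale hx, breg_scale hx]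
    have h := breg_one_upper (t := d / x) hq hq2
    have h0 : 0 ≤ |x| ^ q := by positivity
    nlinarith [mul_le_mul_of_nonneg_left h h0]

lemma quadPow_nonneg (q x d : ℝ) : 0 ≤ quadPow q x d := by
  unfold quadPow; split_ifs <;> positivity

lemma breg_nonneg {q : ℝ} (hq : 1 < q) (hq2 : q ≤ 2) (x d : ℝ) : 0 ≤ breg q x d :=
  le_trans (mul_nonneg (by linarith) (quadPow_nonneg q x d)) (breg_lower hq hq2 x d)

lemma quadPow_le_breg {q : ℝ} (hq : 1 < q) (hq2 : q ≤ 2) (x d : ℝ) :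
    quadPow q x d ≤ 16 / (q - 1) * breg q x d := by
  have h := breg_lower hq hq2 x d
  have hs : 0 < q - 1 := by linarith
  rw [div_mul_eq_mul_div, le_div_iff₀ hs]; linarith

lemma sq_mul_rpow_le {q x d : ℝ} (hq2 : q ≤ 2) (h : |d| ≤ |x|) :
    d ^ 2 * |x| ^ (q - 2) ≤ |d| ^ q := by
  by_cases hd : d = 0
  · subst hd; simp; positivity
  · have hd' : 0 < |d| := abs_pos.2 hd
    have : |x| ^ (q - 2) ≤ |d| ^ (q - 2) :=
      Real.rpow_le_rpow_of_nonpos hd' h (by linarith)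
    calc d ^ 2 * |x| ^ (q - 2) ≤ d ^ 2 * |d| ^ (q - 2) := by gcongr
      _ = |d| ^ q := by
        rw [Real.rpow_sub hd', Real.rpow_two, sq_abs]; field_simp

lemma quadPow_le_rpow {q : ℝ} (hq2 : q ≤ 2) (x d : ℝ) : quadPow q x d ≤ |d| ^ q := by
  unfold quadPow
  split_ifs with h
  · exact sq_mul_rpow_le hq2 h
  · exact le_rfl

/-- The factor is `β^q`, not `β^2`: the move may lie in the range where the growth is of order
`|d|^q`. The surplus `β^(q-1)` over linear scaling is all that damping gains. -/
lemma quadPow_mul_le {q β : ℝ} (hq2 : q ≤ 2) (hβ : 0 < β) (hβ1 : β ≤ 1) (x d : ℝ) :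
    quadPow q x (β * d) ≤ β ^ q * quadPow q x d := by
  have h1 : |β * d| ^ q = β ^ q * |d| ^ q := by
    rw [abs_mul, abs_of_pos hβ, Real.mul_rpow hβ.le (abs_nonneg _)]
  by_cases h : |d| ≤ |x|
  · have h' : |β * d| ≤ |x| := by
      rw [abs_mul, abs_of_pos hβ]; nlinarith [abs_nonneg d]
    unfold quadPow
    rw [if_pos h, if_pos h', mul_pow, mul_assoc]
    have : β ^ 2 ≤ β ^ q := by
      rw [← Real.rpow_two]
      exact Real.rpow_le_rpow_of_exponent_ge hβ hβ1 hq2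
    gcongr
  · have : quadPow q x d = |d| ^ q := by unfold quadPow; rw [if_neg h]
    rw [this, ← h1]
    exact quadPow_le_rpow hq2 _ _

/-- Weighted arithmetic–geometric mean in the quadratic range; elsewhere the term is already
dominated by `|d|^q`. The free parameter `ρ` is tuned differently at each use, always so that the
`|x|^q` part can be absorbed. -/
lemma abs_powDeriv_mul_le {q : ℝ} (hq : 1 < q) (hq2 : q ≤ 2) (x d : ℝ) {ρ : ℝ} (hρ : 0 < ρ) :
    |powDeriv q x * d| ≤ ρ * |x| ^ q + (1 / ρ + 2) * quadPow q x d := by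
  by_cases hx : x = 0
  · subst hx
    have := quadPow_nonneg q 0 d
    have h0 : |powDeriv q 0 * d| = 0 := by simp [powDeriv]
    rw [h0]; positivity
  have hx' : 0 < |x| := abs_pos.2 hx
  have h1 : |powDeriv q x * d| = q * (|x| * |x| ^ (q - 2) * |d|) := by
    unfold powDeriv
    rw [abs_mul, abs_mul, abs_mul, abs_of_pos (by linarith : 0 < q),
      abs_of_nonneg (by positivity : 0 ≤ |x| ^ (q - 2))]
    ring
  have hxq : |x| ^ q = |x| ^ (q - 2) * |x| ^ 2 := by
    rw [Real.rpow_sub hx', Real.rpow_two]; field_simp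
  have hpos : 0 < |x| ^ (q - 2) := Real.rpow_pos_of_pos hx' _
  rw [h1]
  unfold quadPow
  split_ifs with h
  · rw [hxq, ← sq_abs d]
    set X := |x|
    set Dd := |d|
    set W := X ^ (q - 2)
    have hD : 0 ≤ Dd := abs_nonneg _
    have key : 2 * (X * Dd) ≤ ρ * X ^ 2 + 1 / ρ * Dd ^ 2 := by
      have : ρ * X ^ 2 + 1 / ρ * Dd ^ 2 - 2 * (X * Dd) = ρ * (X - Dd / ρ) ^ 2 := by
        field_simp; ring
      nlinarith [mul_nonneg hρ.le (sq_nonneg (X - Dd / ρ))]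
    have := mul_le_mul_of_nonneg_left key hpos.le
    have h3 : 0 ≤ W * (X * Dd) := by positivity
    have h4 : 0 ≤ Dd ^ 2 * W := by positivity
    nlinarith
  · push Not at h
    have e1 : |x| * |x| ^ (q - 2) = |x| ^ (q - 1) := by
      rw [mul_comm, ← Real.rpow_add_one hx'.ne']; ring_nf
    have e2 : |x| ^ (q - 1) ≤ |d| ^ (q - 1) :=
      Real.rpow_le_rpow hx'.le h.le (by linarith)
    have e3 : |d| ^ q = |d| ^ (q - 1) * |d| := by
      rw [← Real.rpow_add_one (by linarith)]; ring_nf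
    rw [e1, e3]
    have e4 : |x| ^ (q - 1) * |d| ≤ |d| ^ (q - 1) * |d| := by gcongr
    have e5 : 0 ≤ |d| ^ (q - 1) * |d| := by positivity
    have e6 : 0 ≤ ρ * |x| ^ q := by positivity
    have e7 : 0 ≤ 1 / ρ * (|d| ^ (q - 1) * |d|) := by positivity
    have e8 : 0 ≤ |x| ^ (q - 1) * |d| := by positivity
    nlinarith

lemma add_rpow_le_two_mul {q a b : ℝ} (hq : 1 < q) (hq2 : q ≤ 2) (ha : 0 ≤ a) (hb : 0 ≤ b) :
    (a + b) ^ q ≤ 2 * (a ^ q + b ^ q) := by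
  have h : (a + b) ^ q ≤ 2 ^ (q - 1) * (a ^ q + b ^ q) := by
    lift a to NNReal using ha
    lift b to NNReal using hb
    exact_mod_cast NNReal.rpow_add_le_mul_rpow_add_rpow a b hq.le
  have h2 : (2 : ℝ) ^ (q - 1) ≤ 2 := by
    calc (2 : ℝ) ^ (q - 1) ≤ 2 ^ (1 : ℝ) :=
          Real.rpow_le_rpow_of_exponent_le (by norm_num) (by linarith)
      _ = 2 := by norm_num
  refine h.trans ?_
  gcongr

lemma abs_rpow_le_of_add {q : ℝ} (hq : 1 < q) (hq2 : q ≤ 2) (x d : ℝ) :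
    |d| ^ q ≤ 2 * (|x + d| ^ q + |x| ^ q) := by
  refine le_trans ?_ (add_rpow_le_two_mul hq hq2 (abs_nonneg _) (abs_nonneg _))
  apply Real.rpow_le_rpow (abs_nonneg _) _ (by linarith)
  calc |d| = |(x + d) - x| := by ring_nf
    _ ≤ _ := abs_sub _ _

/-- `|d| ^ (p q)` is controlled by the local growth. -/
lemma rpow_mul_le_quadPow {q : ℝ} (hq : 1 < q) {p : ℕ} (hp : 2 ≤ p) (x d : ℝ)
    {R : ℝ} (hx : |x| ^ q ≤ R) (hd : |d| ^ q ≤ R) :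
    |d| ^ ((p : ℝ) * q) ≤ R ^ (p - 1) * quadPow q x d := by
  obtain ⟨n, rfl⟩ : ∃ n, p = n + 2 := ⟨p - 2, by omega⟩
  have hR : 0 ≤ R := le_trans (by positivity) hx
  have hpow : ∀ t : ℝ, 0 ≤ t → t ^ (((n + 2 : ℕ) : ℝ) * q) = (t ^ q) ^ (n + 1) * t ^ q := by
    intro t ht
    rw [mul_comm, Real.rpow_mul ht, Real.rpow_natCast, pow_succ]
  have hn : n + 2 - 1 = n + 1 := rfl
  rw [hn]
  unfold quadPow
  split_ifs with h
  · by_cases hd0 : d = 0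
    · subst hd0
      rw [abs_zero, Real.zero_rpow (by positivity)]
      simp
    have hd' : 0 < |d| := abs_pos.2 hd0
    have hx' : 0 < |x| := lt_of_lt_of_le hd' h
    have e1 : |d| ^ (((n + 2 : ℕ) : ℝ) * q) = |d| ^ (((n + 2 : ℕ) : ℝ) * q - 2) * d ^ 2 := by
      rw [Real.rpow_sub hd', Real.rpow_two, sq_abs]; field_simp
    have e2 : |d| ^ (((n + 2 : ℕ) : ℝ) * q - 2) ≤ |x| ^ (((n + 2 : ℕ) : ℝ) * q - 2) := by
      apply Real.rpow_le_rpow hd'.le h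
      push_cast
      nlinarith [(Nat.cast_nonneg n : (0 : ℝ) ≤ n)]
    have e3 : |x| ^ (((n + 2 : ℕ) : ℝ) * q - 2) = (|x| ^ q) ^ (n + 1) * |x| ^ (q - 2) := by
      rw [Real.rpow_sub hx', hpow _ hx'.le, Real.rpow_sub hx']; ring
    have e4 : (|x| ^ q) ^ (n + 1) ≤ R ^ (n + 1) := by gcongr
    calc _ = |d| ^ (((n + 2 : ℕ) : ℝ) * q - 2) * d ^ 2 := e1
      _ ≤ ((|x| ^ q) ^ (n + 1) * |x| ^ (q - 2)) * d ^ 2 := by rw [← e3]; gcongr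
      _ ≤ (R ^ (n + 1) * |x| ^ (q - 2)) * d ^ 2 := by gcongr
      _ = _ := by ring
  · rw [hpow _ (abs_nonneg _)]
    gcongr

/-! ### One step of a damped block update -/

/-- The weight of the term `|d| ^ (p q)` in the local model. -/
def tailWeight (q : ℝ) (p : ℕ) : ℝ := (q - 1) / 64 ^ p

lemma tailWeight_pos {q : ℝ} (hq : 1 < q) (p : ℕ) : 0 < tailWeight q p := by
  unfold tailWeight
  have : 0 < q - 1 := by linarith
  positivity

/-- Relative changes of at most `1/p` keep `p τ / u` in the range where the exponential is bounded
by its quadratic expansion. -/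
lemma pow_add_le_quadratic {p : ℕ} (hp : 1 ≤ p) {u τ : ℝ} (hu : 0 < u) (hτ : |τ| ≤ u / p) :
    (u + τ) ^ p ≤ u ^ p + p * u ^ (p - 1) * τ + p ^ 2 * u ^ (p - 1) * (τ ^ 2 / u) := by
  have hp0 : (0 : ℝ) < p := by exact_mod_cast hp
  set r := τ / u with hr
  have hτr : τ = u * r := by rw [hr]; field_simp
  have h1 : |p * r| ≤ 1 := by
    rw [hr, abs_mul, abs_div, abs_of_pos hp0, abs_of_pos hu]
    rw [le_div_iff₀ hp0] at hτ
    rw [← mul_div_assoc, div_le_one hu]; linarith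
  have h2 := Real.abs_exp_sub_one_sub_id_le h1
  have h3 : 0 ≤ 1 + r := by
    have := (abs_le.1 hτ).1
    have h4 : u / p ≤ u := div_le_self hu.le (by exact_mod_cast hp)
    have : 0 ≤ u * (1 + r) := by rw [mul_add, ← hτr]; linarith
    exact nonneg_of_mul_nonneg_right this hu
  have h4 : (1 + r) ^ p ≤ Real.exp (p * r) := by
    rw [Real.exp_nat_mul]
    gcongr
    rw [add_comm]; exact Real.add_one_le_exp r
  have h5 : (1 + r) ^ p ≤ 1 + p * r + (p * r) ^ 2 := by
    have := (abs_le.1 h2).2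
    linarith
  have h6 : u ^ p = u ^ (p - 1) * u := by
    rw [← pow_succ]; congr 1; omega
  calc (u + τ) ^ p = u ^ p * (1 + r) ^ p := by rw [hτr, ← mul_pow]; ring
    _ ≤ u ^ p * (1 + p * r + (p * r) ^ 2) := by gcongr
    _ = _ := by rw [h6, hτr]; field_simp

/-- When `|τ|` exceeds `u/p` no expansion is useful; both `u + τ` and the linear term are bounded by
powers of `(p+1)|τ|`. The tail term of the local model exists to pay for this case. -/
lemma pow_add_le_of_large {p : ℕ} (hp : 1 ≤ p) {u τ : ℝ} (hu : 0 ≤ u) (huτ : 0 ≤ u + τ)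
    (hτ : u < p * |τ|) :
    (u + τ) ^ p ≤ u ^ p + p * u ^ (p - 1) * τ + ((p + 1) * |τ|) ^ p := by
  rcases le_total 0 τ with h | h
  · rw [abs_of_nonneg h] at hτ ⊢
    have : (u + τ) ^ p ≤ ((p + 1) * τ) ^ p := by
      gcongr; linarith
    have h1 : 0 ≤ u ^ p := by positivity
    have h2 : 0 ≤ p * u ^ (p - 1) * τ := by positivity
    linarith
  · obtain ⟨t, rfl⟩ : ∃ t, τ = -t := ⟨-τ, by ring⟩
    have ht : 0 ≤ t := by linarith
    rw [abs_neg, abs_of_nonneg ht] at hτ ⊢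
    have h1 : (u + -t) ^ p ≤ u ^ p := by gcongr; linarith
    have h2 : p * u ^ (p - 1) * t ≤ ((p + 1) * t) ^ p := by
      obtain ⟨n, rfl⟩ : ∃ n, p = n + 1 := ⟨p - 1, by omega⟩
      rw [Nat.add_sub_cancel, pow_succ]
      have h3 : u ^ n ≤ (((n + 1 : ℕ) + 1) * t) ^ n := by
        gcongr; push_cast at hτ ⊢; linarith
      calc ((n + 1 : ℕ) : ℝ) * u ^ n * t = u ^ n * ((n + 1 : ℕ) * t) := by ring
        _ ≤ (((n + 1 : ℕ) + 1) * t) ^ n * (((n + 1 : ℕ) + 1) * t) := by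
          gcongr; linarith
    linarith

set_option maxHeartbeats 1000000 in
/-- A damped move of one entry increases the `p`-th power of the load by at most its linear part
and a small multiple of the local model. -/
lemma load_step {q : ℝ} (hq : 1 < q) (hq2 : q ≤ 2) {p : ℕ} (hp : 3 ≤ p) {β : ℝ} (hβ : 0 < β)
    (hβ1 : β ≤ 1) (hβq : β ^ (q - 1) ≤ (q - 1) / (2048 * p ^ 2)) (x e : ℝ) {u : ℝ}
    (hu : |x| ^ q ≤ u) :
    (u + (|x + β * e| ^ q - |x| ^ q)) ^ p ≤ u ^ p + p * u ^ (p - 1) * (β * (powDeriv q x * e)) +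
      β / 2 * (p / 2 * u ^ (p - 1) * breg q x e + tailWeight q p * |e| ^ ((p : ℝ) * q)) := by
  have hs : 0 < q - 1 := by linarith
  have hp0 : (3 : ℝ) ≤ p := by exact_mod_cast hp
  have hy : 0 ≤ |x| ^ q := by positivity
  have hu0 : 0 ≤ u := hy.trans hu
  set g := quadPow q x (β * e) with hg
  set D := breg q x e with hD
  have hD0 : 0 ≤ D := breg_nonneg hq hq2 x e
  have hg0 : 0 ≤ g := quadPow_nonneg _ _ _
  have hβqe : β ^ q = β * β ^ (q - 1) := by
    rw [mul_comm, ← Real.rpow_add_one hβ.ne']; ring_nf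
  set B := β ^ (q - 1) with hB
  have hB0 : 0 < B := Real.rpow_pos_of_pos hβ _
  -- The smallness of `β^(q-1)` is spent here: it outweighs the loss `16/(q-1)` in passing from
  -- `quadPow` to the divergence and leaves a factor of order `1/p^2`.
  have hg1 : g ≤ β * D * (1 / (128 * p ^ 2)) := by
    have h1 := quadPow_mul_le hq2 hβ hβ1 x e
    have h2 := quadPow_le_breg hq hq2 x e
    calc g ≤ β ^ q * quadPow q x e := h1
      _ ≤ (β * B) * (16 / (q - 1) * D) := by rw [hβqe]; gcongr
      _ ≤ (β * ((q - 1) / (2048 * p ^ 2))) * (16 / (q - 1) * D) := by gcongr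
      _ = _ := by field_simp; ring
  have hg2 : g ≤ β * B * |e| ^ q := by
    have := quadPow_le_rpow hq2 x (β * e)
    rw [abs_mul, abs_of_pos hβ, Real.mul_rpow hβ.le (abs_nonneg _), hβqe] at this
    exact this
  set Db := breg q x (β * e) with hDb
  have hDb1 : Db ≤ 4 * g := breg_upper hq hq2 _ _
  have hDb0 : 0 ≤ Db := breg_nonneg hq hq2 _ _
  set τ := |x + β * e| ^ q - |x| ^ q with hτ
  have hτe : τ = β * (powDeriv q x * e) + Db := by
    rw [hτ, hDb, breg]; ring
  have hτρ : ∀ ρ : ℝ, 0 < ρ → |τ| ≤ ρ * |x| ^ q + (1 / ρ + 6) * g := by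
    intro ρ hρ
    have h1 := abs_powDeriv_mul_le hq hq2 x (β * e) hρ
    have h2 : |τ| ≤ |powDeriv q x * (β * e)| + |Db| := by
      rw [hτe, show β * (powDeriv q x * e) = powDeriv q x * (β * e) by ring]
      exact abs_add_le _ _
    rw [abs_of_nonneg hDb0] at h2
    rw [← hg] at h1
    linarith
  have hun : 0 ≤ u ^ (p - 1) := by positivity
  have huτ : 0 ≤ u + τ := by
    have : 0 ≤ |x + β * e| ^ q := by positivity
    rw [hτ]; linarith
  have hlin : p * u ^ (p - 1) * τ = p * u ^ (p - 1) * (β * (powDeriv q x * e)) +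
      p * u ^ (p - 1) * Db := by rw [hτe]; ring
  have hN0 : 0 ≤ |e| ^ ((p : ℝ) * q) := by positivity
  have hc2 := (tailWeight_pos hq p).le
  rcases le_or_gt |τ| (u / p) with hc | hc
  · rcases eq_or_lt_of_le hu0 with h0 | h0
    · have hτ0 : τ = 0 := by
        rw [← h0] at hc; simpa using hc
      have hDb' : Db = -(β * (powDeriv q x * e)) := by linarith
      rw [hτ0, add_zero]
      have : u ^ (p - 1) = 0 := by rw [← h0, zero_pow]; omega
      rw [this]
      have : 0 ≤ tailWeight q p * |e| ^ ((p : ℝ) * q) := by positivity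
      have := mul_nonneg hβ.le this
      linarith
    · have hτ2 : τ ^ 2 / u ≤ 8 * g := by
        rw [div_le_iff₀ h0]
        rcases eq_or_lt_of_le (abs_nonneg τ) with h1 | h1
        · have : τ = 0 := abs_eq_zero.1 h1.symm
          rw [this]
          nlinarith [mul_nonneg hg0 h0.le]
        -- This `ρ` makes `ρ |x|^q ≤ |τ|/2`, which moves to the left; multiplying by `|τ|` then
        -- bounds `τ^2` by a multiple of `u g`.
        · have h2 := hτρ (|τ| / (2 * u)) (by positivity)
          have h3 : |τ| / (2 * u) * |x| ^ q ≤ |τ| / 2 := by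
            calc |τ| / (2 * u) * |x| ^ q ≤ |τ| / (2 * u) * u := by gcongr
              _ = |τ| / 2 := by field_simp
          have h4 : |τ| / 2 ≤ (1 / (|τ| / (2 * u)) + 6) * g := by linarith
          have h5 := mul_le_mul_of_nonneg_left h4 h1.le
          have h6 : |τ| * ((1 / (|τ| / (2 * u)) + 6) * g) = 2 * u * g + 6 * |τ| * g := by
            field_simp
          have h7 : |τ| ≤ u / 3 := hc.trans (by gcongr)
          rw [h6] at h5
          have h8 : τ ^ 2 = |τ| * |τ| := by rw [← sq_abs]; ring
          rw [h8]
          nlinarith [mul_le_mul_of_nonneg_right h7 hg0]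
      have hq' := pow_add_le_quadratic (by omega) h0 hc
      have h1 : p ^ 2 * u ^ (p - 1) * (τ ^ 2 / u) ≤ p ^ 2 * u ^ (p - 1) * (8 * g) := by gcongr
      have h2 : p * u ^ (p - 1) * Db ≤ p * u ^ (p - 1) * (4 * g) := by gcongr
      have h3 : p * u ^ (p - 1) * (4 * g) ≤ p ^ 2 * u ^ (p - 1) * (2 * g) := by
        have h9 : (0:ℝ) ≤ u ^ (p - 1) * g := by positivity
        have h10 : (0 : ℝ) ≤ (p ^ 2 * 2 - p * 4) := by nlinarith
        have := mul_nonneg h10 h9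
        linarith
      have h4 : (p : ℝ) ^ 2 * u ^ (p - 1) * (10 * g) ≤ β / 4 * (p * u ^ (p - 1) * D) := by
        calc (p : ℝ) ^ 2 * u ^ (p - 1) * (10 * g)
            ≤ p ^ 2 * u ^ (p - 1) * (10 * (β * D * (1 / (128 * p ^ 2)))) := by gcongr
          _ = β * (u ^ (p - 1) * D) * (10 / 128) := by field_simp
          _ ≤ β / 4 * (p * u ^ (p - 1) * D) := by
            have h9 : 0 ≤ β * (u ^ (p - 1) * D) := by positivity
            have := mul_le_mul_of_nonneg_right hp0 h9
            linarith
      have h5 : 0 ≤ β / 2 * (tailWeight q p * |e| ^ ((p : ℝ) * q)) := by positivity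
      linarith
  · have hc' : u < p * |τ| := by
      rwa [div_lt_iff₀ (by linarith), mul_comm] at hc
    have h1 := pow_add_le_of_large (by omega) hu0 huτ hc'
    have h2 : |τ| ≤ 8 * p * g := by
      -- Since `|x|^q ≤ u < p |τ|`, this choice of `ρ` again makes the first term at most `|τ|/2`.
      have h3 := hτρ (1 / (2 * p)) (by positivity)
      have h4 : 1 / (2 * p) * |x| ^ q ≤ |τ| / 2 := by
        calc 1 / (2 * p) * |x| ^ q ≤ 1 / (2 * p) * (p * |τ|) := by gcongr; linarith
          _ = |τ| / 2 := by field_simp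
      have h5 : (1 / (1 / (2 * (p : ℝ))) + 6) * g = (2 * p + 6) * g := by
        rw [one_div_one_div]
      rw [h5] at h3
      nlinarith
    have h3 : ((p + 1) * |τ|) ^ p ≤ β / 2 * (tailWeight q p * |e| ^ ((p : ℝ) * q)) := by
      have e1 : (p + 1) * |τ| ≤ (16 * p ^ 2 * (β * B)) * |e| ^ q := by
        calc (p + 1) * |τ| ≤ (2 * p) * (8 * p * (β * B * |e| ^ q)) := by
              gcongr
              · linarith
              · exact h2.trans (by gcongr)
          _ = _ := by ring
      have e2 : |e| ^ ((p : ℝ) * q) = (|e| ^ q) ^ p := by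
        rw [mul_comm, Real.rpow_mul (abs_nonneg _), Real.rpow_natCast]
      -- The base is below one, so its `p`-th power is no larger than itself. The factor `1024 = 64
      -- * 16` leaves the `64^p` that is the denominator of `tailWeight`.
      have e3 : (1024 * p ^ 2 * (β * B)) ^ p ≤ β / 2 * (q - 1) := by
        have a1 : 1024 * p ^ 2 * (β * B) ≤ β / 2 * (q - 1) := by
          calc 1024 * p ^ 2 * (β * B) ≤ 1024 * p ^ 2 * (β * ((q - 1) / (2048 * p ^ 2))) := by gcongr
            _ = _ := by field_simp; norm_num
        have a2 : β / 2 * (q - 1) ≤ 1 := by nlinarith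
        calc (1024 * p ^ 2 * (β * B)) ^ p ≤ (1024 * p ^ 2 * (β * B)) ^ 1 :=
              pow_le_pow_of_le_one (by positivity) (a1.trans a2) (by omega)
          _ ≤ _ := by rw [pow_one]; exact a1
      calc ((p + 1) * |τ|) ^ p ≤ ((16 * p ^ 2 * (β * B)) * |e| ^ q) ^ p := by gcongr
        _ = (1024 * p ^ 2 * (β * B)) ^ p / 64 ^ p * (|e| ^ q) ^ p := by
          rw [mul_pow, ← div_pow]; congr 2; ring
        _ ≤ (β / 2 * (q - 1)) / 64 ^ p * (|e| ^ q) ^ p := by gcongr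
        _ = _ := by rw [e2, tailWeight]; ring
    have h4 : p * u ^ (p - 1) * Db ≤ β / 4 * (p * u ^ (p - 1) * D) := by
      have a1 : Db ≤ β / 4 * D := by
        calc Db ≤ 4 * (β * D * (1 / (128 * p ^ 2))) := by linarith
          _ ≤ 4 * (β * D * (1 / 16)) := by
            gcongr
            nlinarith
          _ = _ := by ring
      calc p * u ^ (p - 1) * Db ≤ p * u ^ (p - 1) * (β / 4 * D) := by gcongr
        _ = _ := by ring
    linarith

/-- The damped divergence is much smaller than the divergence. -/
lemma breg_mul_le {q : ℝ} (hq : 1 < q) (hq2 : q ≤ 2) {p : ℕ} (hp : 3 ≤ p) {β : ℝ} (hβ : 0 < β)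
    (hβ1 : β ≤ 1) (hβq : β ^ (q - 1) ≤ (q - 1) / (2048 * p ^ 2)) (x e : ℝ) :
    breg q x (β * e) ≤ β * breg q x e := by
  have hs : 0 < q - 1 := by linarith
  have hp0 : (3 : ℝ) ≤ p := by exact_mod_cast hp
  have hβqe : β ^ q = β * β ^ (q - 1) := by
    rw [mul_comm, ← Real.rpow_add_one hβ.ne']; ring_nf
  have hD0 : 0 ≤ breg q x e := breg_nonneg hq hq2 x e
  calc breg q x (β * e) ≤ 4 * quadPow q x (β * e) := breg_upper hq hq2 _ _
    _ ≤ 4 * (β ^ q * quadPow q x e) := by gcongr; exact quadPow_mul_le hq2 hβ hβ1 x e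
    _ ≤ 4 * ((β * β ^ (q - 1)) * (16 / (q - 1) * breg q x e)) := by
      rw [hβqe]; gcongr; exact quadPow_le_breg hq hq2 x e
    _ ≤ 4 * ((β * ((q - 1) / (2048 * p ^ 2))) * (16 / (q - 1) * breg q x e)) := by gcongr
    _ = (β * breg q x e) * (1 / (32 * p ^ 2)) := by field_simp; ring
    _ ≤ (β * breg q x e) * 1 := by
      gcongr
      rw [div_le_one (by positivity)]; nlinarith
    _ = _ := mul_one _

/-! ### Loads of one row along a pass -/

open Finset in
/-- The data of one row along a pass: `u` are the successive loads, `y` the initial entries, `s, D, N`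
describe a comparison direction and `sh, Dh, Nh` the direction in which the pass moves. -/
structure PassRow (p k : ℕ) (β K c Z : ℝ) (y s D N sh Dh Nh u : ℕ → ℝ) : Prop where
  three_le : 3 ≤ p
  step_pos : 0 < β
  step_small : β * (30000000 * p ^ 3 * K ^ 4) ≤ 1
  one_le : 1 ≤ K
  weight_nonneg : 0 ≤ c
  y_nonneg : ∀ j, 0 ≤ y j
  D_nonneg : ∀ j, 0 ≤ D j
  Dh_nonneg : ∀ j, 0 ≤ Dh j
  Nh_nonneg : ∀ j, 0 ≤ Nh j
  Z_nonneg : 0 ≤ Z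
  load_zero : u 0 = ∑ j ∈ range k, y j
  load_nonneg : ∀ j ≤ k, 0 ≤ u j
  drift : ∀ j < k, |u (j + 1) - u j| ≤ β * (|sh j| + Dh j)
  growth : ∀ j < k, u (j + 1) ^ p ≤ u j ^ p + p * u j ^ (p - 1) * (β * sh j) +
    β / 2 * (p / 2 * u j ^ (p - 1) * Dh j + c * Nh j)
  lin : ∀ j < k, ∀ ρ : ℝ, 0 < ρ → |s j| ≤ ρ * y j + K * (1 + 1 / ρ) * D j
  linh : ∀ j < k, ∀ ρ : ℝ, 0 < ρ → |sh j| ≤ ρ * y j + K * (1 + 1 / ρ) * Dh j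
  base : p * (∑ j ∈ range k, y j) ^ (p - 1) * ∑ j ∈ range k, (s j + D j / 2) +
      c * ∑ j ∈ range k, N j ≤
    Z ^ p - (∑ j ∈ range k, y j) ^ p -
      p / 4 * (∑ j ∈ range k, y j) ^ (p - 1) * ∑ j ∈ range k, D j
  total : ∑ j ∈ range k, D j ≤ 8 * (Z + ∑ j ∈ range k, y j)
  tail : c * ∑ j ∈ range k, N j ≤ 1 / 4 * (Z ^ p + (∑ j ∈ range k, y j) ^ p)

namespace PassRow

open Finset

variable {p k : ℕ} {β K c Z : ℝ} {y s D N sh Dh Nh u : ℕ → ℝ}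

/-- The local model evaluated along the pass. -/
def model (p k : ℕ) (c : ℝ) (Dh Nh u : ℕ → ℝ) : ℝ :=
  ∑ j ∈ range k, (p / 2 * u j ^ (p - 1) * Dh j + c * Nh j)

lemma one_le_p (h : PassRow p k β K c Z y s D N sh Dh Nh u) : (3 : ℝ) ≤ p := by
  exact_mod_cast h.three_le

lemma z_nonneg (h : PassRow p k β K c Z y s D N sh Dh Nh u) : 0 ≤ ∑ j ∈ range k, y j :=
  sum_nonneg fun j _ => h.y_nonneg j

lemma model_term_nonneg (h : PassRow p k β K c Z y s D N sh Dh Nh u) {j : ℕ} (hj : j < k) :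
    0 ≤ p / 2 * u j ^ (p - 1) * Dh j + c * Nh j := by
  have := h.load_nonneg j hj.le
  have := h.Dh_nonneg j
  have := h.Nh_nonneg j
  have := h.weight_nonneg
  positivity

lemma model_nonneg (h : PassRow p k β K c Z y s D N sh Dh Nh u) : 0 ≤ model p k c Dh Nh u :=
  sum_nonneg fun _ hj => h.model_term_nonneg (mem_range.1 hj)

/-- All smallness requirements on `β` in the two cases follow from the single field `step_small` by
monotonicity in the powers of `p` and `K`. -/
lemma small (h : PassRow p k β K c Z y s D N sh Dh Nh u) {a : ℝ} {i l : ℕ}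
    (ha2 : a ≤ 30000000) (hi : i ≤ 3) (hl : l ≤ 4) : β * (a * p ^ i * K ^ l) ≤ 1 := by
  refine le_trans ?_ h.step_small
  have h1 := h.one_le_p
  have h2 := h.one_le
  have h3 := h.step_pos
  have e1 : (p : ℝ) ^ i ≤ p ^ 3 := pow_le_pow_right₀ (by linarith) hi
  have e2 : K ^ l ≤ K ^ 4 := pow_le_pow_right₀ h2 hl
  gcongr

lemma term_le_model (h : PassRow p k β K c Z y s D N sh Dh Nh u) {j : ℕ} (hj : j ≤ k) :
    ∑ l ∈ range j, (p / 2 * u l ^ (p - 1) * Dh l) ≤ model p k c Dh Nh u := by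
  refine le_trans ?_ (sum_le_sum_of_subset_of_nonneg (range_mono hj)
    fun l hl _ => h.model_term_nonneg (mem_range.1 hl))
  refine sum_le_sum fun l _ => ?_
  have := mul_nonneg h.weight_nonneg (h.Nh_nonneg l)
  linarith

/-- All loads are bounded by the initial load and a small multiple of the model. -/
lemma exists_max_load (h : PassRow p k β K c Z y s D N sh Dh Nh u) :
    ∃ U : ℝ, (∀ j ≤ k, u j ≤ U) ∧
      U ^ p ≤ 2 * (∑ j ∈ range k, y j) ^ p + 10 * β * K * model p k c Dh Nh u := by
  obtain ⟨j0, hj0, hmax⟩ := exists_max_image (range (k + 1)) u ⟨0, by simp⟩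
  have hj0k : j0 ≤ k := by have := mem_range.1 hj0; omega
  have hmax' : ∀ j ≤ k, u j ≤ u j0 := fun j hj => hmax j (mem_range.2 (by omega))
  refine ⟨u j0, hmax', ?_⟩
  have hp := h.one_le_p
  have hβ := h.step_pos
  have hK := h.one_le
  have hz := h.z_nonneg
  set z := ∑ j ∈ range k, y j with hzdef
  set U := u j0
  have hU0 : 0 ≤ U := h.load_nonneg j0 hj0k
  have hzU : z ≤ U := by rw [hzdef, ← h.load_zero]; exact hmax' 0 (Nat.zero_le _)
  have h2p : 2 * p * β ≤ 1 := by
    have := h.small (a := 2) (i := 1) (l := 0) (by norm_num) (by norm_num) (by norm_num)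
    simp only [pow_one, pow_zero, mul_one] at this
    linarith
  have step : ∀ l < k, u (l + 1) ^ p - u l ^ p ≤ 1 / 2 * U ^ (p - 1) * y l +
      (4 * β * K) * (p / 2 * u l ^ (p - 1) * Dh l) +
      β / 2 * (p / 2 * u l ^ (p - 1) * Dh l + c * Nh l) := by
    intro l hl
    have g := h.growth l hl
    have hul := h.load_nonneg l hl.le
    have hDl := h.Dh_nonneg l
    have hyl := h.y_nonneg l
    -- With this `ρ` the part of the linear term involving `y` becomes `u^(p-1) y / 2`; summed over
    -- the blocks it is at most half of `U^p` and is absorbed on the left.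
    have b1 := h.linh l hl (1 / (2 * p * β)) (by positivity)
    rw [one_div_one_div] at b1
    have b2 : sh l ≤ 1 / (2 * p * β) * y l + K * (1 + 2 * p * β) * Dh l := (le_abs_self _).trans b1
    have b3 : K * (1 + 2 * p * β) * Dh l ≤ K * 2 * Dh l := by
      gcongr; linarith
    have b4 : p * u l ^ (p - 1) * (β * sh l) ≤
        p * u l ^ (p - 1) * (β * (1 / (2 * p * β) * y l + K * 2 * Dh l)) := by
      gcongr; linarith
    have b5 : p * u l ^ (p - 1) * (β * (1 / (2 * p * β) * y l + K * 2 * Dh l)) =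
        1 / 2 * u l ^ (p - 1) * y l + (4 * β * K) * (p / 2 * u l ^ (p - 1) * Dh l) := by
      field_simp; ring
    have b6 : 1 / 2 * u l ^ (p - 1) * y l ≤ 1 / 2 * U ^ (p - 1) * y l := by
      gcongr; exact hmax' l hl.le
    linarith
  have tele : U ^ p - z ^ p = ∑ l ∈ range j0, (u (l + 1) ^ p - u l ^ p) := by
    rw [sum_range_sub (fun l => u l ^ p), h.load_zero]
  have h1 : U ^ p - z ^ p ≤ ∑ l ∈ range j0, (1 / 2 * U ^ (p - 1) * y l +
      (4 * β * K) * (p / 2 * u l ^ (p - 1) * Dh l) +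
      β / 2 * (p / 2 * u l ^ (p - 1) * Dh l + c * Nh l)) := by
    rw [tele]
    exact sum_le_sum fun l hl => step l (by have := mem_range.1 hl; omega)
  rw [sum_add_distrib, sum_add_distrib, ← mul_sum, ← mul_sum, ← mul_sum] at h1
  have h2 : ∑ l ∈ range j0, y l ≤ z :=
    sum_le_sum_of_subset_of_nonneg (range_mono hj0k) fun l _ _ => h.y_nonneg l
  have h3 := h.term_le_model hj0k
  have h4 : ∑ l ∈ range j0, (p / 2 * u l ^ (p - 1) * Dh l + c * Nh l) ≤ model p k c Dh Nh u :=
    sum_le_sum_of_subset_of_nonneg (range_mono hj0k)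
      fun l hl _ => h.model_term_nonneg (mem_range.1 hl)
  have h5 : 1 / 2 * U ^ (p - 1) * ∑ l ∈ range j0, y l ≤ 1 / 2 * U ^ p := by
    have : U ^ p = U ^ (p - 1) * U := by
      rw [← pow_succ]; congr 1; have := h.three_le; omega
    rw [this, mul_assoc]
    have := h2.trans hzU
    gcongr
  have hG := h.model_nonneg
  have h6 : 4 * β * K * ∑ l ∈ range j0, (p / 2 * u l ^ (p - 1) * Dh l) ≤
      4 * β * K * model p k c Dh Nh u := by gcongr
  have h7 : β / 2 * ∑ l ∈ range j0, (p / 2 * u l ^ (p - 1) * Dh l + c * Nh l) ≤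
      β / 2 * model p k c Dh Nh u := by gcongr
  have h8 : β / 2 * model p k c Dh Nh u ≤ β * K * model p k c Dh Nh u := by
    gcongr; nlinarith
  linarith

/-- The case where the pass moves a lot. -/
lemma bound_of_large (h : PassRow p k β K c Z y s D N sh Dh Nh u)
    (hG : 4 * (5200 * p ^ 2 * K ^ 2) * (∑ j ∈ range k, y j) ^ p ≤ model p k c Dh Nh u) :
    ∑ j ∈ range k, (p * u j ^ (p - 1) * (s j + D j / 2) + c * N j) ≤
      Z ^ p - (∑ j ∈ range k, y j) ^ p + 1 / 2 * model p k c Dh Nh u := by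
  obtain ⟨U, hU, hUp⟩ := h.exists_max_load
  have hp := h.one_le_p
  have hβ := h.step_pos
  have hK := h.one_le
  have hz := h.z_nonneg
  have htot := h.total
  have htail := h.tail
  have hZ := h.Z_nonneg
  set z := ∑ j ∈ range k, y j with hzdef
  set G := model p k c Dh Nh u
  have hG0 : 0 ≤ G := h.model_nonneg
  have hzU : z ≤ U := by rw [hzdef, ← h.load_zero]; exact hU 0 (Nat.zero_le _)
  have hU0 : 0 ≤ U := hz.trans hzU
  have hpow : ∀ t : ℝ, t ^ p = t ^ (p - 1) * t := by
    intro t; rw [← pow_succ]; congr 1; have := h.three_le; omega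
  -- Of the two terms of `exists_max_load`, the one with `z^p` costs at most half of `G` by the case
  -- assumption, the one with `G` at most half by the choice of `β`.
  have hMU : 5200 * p ^ 2 * K ^ 2 * U ^ p ≤ G := by
    have e1 := h.small (a := 104000) (i := 2) (l := 3) (by norm_num) (by norm_num)
      (by norm_num)
    have e2 : 5200 * p ^ 2 * K ^ 2 * U ^ p ≤
        5200 * p ^ 2 * K ^ 2 * (2 * z ^ p + 10 * β * K * G) := by gcongr
    have e3 : 5200 * p ^ 2 * K ^ 2 * (10 * β * K * G) =
        1 / 2 * (β * (104000 * p ^ 2 * K ^ 3)) * G := by ring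
    have e4 : 1 / 2 * (β * (104000 * p ^ 2 * K ^ 3)) * G ≤ 1 / 2 * 1 * G := by gcongr
    nlinarith
  have hsum : ∑ j ∈ range k, (|s j| + D j) ≤ 25 * K * (Z + z) := by
    have e1 : ∑ j ∈ range k, (|s j| + D j) ≤ ∑ j ∈ range k, (y j + (2 * K + 1) * D j) := by
      refine sum_le_sum fun j hj => ?_
      have := h.lin j (mem_range.1 hj) 1 one_pos
      norm_num at this
      linarith
    have e3 : ∑ j ∈ range k, (y j + (2 * K + 1) * D j) =
        z + (2 * K + 1) * ∑ j ∈ range k, D j := by rw [sum_add_distrib, ← mul_sum]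
    rw [e3] at e1
    have e2 : (2 * K + 1) * ∑ j ∈ range k, D j ≤ (3 * K) * (8 * (Z + z)) := by
      gcongr
      · exact sum_nonneg fun j _ => h.D_nonneg j
      · linarith
    nlinarith
  have hL : ∑ j ∈ range k, p * u j ^ (p - 1) * (s j + D j / 2) ≤
      p * U ^ (p - 1) * (25 * K * (Z + z)) := by
    calc ∑ j ∈ range k, p * u j ^ (p - 1) * (s j + D j / 2)
        ≤ ∑ j ∈ range k, p * U ^ (p - 1) * (|s j| + D j) := by
          refine sum_le_sum fun j hj => ?_
          have hjk := mem_range.1 hj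
          have a1 := h.load_nonneg j hjk.le
          have a2 := hU j hjk.le
          have a3 := h.D_nonneg j
          calc p * u j ^ (p - 1) * (s j + D j / 2) ≤ p * u j ^ (p - 1) * (|s j| + D j) := by
                gcongr
                · exact le_abs_self _
                · linarith
            _ ≤ _ := by gcongr
      _ ≤ _ := by rw [← mul_sum]; gcongr
  have hzp : z ^ p ≤ U ^ p := by gcongr
  have hUZ : p * U ^ (p - 1) * (25 * K * Z) ≤ 1 / 4 * Z ^ p + 2500 * p ^ 2 * K ^ 2 * U ^ p := by
    -- Either `Z` is so large that `U^(p-1) Z` is a small part of `Z^p`, or `Z` is a bounded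
    -- multiple of `U` and the product is charged to `U^p`, that is, to the model.
    rcases le_total (100 * p * K * U) Z with hc | hc
    · have e1 : (100 * p * K * U) ^ (p - 1) ≤ Z ^ (p - 1) := by gcongr
      have e2 : 100 * p * K * U ^ (p - 1) ≤ (100 * p * K * U) ^ (p - 1) := by
        rw [mul_pow]
        gcongr
        have : 1 ≤ 100 * p * K := by nlinarith
        exact le_self_pow₀ this (by have := h.three_le; omega)
      have e3 : 100 * p * K * U ^ (p - 1) * Z ≤ Z ^ p := by
        rw [hpow Z]; gcongr; linarith
      have : 0 ≤ 2500 * p ^ 2 * K ^ 2 * U ^ p := by positivity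
      linarith
    · have e1 : p * U ^ (p - 1) * (25 * K * Z) ≤ p * U ^ (p - 1) * (25 * K * (100 * p * K * U)) := by
        gcongr
      have e2 : p * U ^ (p - 1) * (25 * K * (100 * p * K * U)) = 2500 * p ^ 2 * K ^ 2 * U ^ p := by
        rw [hpow U]; ring
      have : 0 ≤ Z ^ p := by positivity
      linarith
  have hUz : p * U ^ (p - 1) * (25 * K * z) ≤ 25 * p * K * U ^ p := by
    calc p * U ^ (p - 1) * (25 * K * z) ≤ p * U ^ (p - 1) * (25 * K * U) := by gcongr
      _ = _ := by rw [hpow U]; ring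
  have hUp0 : 0 ≤ U ^ p := by positivity
  -- Half of `5200` is `2500 + 100`: the `2500` serves `hUZ`, and the `100` must cover `hUz`
  -- together with `5/4 z^p`, made of `z^p` from the target and `z^p / 4` from the tail.
  have hnum : 25 * p * K + 5 / 4 ≤ 100 * p ^ 2 * K ^ 2 := by
    have : 1 ≤ p * K := by nlinarith
    nlinarith
  have hnum' := mul_le_mul_of_nonneg_right hnum hUp0
  have hL' : p * U ^ (p - 1) * (25 * K * (Z + z)) =
      p * U ^ (p - 1) * (25 * K * Z) + p * U ^ (p - 1) * (25 * K * z) := by ring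
  have hZp : 0 ≤ Z ^ p := by positivity
  rw [sum_add_distrib, ← mul_sum]
  linarith

set_option maxHeartbeats 1600000 in
/-- The case where the loads hardly change. -/
lemma bound_of_small (h : PassRow p k β K c Z y s D N sh Dh Nh u)
    (hG : model p k c Dh Nh u < 4 * (5200 * p ^ 2 * K ^ 2) * (∑ j ∈ range k, y j) ^ p) :
    ∑ j ∈ range k, (p * u j ^ (p - 1) * (s j + D j / 2) + c * N j) ≤
      Z ^ p - (∑ j ∈ range k, y j) ^ p + 1 / 2 * model p k c Dh Nh u := by
  have hp := h.one_le_p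
  have hp3 := h.three_le
  have hβ := h.step_pos
  have hK := h.one_le
  have hz0 := h.z_nonneg
  have hbase := h.base
  set z := ∑ j ∈ range k, y j with hzdef
  set G := model p k c Dh Nh u
  have hG0 : 0 ≤ G := h.model_nonneg
  have hz : 0 < z := by
    rcases eq_or_lt_of_le hz0 with h0 | h0
    · rw [← h0, zero_pow (by omega)] at hG
      linarith
    · exact h0
  have hpow : ∀ t : ℝ, t ^ p = t ^ (p - 1) * t := by
    intro t; rw [← pow_succ]; congr 1; omega
  have hzp : 0 < z ^ (p - 1) := by positivity
  -- The admissible relative drift of the loads. It is chosen so that `4 p^2 K η = p/16`, as needed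
  -- for `b6` at the end.
  set η : ℝ := 1 / (64 * p * K) with hη
  have hη0 : 0 < η := by positivity
  have hpη : p * η ≤ 1 / 64 := by
    rw [hη]
    rw [mul_one_div, div_le_iff₀ (by positivity)]
    nlinarith
  -- loads close to `z`
  have hlow : ∀ t : ℝ, |t - z| ≤ η * z → 1 / 2 * z ^ (p - 1) ≤ t ^ (p - 1) := by
    intro t ht
    have h1 : (1 - η) * z ≤ t := by have := (abs_le.1 ht).1; linarith
    have hη1 : η ≤ 1 := by nlinarith
    have h2 : ((1 - η) * z) ^ (p - 1) ≤ t ^ (p - 1) := by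
      have : 0 ≤ (1 - η) * z := mul_nonneg (by linarith) hz0
      gcongr
    have h3 : 1 + ((p - 1 : ℕ) : ℝ) * (-η) ≤ (1 + -η) ^ (p - 1) :=
      one_add_mul_le_pow (by linarith) _
    have h4 : ((p - 1 : ℕ) : ℝ) ≤ p := by exact_mod_cast Nat.sub_le p 1
    have h5 : 1 / 2 ≤ (1 - η) ^ (p - 1) := by
      rw [← sub_eq_add_neg] at h3
      nlinarith
    calc 1 / 2 * z ^ (p - 1) ≤ (1 - η) ^ (p - 1) * z ^ (p - 1) := by gcongr
      _ = ((1 - η) * z) ^ (p - 1) := by rw [mul_pow]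
      _ ≤ _ := h2
  have hbound : ∀ j ≤ k, ∀ ρ : ℝ, 0 < ρ → ∑ l ∈ range j, |u (l + 1) - u l| ≤
      β * (ρ * z + 2 * K * (1 + 1 / ρ) * ∑ l ∈ range j, Dh l) := by
    intro j hj ρ hρ
    calc ∑ l ∈ range j, |u (l + 1) - u l|
        ≤ ∑ l ∈ range j, β * (ρ * y l + 2 * K * (1 + 1 / ρ) * Dh l) := by
          refine sum_le_sum fun l hl => ?_
          have hlk : l < k := lt_of_lt_of_le (mem_range.1 hl) hj
          have a1 := h.drift l hlk
          have a2 := h.linh l hlk ρ hρ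
          have a3 := h.Dh_nonneg l
          have a4 : Dh l ≤ K * (1 + 1 / ρ) * Dh l := by
            have : 1 ≤ K * (1 + 1 / ρ) := by
              have : 0 < 1 / ρ := by positivity
              nlinarith
            nlinarith
          refine a1.trans (mul_le_mul_of_nonneg_left ?_ hβ.le)
          linarith
      _ = β * (ρ * ∑ l ∈ range j, y l + 2 * K * (1 + 1 / ρ) * ∑ l ∈ range j, Dh l) := by
          rw [← mul_sum, sum_add_distrib, ← mul_sum, ← mul_sum]
      _ ≤ _ := by
          gcongr
          exact sum_le_sum_of_subset_of_nonneg (range_mono hj) fun l _ _ => h.y_nonneg l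
  have habs : ∀ j, |u j - z| ≤ ∑ l ∈ range j, |u (l + 1) - u l| := by
    intro j
    have : u j - z = ∑ l ∈ range j, (u (l + 1) - u l) := by
      rw [sum_range_sub u, h.load_zero]
    rw [this]
    exact abs_sum_le_sum_abs _ _
  have hPj : ∀ j ≤ k, (∀ l < j, |u l - z| ≤ η * z) →
      p / 4 * z ^ (p - 1) * ∑ l ∈ range j, Dh l ≤ G := by
    intro j hj hl
    refine le_trans ?_ (h.term_le_model hj)
    rw [mul_sum]
    refine sum_le_sum fun l hl' => ?_
    have a1 := hlow _ (hl l (mem_range.1 hl'))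
    have a2 := h.Dh_nonneg l
    calc p / 4 * z ^ (p - 1) * Dh l = p / 2 * (1 / 2 * z ^ (p - 1)) * Dh l := by ring
      _ ≤ _ := by gcongr
  have hPsmall : ∀ j ≤ k, (∀ l < j, |u l - z| ≤ η * z) →
      ∑ l ∈ range j, Dh l ≤ 16 * (5200 * p ^ 2 * K ^ 2) * z := by
    intro j hj hl
    have a1 := hPj j hj hl
    have a2 : 0 ≤ ∑ l ∈ range j, Dh l := sum_nonneg fun l _ => h.Dh_nonneg l
    have a3 : z ^ (p - 1) * ((∑ l ∈ range j, Dh l) * (1 / 4)) ≤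
        z ^ (p - 1) * (4 * (5200 * p ^ 2 * K ^ 2) * z) := by
      rw [hpow z] at hG
      have : z ^ (p - 1) * ((∑ l ∈ range j, Dh l) * (1 / 4)) ≤
          p / 4 * z ^ (p - 1) * ∑ l ∈ range j, Dh l := by
        have : 0 ≤ z ^ (p - 1) * (∑ l ∈ range j, Dh l) := by positivity
        nlinarith
      nlinarith
    have a4 := le_of_mul_le_mul_left a3 hzp
    linarith
  -- Bootstrap: as long as the earlier loads are near `z`, the model controls the sum of the
  -- divergences `Dh`, hence the total variation of the loads so far, and this keeps the next load
  -- near `z` as well.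
  have hclose : ∀ j ≤ k, ∑ l ∈ range j, |u (l + 1) - u l| ≤ η * z := by
    intro j
    induction j using Nat.strong_induction_on with
    | _ j ih =>
      intro hj
      have a0 : ∀ l < j, |u l - z| ≤ η * z := fun l hl =>
        (habs l).trans (ih l hl (by omega))
      have a1 := hPsmall j hj a0
      have a2 := hbound j hj 1 one_pos
      have a3 := h.step_small
      refine a2.trans ?_
      have a4 : β * (1 * z + 2 * K * (1 + 1 / 1) * ∑ l ∈ range j, Dh l) ≤
          β * (1 * z + 2 * K * (1 + 1 / 1) * (16 * (5200 * p ^ 2 * K ^ 2) * z)) := by gcongr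
      refine a4.trans ?_
      have a5 : β * (1 + 332800 * p ^ 2 * K ^ 3) ≤ η := by
        rw [hη, le_div_iff₀ (by positivity)]
        -- Here `332800 = 4 * 16 * 5200`, and multiplying by `64` gives about `21300000`; this is
        -- the requirement that dictates `30000000` in `step_small`.
        have a6 : (1 + 332800 * p ^ 2 * K ^ 3) * (64 * p * K) ≤ 21400000 * p ^ 3 * K ^ 4 := by
          have : 1 ≤ (p : ℝ) ^ 2 * K ^ 3 :=
            one_le_mul_of_one_le_of_one_le (one_le_pow₀ (by linarith)) (one_le_pow₀ hK)
          have b : 0 ≤ (p : ℝ) * K := by positivity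
          nlinarith [mul_le_mul_of_nonneg_right this b]
        calc β * (1 + 332800 * p ^ 2 * K ^ 3) * (64 * p * K)
            = β * ((1 + 332800 * p ^ 2 * K ^ 3) * (64 * p * K)) := by ring
          _ ≤ β * (30000000 * p ^ 3 * K ^ 4) := by
            refine mul_le_mul_of_nonneg_left (a6.trans ?_) hβ.le
            gcongr
            norm_num
          _ ≤ 1 := a3
      calc _ = β * (1 + 332800 * p ^ 2 * K ^ 3) * z := by ring
        _ ≤ _ := by gcongr
  set V := ∑ l ∈ range k, |u (l + 1) - u l| with hVdef
  set Ph := ∑ l ∈ range k, Dh l with hPhdef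
  set P := ∑ l ∈ range k, D l with hPdef
  have hP0 : 0 ≤ P := sum_nonneg fun l _ => h.D_nonneg l
  have hPh0 : 0 ≤ Ph := sum_nonneg fun l _ => h.Dh_nonneg l
  have hV0 : 0 ≤ V := sum_nonneg fun l _ => abs_nonneg _
  have hVη : V ≤ η * z := hclose k le_rfl
  have hη1 : η ≤ 1 := by nlinarith
  have hdev : ∀ l ≤ k, |u l - z| ≤ V := fun l hl => (habs l).trans
    (sum_le_sum_of_subset_of_nonneg (range_mono hl) fun _ _ _ => abs_nonneg _)
  have hGP : p / 4 * z ^ (p - 1) * Ph ≤ G :=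
    hPj k le_rfl fun l hl => (hdev l hl.le).trans hVη
  rw [sum_add_distrib, ← mul_sum]
  -- The budget for replacing the loads by `z`: the slack `p/4 z^(p-1) P` of `base` for the
  -- comparison direction, and half of the model for the direction of the pass.
  suffices hdiff : ∑ j ∈ range k, p * u j ^ (p - 1) * (s j + D j / 2) ≤
      p * z ^ (p - 1) * ∑ j ∈ range k, (s j + D j / 2) + p / 4 * z ^ (p - 1) * P + 1 / 2 * G by
    linarith
  have hdev' : ∀ l ≤ k, |u l ^ (p - 1) - z ^ (p - 1)| ≤ 2 * p * (V / z) * z ^ (p - 1) := by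
    intro l hl
    set v := V / z with hv
    have hVz : V = v * z := by rw [hv]; field_simp
    have hv0 : 0 ≤ v := by positivity
    have hvη : v ≤ η := by rw [hv, div_le_iff₀ hz]; exact hVη
    have hd := abs_le.1 (hdev l hl)
    have hn : ((p - 1 : ℕ) : ℝ) ≤ p := by exact_mod_cast Nat.sub_le p 1
    have hul := h.load_nonneg l hl
    have hup : u l ^ (p - 1) ≤ (1 + 2 * p * v) * z ^ (p - 1) := by
      have a1 : u l ^ (p - 1) ≤ ((1 + v) * z) ^ (p - 1) := by gcongr; linarith
      have a2 : (1 + v) ^ (p - 1) ≤ Real.exp (p * v) := by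
        calc (1 + v) ^ (p - 1) ≤ (1 + v) ^ p := pow_le_pow_right₀ (by linarith) (Nat.sub_le _ _)
          _ ≤ (Real.exp v) ^ p := by gcongr; rw [add_comm]; exact Real.add_one_le_exp v
          _ = Real.exp (p * v) := by rw [Real.exp_nat_mul]
      have a3 : 0 ≤ p * v := by positivity
      have a4 : p * v ≤ 1 := by nlinarith
      have a5 := Real.abs_exp_sub_one_sub_id_le (x := p * v) (by rw [abs_of_nonneg a3]; exact a4)
      have a6 : Real.exp (p * v) ≤ 1 + 2 * p * v := by
        have := (abs_le.1 a5).2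
        have a7 : (p * v) ^ 2 ≤ p * v := by rw [sq]; exact mul_le_of_le_one_left a3 a4
        linarith
      calc u l ^ (p - 1) ≤ (1 + v) ^ (p - 1) * z ^ (p - 1) := by rw [← mul_pow]; exact a1
        _ ≤ _ := by gcongr; linarith
    have hlo : (1 - 2 * p * v) * z ^ (p - 1) ≤ u l ^ (p - 1) := by
      have a0 : 0 ≤ (1 - v) * z := mul_nonneg (by linarith) hz0
      have a1 : ((1 - v) * z) ^ (p - 1) ≤ u l ^ (p - 1) := by gcongr; linarith
      have a2 : 1 + ((p - 1 : ℕ) : ℝ) * (-v) ≤ (1 + -v) ^ (p - 1) :=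
        one_add_mul_le_pow (by linarith) _
      rw [← sub_eq_add_neg] at a2
      calc (1 - 2 * p * v) * z ^ (p - 1) ≤ (1 - v) ^ (p - 1) * z ^ (p - 1) := by
            gcongr
            have a8 := mul_le_mul_of_nonneg_right hn hv0
            have a9 : 0 ≤ p * v := by positivity
            linarith
        _ = ((1 - v) * z) ^ (p - 1) := by rw [mul_pow]
        _ ≤ _ := a1
    rw [abs_le]
    constructor <;> linarith
  have hA : ∑ j ∈ range k, p * u j ^ (p - 1) * (s j + D j / 2) ≤
      p * z ^ (p - 1) * ∑ j ∈ range k, (s j + D j / 2) +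
        p * (2 * p * (V / z) * z ^ (p - 1)) * ∑ j ∈ range k, (|s j| + D j) := by
    rw [mul_sum, mul_sum, ← sum_add_distrib]
    refine sum_le_sum fun j hj => ?_
    have a1 := hdev' j (mem_range.1 hj).le
    have a2 : |s j + D j / 2| ≤ |s j| + D j := by
      have := h.D_nonneg j
      refine (abs_add_le _ _).trans ?_
      rw [abs_of_nonneg (by positivity : 0 ≤ D j / 2)]
      linarith
    have a3 : (u j ^ (p - 1) - z ^ (p - 1)) * (s j + D j / 2) ≤
        (2 * p * (V / z) * z ^ (p - 1)) * (|s j| + D j) := by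
      refine (le_abs_self _).trans ?_
      rw [abs_mul]
      gcongr
    have := mul_le_mul_of_nonneg_left a3 (by linarith : (0 : ℝ) ≤ p)
    linarith
  refine hA.trans ?_
  -- If the loads do not move at all there is no error. Otherwise `V > 0` and may serve in the
  -- choice of `ρ`.
  rcases eq_or_lt_of_le hV0 with hV | hV
  · rw [← hV]
    have : 0 ≤ p / 4 * z ^ (p - 1) * P := by positivity
    simp only [zero_div, mul_zero, zero_mul, add_zero]
    linarith
  -- The parameter `ρ = V/(2 β z)` absorbs half of `V` on the left. Controlling the square of the
  -- variation, with a factor `β`, is what makes the error second order.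
  have hV2 : V ^ 2 ≤ 12 * K * β * z * Ph := by
    have a1 := hbound k le_rfl (V / (2 * β * z)) (by positivity)
    rw [← hVdef, ← hPhdef] at a1
    have a2 : β * (V / (2 * β * z) * z + 2 * K * (1 + 1 / (V / (2 * β * z))) * Ph) =
        V / 2 + 2 * K * β * (1 + 2 * β * z / V) * Ph := by
      field_simp
    rw [a2] at a1
    have a3 : V * V ≤ V * (2 * (2 * K * β * (1 + 2 * β * z / V) * Ph)) :=
      mul_le_mul_of_nonneg_left (by linarith) hV0
    have a4 : V * (2 * (2 * K * β * (1 + 2 * β * z / V) * Ph)) =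
        4 * K * β * Ph * V + 8 * K * β * β * z * Ph := by
      field_simp; ring
    have a5 : V ≤ z := hVη.trans (by nlinarith)
    have a6 : β ≤ 1 := by
      have := h.small (a := 1) (i := 0) (l := 0) (by norm_num) (by norm_num) (by norm_num)
      simpa using this
    have a7 : 4 * K * β * Ph * V ≤ 4 * K * β * Ph * z := by gcongr
    have a8 : 8 * K * β * β * z * Ph ≤ 8 * K * β * 1 * z * Ph := by gcongr
    nlinarith
  have hS : ∀ ρ : ℝ, 0 < ρ → ∑ j ∈ range k, (|s j| + D j) ≤ ρ * z + 2 * K * (1 + 1 / ρ) * P := by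
    intro ρ hρ
    rw [hzdef, hPdef, mul_sum, mul_sum, ← sum_add_distrib]
    refine sum_le_sum fun j hj => ?_
    have a1 := h.lin j (mem_range.1 hj) ρ hρ
    have a3 := h.D_nonneg j
    have a4 : D j ≤ K * (1 + 1 / ρ) * D j := by
      have : 1 ≤ K * (1 + 1 / ρ) := by
        have : 0 < 1 / ρ := by positivity
        nlinarith
      nlinarith
    linarith
  set v := V / z with hv
  have hVz : V = v * z := by rw [hv]; field_simp
  have hv0 : 0 < v := by positivity
  have hvη : v ≤ η := by rw [hv, div_le_iff₀ hz]; exact hVη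
  -- Taking `ρ` proportional to the relative drift `v` splits the error into a term with `v^2 z`,
  -- paid by `Ph` through `hV2`, and terms with `P`, of which each coefficient is at most `p/16`.
  have b1 := hS (64 * p * K * v) (by positivity)
  have b2 : p * (2 * p * v * z ^ (p - 1)) * ∑ j ∈ range k, (|s j| + D j) ≤
      p * (2 * p * v * z ^ (p - 1)) *
        (64 * p * K * v * z + 2 * K * (1 + 1 / (64 * p * K * v)) * P) := by gcongr
  have b3 : p * (2 * p * v * z ^ (p - 1)) *
        (64 * p * K * v * z + 2 * K * (1 + 1 / (64 * p * K * v)) * P) =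
      z ^ (p - 1) * (128 * p ^ 3 * K * (v ^ 2 * z) + 4 * p ^ 2 * K * v * P + p / 16 * P) := by
    field_simp; ring
  have b4 : v ^ 2 * z ≤ 12 * K * β * Ph := by
    have : z * (v ^ 2 * z) ≤ z * (12 * K * β * Ph) := by
      calc z * (v ^ 2 * z) = V ^ 2 := by rw [hVz]; ring
        _ ≤ _ := hV2
        _ = _ := by ring
    exact le_of_mul_le_mul_left this hz
  have b5 : 128 * p ^ 3 * K * (v ^ 2 * z) ≤ p / 8 * Ph := by
    have c1 := h.small (a := 12288) (i := 2) (l := 2) (by norm_num) (by norm_num) (by norm_num)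
    calc 128 * p ^ 3 * K * (v ^ 2 * z) ≤ 128 * p ^ 3 * K * (12 * K * β * Ph) := by gcongr
      _ = (β * (12288 * p ^ 2 * K ^ 2)) * (p / 8 * Ph) := by ring
      _ ≤ 1 * (p / 8 * Ph) := by gcongr
      _ = _ := one_mul _
  have b6 : 4 * p ^ 2 * K * v * P ≤ p / 16 * P := by
    have : 4 * p ^ 2 * K * v ≤ p / 16 := by
      calc 4 * p ^ 2 * K * v ≤ 4 * p ^ 2 * K * η := by gcongr
        _ = (p : ℝ) / 16 := by rw [hη]; field_simp; norm_num
    gcongr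
  have b7 : z ^ (p - 1) * (128 * p ^ 3 * K * (v ^ 2 * z) + 4 * p ^ 2 * K * v * P + p / 16 * P) ≤
      z ^ (p - 1) * (p / 8 * Ph + p / 16 * P + p / 16 * P) := by gcongr
  have b8 : 0 ≤ z ^ (p - 1) * (p * P) := by positivity
  linarith

/-- The models along a pass, evaluated at a comparison point, are controlled by the change of the
`p`-th power of the load and by the models in the direction of the pass. -/
lemma bound (h : PassRow p k β K c Z y s D N sh Dh Nh u) :
    ∑ j ∈ range k, (p * u j ^ (p - 1) * (s j + D j / 2) + c * N j) ≤
      Z ^ p - (∑ j ∈ range k, y j) ^ p + 1 / 2 * model p k c Dh Nh u := by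
  rcases le_or_gt (4 * (5200 * p ^ 2 * K ^ 2) * (∑ j ∈ range k, y j) ^ p)
    (model p k c Dh Nh u) with hG | hG
  · exact h.bound_of_large hG
  · exact h.bound_of_small hG

end PassRow

/-! ### The bound for one row, concretely -/

open Finset

/-- The load of a row after the first `j` entries of `x` have been moved by `β e`. -/
def passLoad (q : ℝ) (k : ℕ) (β : ℝ) (x e : ℕ → ℝ) (j : ℕ) : ℝ :=
  ∑ l ∈ range k, |if l < j then x l + β * e l else x l| ^ q

lemma passLoad_zero (q : ℝ) (k : ℕ) (β : ℝ) (x e : ℕ → ℝ) :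
    passLoad q k β x e 0 = ∑ l ∈ range k, |x l| ^ q := by
  simp [passLoad]

lemma passLoad_last (q : ℝ) (k : ℕ) (β : ℝ) (x e : ℕ → ℝ) :
    passLoad q k β x e k = ∑ l ∈ range k, |x l + β * e l| ^ q := by
  unfold passLoad
  refine sum_congr rfl fun l hl => ?_
  rw [if_pos (mem_range.1 hl)]

lemma passLoad_nonneg (q : ℝ) (k : ℕ) (β : ℝ) (x e : ℕ → ℝ) (j : ℕ) :
    0 ≤ passLoad q k β x e j :=
  sum_nonneg fun _ _ => by positivity

lemma passLoad_succ (q : ℝ) {k : ℕ} (β : ℝ) (x e : ℕ → ℝ) {j : ℕ} (hj : j < k) :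
    passLoad q k β x e (j + 1) =
      passLoad q k β x e j + (|x j + β * e j| ^ q - |x j| ^ q) := by
  rw [← sub_eq_iff_eq_add']
  unfold passLoad
  rw [← sum_sub_distrib, sum_eq_single_of_mem j (mem_range.2 hj)]
  · simp
  · intro l _ hl
    by_cases h : l < j
    · rw [if_pos h, if_pos (by omega)]; ring
    · rw [if_neg h, if_neg (by omega)]; ring

lemma le_passLoad (q : ℝ) {k : ℕ} (β : ℝ) (x e : ℕ → ℝ) {j : ℕ} (hj : j < k) :
    |x j| ^ q ≤ passLoad q k β x e j := by
  have := single_le_sum (f := fun l => |if l < j then x l + β * e l else x l| ^ q)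
    (fun l _ => by positivity) (mem_range.2 hj)
  simpa [passLoad] using this

lemma pow_tangent_le {p : ℕ} (hp : 2 ≤ p) {z Z : ℝ} (hz : 0 ≤ z) (hZ : 0 ≤ Z) :
    z ^ p + p * z ^ (p - 1) * (Z - z) ≤ Z ^ p := by
  rcases eq_or_lt_of_le hz with h | h
  · rw [← h, zero_pow (by omega), zero_pow (by omega)]
    have : 0 ≤ Z ^ p := by positivity
    linarith
  · have h1 : 1 + (p : ℝ) * (Z / z - 1) ≤ (1 + (Z / z - 1)) ^ p := by
      apply one_add_mul_le_pow
      have : 0 ≤ Z / z := by positivity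
      linarith
    have h2 : z ^ p = z ^ (p - 1) * z := by rw [← pow_succ]; congr 1; omega
    calc z ^ p + p * z ^ (p - 1) * (Z - z) = z ^ p * (1 + (p : ℝ) * (Z / z - 1)) := by
          rw [h2]; field_simp
      _ ≤ z ^ p * (1 + (Z / z - 1)) ^ p := by gcongr
      _ = Z ^ p := by rw [← mul_pow]; congr 1; field_simp; ring

lemma three_mul_le_pow {p : ℕ} (hp : 3 ≤ p) : (3 * p : ℝ) ≤ 3 ^ (p - 1) := by
  obtain ⟨n, rfl⟩ : ∃ n, p = n + 3 := ⟨p - 3, by omega⟩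
  have : n + 3 - 1 = n + 2 := rfl
  rw [this]
  induction n with
  | zero => norm_num
  | succ n ih =>
    have h := ih (by omega) rfl
    rw [pow_succ]
    push_cast at h ⊢
    have : (0 : ℝ) ≤ n := by positivity
    linarith

section Row

variable {q : ℝ} {p k : ℕ} {β : ℝ}

lemma sum_breg_le (hq : 1 < q) (hq2 : q ≤ 2) (x d : ℕ → ℝ) :
    ∑ j ∈ range k, breg q (x j) (d j) ≤
      8 * (∑ j ∈ range k, |x j + d j| ^ q + ∑ j ∈ range k, |x j| ^ q) := by
  rw [← sum_add_distrib, mul_sum]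
  refine sum_le_sum fun j _ => ?_
  have h1 := breg_upper hq hq2 (x j) (d j)
  have h2 := quadPow_le_rpow hq2 (x j) (d j)
  have h3 := abs_rpow_le_of_add hq hq2 (x j) (d j)
  linarith

/-- Entrywise `rpow_mul_le_quadPow` with `R = 2 (Z + z)`, which bounds both `|x_j|^q` and `|d_j|^q`.
The factor `q - 1` in `tailWeight` cancels the loss in `quadPow_le_breg`. -/
lemma tail_sum_le (hq : 1 < q) (hq2 : q ≤ 2) (hp : 3 ≤ p) (x d : ℕ → ℝ) :
    tailWeight q p * ∑ j ∈ range k, |d j| ^ ((p : ℝ) * q) ≤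
      16 / 64 ^ p * (2 * (∑ j ∈ range k, |x j + d j| ^ q + ∑ j ∈ range k, |x j| ^ q)) ^ (p - 1) *
        ∑ j ∈ range k, breg q (x j) (d j) := by
  have hs : 0 < q - 1 := by linarith
  set Z := ∑ j ∈ range k, |x j + d j| ^ q
  set z := ∑ j ∈ range k, |x j| ^ q
  have hZ0 : 0 ≤ Z := sum_nonneg fun _ _ => by positivity
  have hz0 : 0 ≤ z := sum_nonneg fun _ _ => by positivity
  rw [mul_sum, mul_sum]
  refine sum_le_sum fun j hj => ?_
  have hZ : |x j + d j| ^ q ≤ Z :=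
    single_le_sum (f := fun j => |x j + d j| ^ q) (fun l _ => by positivity) hj
  have hz : |x j| ^ q ≤ z :=
    single_le_sum (f := fun j => |x j| ^ q) (fun l _ => by positivity) hj
  have h3 := abs_rpow_le_of_add hq hq2 (x j) (d j)
  have h4 := rpow_mul_le_quadPow hq (p := p) (by omega) (x j) (d j) (R := 2 * (Z + z))
    (by linarith) (by linarith)
  have h5 := quadPow_le_breg hq hq2 (x j) (d j)
  have hc := (tailWeight_pos hq p).le
  calc tailWeight q p * |d j| ^ ((p : ℝ) * q)
      ≤ tailWeight q p * ((2 * (Z + z)) ^ (p - 1) * (16 / (q - 1) * breg q (x j) (d j))) := by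
        refine mul_le_mul_of_nonneg_left (h4.trans ?_) hc
        gcongr
    _ = _ := by unfold tailWeight; field_simp

/-- Instantiates the abstract row with the actual powers and divergences. Only `base` and `tail`
concern the comparison point globally; they say that the local model at the initial load lies below
the true cost with room to spare. -/
lemma passRow (hq : 1 < q) (hq2 : q ≤ 2) (hp : 3 ≤ p) (hβ : 0 < β) (hβ1 : β ≤ 1)
    (hβq : β ^ (q - 1) ≤ (q - 1) / (2048 * p ^ 2))
    (hβs : β * (30000000 * p ^ 3 * (32 / (q - 1)) ^ 4) ≤ 1) (x d e : ℕ → ℝ) :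
    PassRow p k β (32 / (q - 1)) (tailWeight q p) (∑ j ∈ range k, |x j + d j| ^ q)
      (fun j => |x j| ^ q) (fun j => powDeriv q (x j) * d j) (fun j => breg q (x j) (d j))
      (fun j => |d j| ^ ((p : ℝ) * q)) (fun j => powDeriv q (x j) * e j)
      (fun j => breg q (x j) (e j)) (fun j => |e j| ^ ((p : ℝ) * q)) (passLoad q k β x e) := by
  have hs : 0 < q - 1 := by linarith
  have hp0 : (3 : ℝ) ≤ p := by exact_mod_cast hp
  have hZ0 : 0 ≤ ∑ j ∈ range k, |x j + d j| ^ q := sum_nonneg fun _ _ => by positivity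
  have hz0 : 0 ≤ ∑ j ∈ range k, |x j| ^ q := sum_nonneg fun _ _ => by positivity
  have hP0 : 0 ≤ ∑ j ∈ range k, breg q (x j) (d j) :=
    sum_nonneg fun j _ => breg_nonneg hq hq2 _ _
  have hlin : ∀ x d ρ : ℝ, 0 < ρ →
      |powDeriv q x * d| ≤ ρ * |x| ^ q + 32 / (q - 1) * (1 + 1 / ρ) * breg q x d := by
    intro x d ρ hρ
    refine (abs_powDeriv_mul_le hq hq2 x d hρ).trans ?_
    have h1 : 0 ≤ breg q x d := breg_nonneg hq hq2 _ _
    have h2 : (1 / ρ + 2) * quadPow q x d ≤ (1 / ρ + 2) * (16 / (q - 1) * breg q x d) := by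
      gcongr; exact quadPow_le_breg hq hq2 x d
    have h3 : (1 / ρ + 2) * (16 / (q - 1) * breg q x d) ≤
        (2 * (1 + 1 / ρ)) * (16 / (q - 1) * breg q x d) := by
      gcongr
      have : 0 < 1 / ρ := by positivity
      linarith
    calc _ ≤ ρ * |x| ^ q + (2 * (1 + 1 / ρ)) * (16 / (q - 1) * breg q x d) := by linarith
      _ = _ := by ring
  have htail := tail_sum_le (k := k) hq hq2 hp x d
  have htot := sum_breg_le (k := k) hq hq2 x d
  have hpow : ∀ t : ℝ, t ^ p = t ^ (p - 1) * t := by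
    intro t; rw [← pow_succ]; congr 1; omega
  refine ⟨hp, hβ, hβs, ?_, (tailWeight_pos hq p).le, fun j => by positivity,
    fun j => breg_nonneg hq hq2 _ _, fun j => breg_nonneg hq hq2 _ _, fun j => by positivity, hZ0,
    passLoad_zero _ _ _ _ _, fun j _ => passLoad_nonneg _ _ _ _ _ _, ?_, ?_,
    fun j _ ρ hρ => hlin _ _ _ hρ, fun j _ ρ hρ => hlin _ _ _ hρ, ?_, htot, ?_⟩
  · rw [le_div_iff₀ hs]; linarith
  · intro j hj
    rw [passLoad_succ q β x e hj, add_sub_cancel_left]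
    have h1 : |x j + β * e j| ^ q - |x j| ^ q =
        β * (powDeriv q (x j) * e j) + breg q (x j) (β * e j) := by rw [breg]; ring
    rw [h1]
    refine (abs_add_le _ _).trans ?_
    rw [abs_of_nonneg (breg_nonneg hq hq2 _ _), abs_mul, abs_of_pos hβ, mul_add]
    have := breg_mul_le hq hq2 hp hβ hβ1 hβq (x j) (e j)
    linarith
  · intro j hj
    rw [passLoad_succ q β x e hj]
    exact load_step hq hq2 hp hβ hβ1 hβq _ _ (le_passLoad q β x e hj)
  · -- the baseline inequality
    set P := ∑ j ∈ range k, breg q (x j) (d j) with hP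
    set S := tailWeight q p * ∑ j ∈ range k, |d j| ^ ((p : ℝ) * q) with hS
    have hZz : ∑ j ∈ range k, (powDeriv q (x j) * d j + breg q (x j) (d j) / 2) =
        (∑ j ∈ range k, |x j + d j| ^ q) - (∑ j ∈ range k, |x j| ^ q) - P / 2 := by
      rw [hP, sum_div, ← sum_sub_distrib, ← sum_sub_distrib]
      refine sum_congr rfl fun j _ => ?_
      rw [breg]; ring
    rw [hZz]
    set Z := ∑ j ∈ range k, |x j + d j| ^ q
    set z := ∑ j ∈ range k, |x j| ^ q
    suffices h : S ≤ (Z ^ p - (z ^ p + p * z ^ (p - 1) * (Z - z))) + p / 4 * z ^ (p - 1) * P by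
      linarith
    -- If `Z ≤ 3 z`, the tail is of order `z^(p-1) P` with a tiny constant, and convexity of the
    -- `p`-th power needs no slack. If `Z > 3 z`, the convexity gap itself is of order `Z^p` and
    -- dominates the tail.
    rcases le_or_gt Z (3 * z) with hc | hc
    · have h1 := pow_tangent_le (p := p) (by omega) hz0 hZ0
      have h2 : 16 / 64 ^ p * (2 * (Z + z)) ^ (p - 1) * P ≤ 16 / 64 ^ p * (8 * z) ^ (p - 1) * P := by
        gcongr 16 / 64 ^ p * ?_ ^ (p - 1) * P
        linarith
      have h3 : (16 : ℝ) / 64 ^ p * (8 * z) ^ (p - 1) * P ≤ p / 4 * z ^ (p - 1) * P := by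
        have e1 : (8 : ℝ) ^ (p - 1) ≤ 64 ^ p := by
          calc (8 : ℝ) ^ (p - 1) ≤ 64 ^ (p - 1) := by gcongr; norm_num
            _ ≤ 64 ^ p := pow_le_pow_right₀ (by norm_num) (Nat.sub_le _ _)
        have e2 : (16 : ℝ) * 8 ^ (p - 1) ≤ 1 / 4 * 64 ^ p := by
          rw [hpow 64]
          have : (8 : ℝ) ^ (p - 1) ≤ 64 ^ (p - 1) := by gcongr; norm_num
          linarith
        rw [mul_pow]
        have e3 : (16 : ℝ) / 64 ^ p * 8 ^ (p - 1) ≤ p / 4 := by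
          rw [div_mul_eq_mul_div, div_le_iff₀ (by positivity)]
          refine e2.trans ?_
          gcongr
          linarith
        calc (16 : ℝ) / 64 ^ p * (8 ^ (p - 1) * z ^ (p - 1)) * P
            = (16 / 64 ^ p * 8 ^ (p - 1)) * z ^ (p - 1) * P := by ring
          _ ≤ _ := by gcongr
      linarith
    · have hZpos : 0 < Z := by linarith
      have h1 : p * z ^ (p - 1) * Z ≤ 1 / 3 * Z ^ p := by
        have e1 : (3 * z) ^ (p - 1) ≤ Z ^ (p - 1) := by gcongr
        rw [mul_pow] at e1
        have e2 := three_mul_le_pow hp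
        have e3 : 3 * p * z ^ (p - 1) ≤ Z ^ (p - 1) := le_trans (by gcongr) e1
        rw [hpow Z]
        nlinarith
      have h2 : z ^ p ≤ p * z ^ (p - 1) * z := by
        rw [hpow z]
        have : 0 ≤ z ^ (p - 1) * z := by positivity
        nlinarith
      have h3 : 16 / 64 ^ p * (2 * (Z + z)) ^ (p - 1) * P ≤
          16 / 64 ^ p * (8 * Z) ^ (p - 1) * (16 * Z) := by
        gcongr 16 / 64 ^ p * ?_ ^ (p - 1) * ?_
        · linarith
        · linarith
      have h4 : (16 : ℝ) / 64 ^ p * (8 * Z) ^ (p - 1) * (16 * Z) = 32 / 8 ^ p * Z ^ p := by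
        rw [hpow Z, mul_pow, show (64 : ℝ) = 8 * 8 by norm_num, mul_pow, hpow 8]
        field_simp
        norm_num
      have h5 : (32 : ℝ) / 8 ^ p ≤ 1 / 16 := by
        rw [div_le_iff₀ (by positivity)]
        have : (8 : ℝ) ^ 3 ≤ 8 ^ p := pow_le_pow_right₀ (by norm_num) hp
        linarith
      have h6 : (32 : ℝ) / 8 ^ p * Z ^ p ≤ 1 / 16 * Z ^ p := by gcongr
      have h7 : 0 ≤ Z ^ p := by positivity
      have h8 : 0 ≤ p / 4 * z ^ (p - 1) * P := by positivity
      linarith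
  · set Z := ∑ j ∈ range k, |x j + d j| ^ q
    set z := ∑ j ∈ range k, |x j| ^ q
    refine htail.trans ?_
    have h1 : 16 / 64 ^ p * (2 * (Z + z)) ^ (p - 1) * ∑ j ∈ range k, breg q (x j) (d j) ≤
        16 / 64 ^ p * (2 * (Z + z)) ^ (p - 1) * (8 * (Z + z)) := by gcongr
    have h2 : (16 : ℝ) / 64 ^ p * (2 * (Z + z)) ^ (p - 1) * (8 * (Z + z)) =
        64 / 32 ^ p * (Z + z) ^ p := by
      rw [hpow (Z + z), mul_pow, show (64 : ℝ) = 2 * 32 by norm_num, mul_pow, hpow 2]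
      field_simp
      ring
    have h3 : (Z + z) ^ p ≤ 2 ^ (p - 1) * (Z ^ p + z ^ p) := add_pow_le hZ0 hz0 p
    have h4 : (64 : ℝ) / 32 ^ p * 2 ^ (p - 1) ≤ 1 / 4 := by
      rw [div_mul_eq_mul_div, div_le_iff₀ (by positivity)]
      have e1 : (16 : ℝ) ^ 3 ≤ 16 ^ p := pow_le_pow_right₀ (by norm_num) hp
      have e2 : (32 : ℝ) ^ p = 16 ^ p * 2 ^ p := by rw [← mul_pow]; norm_num
      have e3 : (2 : ℝ) ^ (p - 1) ≤ 2 ^ p := pow_le_pow_right₀ (by norm_num) (Nat.sub_le _ _)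
      have e4 : (0 : ℝ) < 2 ^ p := by positivity
      rw [e2]
      nlinarith
    calc _ ≤ _ := h1
      _ = _ := h2
      _ ≤ 64 / 32 ^ p * (2 ^ (p - 1) * (Z ^ p + z ^ p)) := by gcongr
      _ = (64 / 32 ^ p * 2 ^ (p - 1)) * (Z ^ p + z ^ p) := by ring
      _ ≤ _ := by gcongr

end Row

/-! ### A pass over all blocks -/

open Finset

/-- The parameters for which the step size `β` is admissible. -/
structure StepSize (q : ℝ) (p : ℕ) (β : ℝ) : Prop where
  one_lt : 1 < q
  le_two : q ≤ 2
  three_le : 3 ≤ p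
  pos : 0 < β
  le_one : β ≤ 1
  rpow_le : β ^ (q - 1) ≤ (q - 1) / (2048 * p ^ 2)
  mul_le : β * (30000000 * p ^ 3 * (32 / (q - 1)) ^ 4) ≤ 1

/-- The cost charged to the entry `v` when the present entry is `x` and the load of the row is `u`. -/
def modelCost (q : ℝ) (p : ℕ) (lam u x v : ℝ) : ℝ :=
  lam * p * u ^ (p - 1) / 2 * (powDeriv q x * v + |v| ^ q) +
    lam * tailWeight q p * |v - x| ^ ((p : ℝ) * q)

/-- The cost is written with `|v|^q` so that it is a sum of a linear function and two powers. This
is the same function up to a constant: half the linear term plus half of `|v|^q` equals linear term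
plus half divergence. -/
lemma modelCost_sub {q : ℝ} {p : ℕ} (hq : 1 < q) (hp : 3 ≤ p) (lam u x v : ℝ) :
    modelCost q p lam u x v - modelCost q p lam u x x =
      lam * (p * u ^ (p - 1) * (powDeriv q x * (v - x) + breg q x (v - x) / 2) +
        tailWeight q p * |v - x| ^ ((p : ℝ) * q)) := by
  have h0 : |x - x| ^ ((p : ℝ) * q) = 0 := by
    rw [sub_self, abs_zero, Real.zero_rpow]
    have : (3 : ℝ) ≤ p := by exact_mod_cast hp
    nlinarith
  unfold modelCost
  rw [h0, breg, add_sub_cancel]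
  ring

/-- The matrix with entries `x i j`. -/
def matOf (m k : ℕ) (x : ℕ → ℕ → ℝ) : Fin m → Fin k → ℝ := fun i j => x i j

/-- The matrix after a pass from `x` towards `xh`. -/
def damped (β : ℝ) (x xh : ℕ → ℕ → ℝ) : ℕ → ℕ → ℝ := fun i j => x i j + β * (xh i j - x i j)

/-- The load of row `i` when the blocks before `j` have been moved. -/
def rowLoad (q : ℝ) (k : ℕ) (β : ℝ) (x xh : ℕ → ℕ → ℝ) (i j : ℕ) : ℝ :=
  passLoad q k β (x i) (fun l => xh i l - x i l) j

/-- `xh` collects `δ`-optimal answers to the queries made along a pass that starts at `x`. -/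
def IsPass {m k : ℕ} (X : Fin k → Set (Fin m → ℝ)) (ψ : Fin k → (Fin m → ℝ) → ℝ) (q : ℝ) (p : ℕ)
    (lam δ β : ℝ) (x xh : ℕ → ℕ → ℝ) : Prop :=
  ∀ j : Fin k, (fun i : Fin m => xh i j) ∈ X j ∧ ∀ y ∈ X j,
    ψ j (fun i => xh i j) + ∑ i : Fin m, modelCost q p lam (rowLoad q k β x xh i j) (x i j) (xh i j) ≤
      ψ j y + ∑ i : Fin m, modelCost q p lam (rowLoad q k β x xh i j) (x i j) (y i) + δ

lemma objective_eq {m k : ℕ} (ψ : Fin k → (Fin m → ℝ) → ℝ) {q : ℝ} {p : ℕ} (hq : 1 < q)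
    (hp : 3 ≤ p) (lam : ℝ) (Y : Fin m → Fin k → ℝ) :
    objective ψ q p lam Y = totalCost ψ Y + lam * ∑ i, (∑ j, |Y i j| ^ q) ^ p := by
  unfold objective lqpNorm
  have hp0 : (0 : ℝ) < p := by exact_mod_cast (by omega : 0 < p)
  rw [← Real.rpow_mul, one_div_mul_cancel (by positivity), Real.rpow_one]
  exact sum_nonneg fun i _ => pow_nonneg (sum_nonneg fun j _ => by positivity) _

section Pass

variable {m k p : ℕ} {q lam δ β : ℝ} {X : Fin k → Set (Fin m → ℝ)}
  {ψ : Fin k → (Fin m → ℝ) → ℝ} {x xh : ℕ → ℕ → ℝ}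

lemma damped_mem (hβ : StepSize q p β) (hX : ∀ j, Convex ℝ (X j))
    (hx : matOf m k x ∈ feasible X) (hxh : matOf m k xh ∈ feasible X) :
    matOf m k (damped β x xh) ∈ feasible X := by
  intro j
  have h := hX j (hx j) (hxh j) (by linarith [hβ.le_one] : 0 ≤ 1 - β) hβ.pos.le (by ring)
  convert h using 1
  ext i
  simp only [matOf, damped, Pi.add_apply, Pi.smul_apply, smul_eq_mul]
  ring

lemma objective_matOf (hβ : StepSize q p β) (x : ℕ → ℕ → ℝ) :
    objective ψ q p lam (matOf m k x) =
      ∑ j : Fin k, ψ j (fun i => x i j) +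
        lam * ∑ i : Fin m, (∑ j ∈ range k, |x i j| ^ q) ^ p := by
  rw [objective_eq ψ hβ.one_lt hβ.three_le]
  simp only [totalCost, matOf, Finset.sum_range]

/-- A pass contracts the gap to every feasible point. -/
theorem pass_contraction (hβ : StepSize q p β) (hlam : 0 < lam)
    (hψ : ∀ j, ConvexOn ℝ (X j) (ψ j)) (hx : matOf m k x ∈ feasible X)
    (hpass : IsPass X ψ q p lam δ β x xh) (y : ℕ → ℕ → ℝ) (hy : matOf m k y ∈ feasible X) :
    objective ψ q p lam (matOf m k (damped β x xh)) - objective ψ q p lam (matOf m k y) ≤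
      (1 - β) * (objective ψ q p lam (matOf m k x) - objective ψ q p lam (matOf m k y)) +
        β * (k * δ) := by
  have hq := hβ.one_lt
  have hp := hβ.three_le
  rw [objective_matOf hβ, objective_matOf hβ, objective_matOf hβ]
  set c := tailWeight q p
  set u : ℕ → ℕ → ℝ := rowLoad q k β x xh with hu
  set G : ℕ → ℕ → ℝ := fun i j => p / 2 * u i j ^ (p - 1) * breg q (x i j) (xh i j - x i j) +
    c * |xh i j - x i j| ^ ((p : ℝ) * q) with hG
  set M : ℕ → ℕ → ℝ → ℝ := fun i j v => modelCost q p lam (u i j) (x i j) v with hM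
  -- one block
  have hcol : ∀ j : Fin k, ψ j (fun i => damped β x xh i j) - ψ j (fun i => x i j) +
      lam * ∑ i : Fin m, (u i (j + 1) ^ p - u i j ^ p) ≤
      β * (ψ j (fun i => y i j) - ψ j (fun i => x i j) + δ +
        ∑ i : Fin m, (M i j (y i j) - M i j (x i j)) - 1 / 2 * (lam * ∑ i : Fin m, G i j)) := by
    intro j
    obtain ⟨hmem, hopt⟩ := hpass j
    have h1 : ψ j (fun i => damped β x xh i j) ≤
        (1 - β) * ψ j (fun i => x i j) + β * ψ j (fun i => xh i j) := by
      have h := (hψ j).2 (hx j) hmem (by linarith [hβ.le_one] : 0 ≤ 1 - β) hβ.pos.le (by ring)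
      have e : (fun i : Fin m => damped β x xh i j) =
          (1 - β) • (fun i => matOf m k x i j) + β • fun i : Fin m => xh i j := by
        ext i
        simp only [matOf, damped, Pi.add_apply, Pi.smul_apply, smul_eq_mul]
        ring
      rw [e]
      exact h
    have h2 : ∀ i : Fin m, u i (j + 1) ^ p - u i j ^ p ≤
        p * u i j ^ (p - 1) * (β * (powDeriv q (x i j) * (xh i j - x i j))) + β / 2 * G i j := by
      intro i
      have hs := load_step hq hβ.le_two hp hβ.pos hβ.le_one hβ.rpow_le (x i j) (xh i j - x i j)
        (le_passLoad q β (x i) (fun l => xh i l - x i l) j.2)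
      have e : u i (j + 1) = u i j + (|x i j + β * (xh i j - x i j)| ^ q - |x i j| ^ q) :=
        passLoad_succ q β (x i) (fun l => xh i l - x i l) j.2
      have e2 : passLoad q k β (x i) (fun l => xh i l - x i l) j = u i j := rfl
      rw [e2] at hs
      rw [e]
      simp only [hG]
      linarith [hs]
    have h3 : ∀ i : Fin m, lam * (p * u i j ^ (p - 1) *
        (β * (powDeriv q (x i j) * (xh i j - x i j))) + β / 2 * G i j) =
        β * ((M i j (xh i j) - M i j (x i j)) - 1 / 2 * (lam * G i j)) := by
      intro i
      simp only [hM]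
      rw [modelCost_sub hq hp]
      simp only [hG]
      ring
    have h4 : lam * ∑ i : Fin m, (u i (j + 1) ^ p - u i j ^ p) ≤
        β * (∑ i : Fin m, (M i j (xh i j) - M i j (x i j)) -
          1 / 2 * (lam * ∑ i : Fin m, G i j)) := by
      calc lam * ∑ i : Fin m, (u i (j + 1) ^ p - u i j ^ p)
          ≤ lam * ∑ i : Fin m, (p * u i j ^ (p - 1) *
            (β * (powDeriv q (x i j) * (xh i j - x i j))) + β / 2 * G i j) := by
            gcongr with i _
            exact h2 i
        _ = _ := by
            rw [mul_sum, sum_congr rfl fun i _ => h3 i, ← mul_sum, sum_sub_distrib, ← mul_sum,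
              ← mul_sum]
    have h5 := hopt (fun i => y i j) (hy j)
    have h6 : ψ j (fun i => xh i j) + ∑ i : Fin m, (M i j (xh i j) - M i j (x i j)) ≤
        ψ j (fun i => y i j) + ∑ i : Fin m, (M i j (y i j) - M i j (x i j)) + δ := by
      rw [sum_sub_distrib, sum_sub_distrib]
      simp only [hM]
      linarith
    have h7 := mul_le_mul_of_nonneg_left h6 hβ.pos.le
    linarith
  -- one row
  have hrow : ∀ i : Fin m, ∑ j : Fin k, (M i j (y i j) - M i j (x i j)) ≤
      lam * ((∑ j ∈ range k, |y i j| ^ q) ^ p - (∑ j ∈ range k, |x i j| ^ q) ^ p) +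
        1 / 2 * (lam * ∑ j : Fin k, G i j) := by
    intro i
    have hb := (passRow (k := k) hq hβ.le_two hp hβ.pos hβ.le_one hβ.rpow_le hβ.mul_le (x i)
      (fun l => y i l - x i l) (fun l => xh i l - x i l)).bound
    have e1 : ∑ j : Fin k, (M i j (y i j) - M i j (x i j)) =
        lam * ∑ j ∈ range k, (p * passLoad q k β (x i) (fun l => xh i l - x i l) j ^ (p - 1) *
          (powDeriv q (x i j) * (y i j - x i j) + breg q (x i j) (y i j - x i j) / 2) +
          c * |y i j - x i j| ^ ((p : ℝ) * q)) := by
      rw [Finset.sum_range, mul_sum]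
      refine sum_congr rfl fun j _ => ?_
      simp only [hM]
      rw [modelCost_sub hq hp]
      rfl
    have e2 : PassRow.model p k c (fun j => breg q (x i j) (xh i j - x i j))
        (fun j => |xh i j - x i j| ^ ((p : ℝ) * q))
        (passLoad q k β (x i) fun l => xh i l - x i l) = ∑ j : Fin k, G i j := by
      unfold PassRow.model
      rw [Finset.sum_range]
      rfl
    rw [e2] at hb
    rw [e1]
    have e3 := mul_le_mul_of_nonneg_left hb hlam.le
    have e4 : ∀ j, x i j + (y i j - x i j) = y i j := fun j => by ring
    simp only [e4] at e3
    linarith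
  -- Summed over blocks and rows, the reserve `-1/2 lam ∑ G` of the block estimates cancels the
  -- excess `+1/2 lam ∑ G` of the row estimates.
  have hsum := sum_le_sum fun j (_ : j ∈ (univ : Finset (Fin k))) => hcol j
  have hsum2 := sum_le_sum fun i (_ : i ∈ (univ : Finset (Fin m))) => hrow i
  rw [← mul_sum] at hsum
  simp only [sum_add_distrib, sum_sub_distrib, ← mul_sum] at hsum hsum2
  -- The load after block `j` is the load before block `j + 1`, so the increments of its `p`-th
  -- power telescope to the true change over the pass.
  have tele : ∑ j : Fin k, ∑ i : Fin m, u i (j + 1) ^ p - ∑ j : Fin k, ∑ i : Fin m, u i j ^ p =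
      ∑ i : Fin m, (∑ j ∈ range k, |damped β x xh i j| ^ q) ^ p -
        ∑ i : Fin m, (∑ j ∈ range k, |x i j| ^ q) ^ p := by
    rw [sum_comm, sum_comm (s := univ) (t := univ) (f := fun (j : Fin k) (i : Fin m) => u i j ^ p),
      ← sum_sub_distrib, ← sum_sub_distrib]
    refine sum_congr rfl fun i _ => ?_
    rw [← sum_sub_distrib, ← Finset.sum_range (fun j => u i (j + 1) ^ p - u i j ^ p),
      sum_range_sub (fun j => u i j ^ p)]
    simp only [hu, rowLoad, passLoad_zero, passLoad_last, damped]
  have hc1 : ∑ j : Fin k, ∑ i : Fin m, G i j = ∑ i : Fin m, ∑ j : Fin k, G i j := sum_comm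
  have hc2 : ∑ j : Fin k, ∑ i : Fin m, M i j (y i j) = ∑ i : Fin m, ∑ j : Fin k, M i j (y i j) :=
    sum_comm
  have hc3 : ∑ j : Fin k, ∑ i : Fin m, M i j (x i j) = ∑ i : Fin m, ∑ j : Fin k, M i j (x i j) :=
    sum_comm
  rw [tele, hc1, hc2, hc3] at hsum
  simp only [sum_const, card_univ, Fintype.card_fin, nsmul_eq_mul] at hsum
  have hfin := mul_le_mul_of_nonneg_left hsum2 hβ.pos.le
  linarith

end Pass

/-! ### A barrier for the epigraph of `g x + w |x - x₀| ^ r` -/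

namespace PowBarrier

/-- Height above the line `t = g x`. -/
def height (g : ℝ) (u : ℝ × ℝ) : ℝ := u.2 - g * u.1

/-- Scaled horizontal coordinate. -/
def horiz (s x₀ : ℝ) (u : ℝ × ℝ) : ℝ := s * (u.1 - x₀)

/-- The domain `|y| < τ ^ ρ`, `0 < τ`. -/
def dom (s x₀ g ρ : ℝ) : Set (ℝ × ℝ) :=
  {u | 0 < height g u ∧ |horiz s x₀ u| < height g u ^ ρ}

/-- Slack `τ ^ ρ - ε y`. -/
def slack (s x₀ g ρ ε : ℝ) (u : ℝ × ℝ) : ℝ := height g u ^ ρ - ε * horiz s x₀ u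

/-- Derivative of the slack in direction `v`. -/
def slackD (s g ρ ε : ℝ) (v u : ℝ × ℝ) : ℝ :=
  ρ * height g u ^ (ρ - 1) * height g v - ε * (s * v.1)

/-- Second derivative of the slack. -/
def slackD2 (g ρ : ℝ) (v w u : ℝ × ℝ) : ℝ :=
  ρ * (ρ - 1) * height g u ^ (ρ - 2) * (height g v * height g w)

/-- Third derivative of the slack. -/
def slackD3 (g ρ : ℝ) (v u : ℝ × ℝ) : ℝ :=
  ρ * (ρ - 1) * (ρ - 2) * height g u ^ (ρ - 3) * height g v ^ 3

/-- The barrier. -/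
def phi (s x₀ g ρ : ℝ) (u : ℝ × ℝ) : ℝ :=
  -Real.log (slack s x₀ g ρ 1 u) - Real.log (slack s x₀ g ρ (-1) u) - 8 * Real.log (height g u)

/-- First derivative of `-log` of a slack. -/
def term1 (s x₀ g ρ ε : ℝ) (v u : ℝ × ℝ) : ℝ :=
  -(slackD s g ρ ε v u / slack s x₀ g ρ ε u)

/-- Second derivative of `-log` of a slack. -/
def term2 (s x₀ g ρ ε : ℝ) (v w u : ℝ × ℝ) : ℝ :=
  slackD s g ρ ε v u * slackD s g ρ ε w u / slack s x₀ g ρ ε u ^ 2 -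
    slackD2 g ρ v w u / slack s x₀ g ρ ε u

/-- Third derivative of `-log` of a slack. -/
def term3 (s x₀ g ρ ε : ℝ) (v u : ℝ × ℝ) : ℝ :=
  -(slackD3 g ρ v u / slack s x₀ g ρ ε u) +
    3 * (slackD s g ρ ε v u * slackD2 g ρ v v u) / slack s x₀ g ρ ε u ^ 2 -
    2 * slackD s g ρ ε v u ^ 3 / slack s x₀ g ρ ε u ^ 3

def phi1 (s x₀ g ρ : ℝ) (v u : ℝ × ℝ) : ℝ :=
  term1 s x₀ g ρ 1 v u + term1 s x₀ g ρ (-1) v u - 8 * (height g v / height g u)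

def phi2 (s x₀ g ρ : ℝ) (v w u : ℝ × ℝ) : ℝ :=
  term2 s x₀ g ρ 1 v w u + term2 s x₀ g ρ (-1) v w u +
    8 * (height g v * height g w / height g u ^ 2)

def phi3 (s x₀ g ρ : ℝ) (v u : ℝ × ℝ) : ℝ :=
  term3 s x₀ g ρ 1 v u + term3 s x₀ g ρ (-1) v u - 16 * (height g v ^ 3 / height g u ^ 3)

variable {s x₀ g ρ : ℝ}

lemma continuous_height : Continuous (height g) := by
  unfold height; fun_prop

lemma continuous_horiz : Continuous (horiz s x₀) := by
  unfold horiz; fun_prop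

lemma continuous_height_rpow (hρ : 0 < ρ) : Continuous fun u => height g u ^ ρ :=
  continuous_height.rpow_const fun _ => Or.inr hρ.le

lemma continuous_slack (hρ : 0 < ρ) (ε : ℝ) : Continuous (slack s x₀ g ρ ε) :=
  (continuous_height_rpow hρ).sub (continuous_const.mul continuous_horiz)

lemma isOpen_dom (hρ : 0 < ρ) : IsOpen (dom s x₀ g ρ) :=
  (isOpen_lt continuous_const continuous_height).inter
    (isOpen_lt continuous_horiz.abs (continuous_height_rpow hρ))

lemma height_pos {u : ℝ × ℝ} (hu : u ∈ dom s x₀ g ρ) : 0 < height g u := hu.1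

lemma slack_pos {u : ℝ × ℝ} (hu : u ∈ dom s x₀ g ρ) {ε : ℝ} (hε : ε = 1 ∨ ε = -1) :
    0 < slack s x₀ g ρ ε u := by
  have := abs_lt.1 hu.2
  unfold slack
  rcases hε with rfl | rfl <;> linarith

lemma hasDerivAt_height (u w : ℝ × ℝ) :
    HasDerivAt (fun h : ℝ => height g (u + h • w)) (height g w) 0 := by
  have : (fun h : ℝ => height g (u + h • w)) = fun h => height g u + h * height g w := by
    funext h; simp [height]; ring
  rw [this]
  simpa using ((hasDerivAt_id (0 : ℝ)).mul_const (height g w)).const_add (height g u)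

lemma hasDerivAt_horiz (u w : ℝ × ℝ) :
    HasDerivAt (fun h : ℝ => horiz s x₀ (u + h • w)) (s * w.1) 0 := by
  have : (fun h : ℝ => horiz s x₀ (u + h • w)) = fun h => horiz s x₀ u + h * (s * w.1) := by
    funext h; simp [horiz]; ring
  rw [this]
  simpa using ((hasDerivAt_id (0 : ℝ)).mul_const (s * w.1)).const_add (horiz s x₀ u)

lemma hasDerivAt_height_rpow (a : ℝ) {u : ℝ × ℝ} (hu : u ∈ dom s x₀ g ρ) (w : ℝ × ℝ) :
    HasDerivAt (fun h : ℝ => height g (u + h • w) ^ a)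
      (a * height g u ^ (a - 1) * height g w) 0 := by
  have h1 := (hasDerivAt_height (g := g) u w).rpow_const (p := a)
    (Or.inl (by simpa using (height_pos hu).ne'))
  convert h1 using 1
  simp; ring

lemma hasDerivAt_slack (ε : ℝ) {u : ℝ × ℝ} (hu : u ∈ dom s x₀ g ρ) (w : ℝ × ℝ) :
    HasDerivAt (fun h : ℝ => slack s x₀ g ρ ε (u + h • w)) (slackD s g ρ ε w u) 0 :=
  (hasDerivAt_height_rpow ρ hu w).sub ((hasDerivAt_horiz u w).const_mul ε)

lemma hasDerivAt_slackD (ε : ℝ) {u : ℝ × ℝ} (hu : u ∈ dom s x₀ g ρ) (v w : ℝ × ℝ) :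
    HasDerivAt (fun h : ℝ => slackD s g ρ ε v (u + h • w)) (slackD2 g ρ v w u) 0 := by
  have h := (((hasDerivAt_height_rpow (ρ - 1) hu w).const_mul ρ).mul_const (height g v)).sub_const
    (ε * (s * v.1))
  exact h.congr_deriv (by unfold slackD2; rw [show ρ - 1 - 1 = ρ - 2 by ring]; ring)

lemma hasDerivAt_slackD2 {u : ℝ × ℝ} (hu : u ∈ dom s x₀ g ρ) (v : ℝ × ℝ) :
    HasDerivAt (fun h : ℝ => slackD2 g ρ v v (u + h • v)) (slackD3 g ρ v u) 0 := by
  have h := ((hasDerivAt_height_rpow (ρ - 2) hu v).const_mul (ρ * (ρ - 1))).mul_const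
    (height g v * height g v)
  exact h.congr_deriv (by unfold slackD3; rw [show ρ - 2 - 1 = ρ - 3 by ring]; ring)

lemma D1_phi {u : ℝ × ℝ} (hu : u ∈ dom s x₀ g ρ) (v : ℝ × ℝ) :
    D1 (phi s x₀ g ρ) v u = phi1 s x₀ g ρ v u := by
  have hA := (slack_pos hu (ε := 1) (Or.inl rfl)).ne'
  have hB := (slack_pos hu (ε := -1) (Or.inr rfl)).ne'
  have hC := (height_pos hu).ne'
  have h1 := (hasDerivAt_slack 1 hu v).log (by simpa using hA)
  have h2 := (hasDerivAt_slack (-1) hu v).log (by simpa using hB)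
  have h3 := ((hasDerivAt_height (g := g) u v).log (by simpa using hC)).const_mul 8
  have h := (h1.neg.sub h2).sub h3
  have e : lineDeriv ℝ (phi s x₀ g ρ) u v = _ := h.deriv
  unfold D1
  rw [e]
  simp only [zero_smul, add_zero]
  unfold phi1 term1
  ring

lemma D2_phi (hρ : 0 < ρ) {u : ℝ × ℝ} (hu : u ∈ dom s x₀ g ρ) (v w : ℝ × ℝ) :
    D2 (phi s x₀ g ρ) v w u = phi2 s x₀ g ρ v w u := by
  have hA := (slack_pos hu (ε := 1) (Or.inl rfl)).ne'
  have hB := (slack_pos hu (ε := -1) (Or.inr rfl)).ne'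
  have hC := (height_pos hu).ne'
  unfold D2
  have hev : D1 (phi s x₀ g ρ) v =ᶠ[𝓝 u] phi1 s x₀ g ρ v :=
    Filter.eventuallyEq_of_mem ((isOpen_dom hρ).mem_nhds hu) fun z hz => D1_phi hz v
  have e0 : D1 (D1 (phi s x₀ g ρ) v) w u = lineDeriv ℝ (phi1 s x₀ g ρ v) u w := hev.lineDeriv_eq
  have h1 := ((hasDerivAt_slackD 1 hu v w).div (hasDerivAt_slack 1 hu w) (by simpa using hA)).neg
  have h2 := ((hasDerivAt_slackD (-1) hu v w).div (hasDerivAt_slack (-1) hu w)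
    (by simpa using hB)).neg
  have h3 := ((hasDerivAt_const (0 : ℝ) (height g v)).div (hasDerivAt_height (g := g) u w)
    (by simpa using hC)).const_mul 8
  have h := (h1.add h2).sub h3
  have e : lineDeriv ℝ (phi1 s x₀ g ρ v) u w = _ := h.deriv
  rw [e0, e]
  simp only [zero_smul, add_zero]
  unfold phi2 term2
  field_simp
  ring

lemma D3_phi (hρ : 0 < ρ) {u : ℝ × ℝ} (hu : u ∈ dom s x₀ g ρ) (v : ℝ × ℝ) :
    D3 (phi s x₀ g ρ) v u = phi3 s x₀ g ρ v u := by
  have hA := (slack_pos hu (ε := 1) (Or.inl rfl)).ne'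
  have hB := (slack_pos hu (ε := -1) (Or.inr rfl)).ne'
  have hC := (height_pos hu).ne'
  unfold D3
  have hev : D1 (D1 (phi s x₀ g ρ) v) v =ᶠ[𝓝 u] phi2 s x₀ g ρ v v :=
    Filter.eventuallyEq_of_mem ((isOpen_dom hρ).mem_nhds hu) fun z hz => D2_phi hρ hz v v
  have e0 : D1 (D1 (D1 (phi s x₀ g ρ) v) v) v u = lineDeriv ℝ (phi2 s x₀ g ρ v v) u v :=
    hev.lineDeriv_eq
  have k : ∀ ε, slack s x₀ g ρ ε u ≠ 0 →
      HasDerivAt (fun h : ℝ => term2 s x₀ g ρ ε v v (u + h • v)) (term3 s x₀ g ρ ε v u) 0 := by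
    intro ε hε
    have a1 := hasDerivAt_slackD ε hu v v
    have a2 := hasDerivAt_slack ε hu v
    have a3 := hasDerivAt_slackD2 hu v
    have h := ((a1.mul a1).div (a2.pow 2) (by simpa using hε)).sub (a3.div a2 (by simpa using hε))
    refine h.congr_deriv ?_
    simp only [zero_smul, add_zero, Pi.mul_apply, Pi.pow_apply]
    unfold term3
    field_simp
    ring
  have h3 := ((hasDerivAt_const (0 : ℝ) (height g v * height g v)).div
    ((hasDerivAt_height (g := g) u v).pow 2) (by simpa using hC)).const_mul 8
  have h := ((k 1 hA).add (k (-1) hB)).add h3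
  have e : lineDeriv ℝ (phi2 s x₀ g ρ v v) u v = _ := h.deriv
  rw [e0, e]
  simp only [zero_smul, add_zero, Pi.pow_apply]
  unfold phi3
  field_simp
  ring

end PowBarrier

/-! ### Self-concordance of the barrier, its blow-up at the boundary, and expressions for its
derivatives. -/

namespace PowBarrier

variable {s x₀ g ρ : ℝ}

/-- After squaring, a polynomial inequality in `a, e, o`, certified by a combination of products of
`e ≥ 0` with squares. -/
lemma cubic_le_rpow {a e o : ℝ} (he : 0 ≤ e) (ho : 0 ≤ o) :
    2 * a ^ 3 + 3 * a * e + 2 * e * o + 8 * o ^ 3 ≤ 2 * (a ^ 2 + e + 4 * o ^ 2) ^ (3 / 2 : ℝ) := by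
  set Y := a ^ 2 + e + 4 * o ^ 2 with hY
  have hY0 : 0 ≤ Y := by positivity
  have h1 : (Y ^ (3 / 2 : ℝ)) ^ 2 = Y ^ 3 := by
    rw [← Real.rpow_natCast (Y ^ (3 / 2 : ℝ)) 2, ← Real.rpow_mul hY0]
    norm_num
  apply le_of_sq_le_sq _ (by positivity)
  rw [mul_pow, h1, hY]
  nlinarith [mul_nonneg (sq_nonneg a) (sq_nonneg (e - 4 * a * o)),
    mul_nonneg (sq_nonneg (a * o)) (sq_nonneg (a - o)),
    mul_nonneg (sq_nonneg e) (sq_nonneg (a - 6 * o)),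
    mul_nonneg (mul_nonneg he (sq_nonneg o)) (sq_nonneg (a - o)), pow_nonneg he 3,
    pow_nonneg ho 6, mul_nonneg (sq_nonneg (a * o)) (sq_nonneg o),
    mul_nonneg (sq_nonneg (a ^ 2)) (sq_nonneg o), mul_nonneg (sq_nonneg e) (sq_nonneg o),
    mul_nonneg (mul_nonneg he (sq_nonneg o)) (sq_nonneg o),
    mul_nonneg (mul_nonneg he (sq_nonneg o)) (sq_nonneg a), mul_nonneg (sq_nonneg a) (sq_nonneg e)]

/-- The second derivative of `-log` of a slack as the sum of two non-negative terms. -/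
lemma term2_eq {ε : ℝ} {u : ℝ × ℝ} (hε : slack s x₀ g ρ ε u ≠ 0) (v : ℝ × ℝ) :
    term2 s x₀ g ρ ε v v u = (slackD s g ρ ε v u / slack s x₀ g ρ ε u) ^ 2 +
      -(slackD2 g ρ v v u / slack s x₀ g ρ ε u) := by
  unfold term2; field_simp; ring

lemma curv_nonneg (hρ : 0 < ρ) (hρ1 : ρ < 1) {u : ℝ × ℝ} (hu : u ∈ dom s x₀ g ρ) {ε : ℝ}
    (hε : ε = 1 ∨ ε = -1) (v : ℝ × ℝ) : 0 ≤ -(slackD2 g ρ v v u / slack s x₀ g ρ ε u) := by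
  have hA := slack_pos hu hε
  have hC := height_pos hu
  unfold slackD2
  rw [← neg_div]
  apply div_nonneg _ hA.le
  have : 0 ≤ ρ * (1 - ρ) * height g u ^ (ρ - 2) * (height g v * height g v) := by
    have h1 : 0 < 1 - ρ := by linarith
    have h2 : 0 ≤ height g v * height g v := mul_self_nonneg _
    positivity
  linarith

/-- With `a` the relative slope, `e` the relative curvature of the slack and `o` that of the height,
the third derivative is `(ρ-2) e o - 3 a e - 2 a^3`. The mixed term `e o` is not controlled by `a^2
+ e`; the share `4 o^2` coming from `-log` of the height takes care of it. -/
lemma term3_le (hρ : 0 < ρ) (hρ1 : ρ < 1) {u : ℝ × ℝ} (hu : u ∈ dom s x₀ g ρ) {ε : ℝ}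
    (hε : ε = 1 ∨ ε = -1) (v : ℝ × ℝ) :
    |term3 s x₀ g ρ ε v u| + 8 * |height g v / height g u| ^ 3 ≤
      2 * (term2 s x₀ g ρ ε v v u + 4 * (height g v / height g u) ^ 2) ^ (3 / 2 : ℝ) := by
  have hA := slack_pos hu hε
  have hC := height_pos hu
  set a := slackD s g ρ ε v u / slack s x₀ g ρ ε u with ha
  set e := -(slackD2 g ρ v v u / slack s x₀ g ρ ε u) with he
  set o := height g v / height g u with ho
  have he0 : 0 ≤ e := curv_nonneg hρ hρ1 hu hε v
  have h2 : term2 s x₀ g ρ ε v v u = |a| ^ 2 + e := by rw [term2_eq hA.ne', sq_abs]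
  have hpow : height g u ^ (ρ - 3) = height g u ^ (ρ - 2) / height g u := by
    rw [← Real.rpow_sub_one hC.ne']; congr 1; ring
  have h3 : term3 s x₀ g ρ ε v u = (ρ - 2) * (e * o) - 3 * (a * e) - 2 * a ^ 3 := by
    rw [he, ha, ho]
    unfold term3 slackD3 slackD2
    rw [hpow]
    field_simp
    ring
  have h4 : |term3 s x₀ g ρ ε v u| ≤ 2 * (e * |o|) + 3 * (|a| * e) + 2 * |a| ^ 3 := by
    rw [h3]
    have b1 : |(ρ - 2) * (e * o)| ≤ 2 * (e * |o|) := by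
      rw [abs_mul, abs_mul, abs_of_nonneg he0]
      have : |ρ - 2| ≤ 2 := by rw [abs_le]; constructor <;> linarith
      gcongr
    have b2 : |3 * (a * e)| = 3 * (|a| * e) := by
      rw [abs_mul, abs_mul, abs_of_nonneg he0]; norm_num
    have b3 : |2 * a ^ 3| = 2 * |a| ^ 3 := by rw [abs_mul, abs_pow]; norm_num
    calc _ ≤ |(ρ - 2) * (e * o) - 3 * (a * e)| + |2 * a ^ 3| := abs_sub _ _
      _ ≤ |(ρ - 2) * (e * o)| + |3 * (a * e)| + |2 * a ^ 3| := by
        gcongr; exact abs_sub _ _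
      _ ≤ _ := by rw [b2, b3]; gcongr
  have h5 := cubic_le_rpow (a := |a|) he0 (abs_nonneg o)
  rw [h2, ← sq_abs o]
  linarith

lemma term2_nonneg (hρ : 0 < ρ) (hρ1 : ρ < 1) {u : ℝ × ℝ} (hu : u ∈ dom s x₀ g ρ) {ε : ℝ}
    (hε : ε = 1 ∨ ε = -1) (v : ℝ × ℝ) : 0 ≤ term2 s x₀ g ρ ε v v u := by
  rw [term2_eq (slack_pos hu hε).ne']
  have := curv_nonneg hρ hρ1 hu hε v
  positivity

/-- The coefficient `8` of the logarithm of the height is shared equally by the two slacks;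
superadditivity of the power `3/2` recombines the two halves. -/
lemma third_le (hρ : 0 < ρ) (hρ1 : ρ < 1) {u : ℝ × ℝ} (hu : u ∈ dom s x₀ g ρ) (v : ℝ × ℝ) :
    |D3 (phi s x₀ g ρ) v u| ≤ 2 * (D2 (phi s x₀ g ρ) v v u) ^ (3 / 2 : ℝ) := by
  rw [D3_phi hρ hu, D2_phi hρ hu]
  have hC := height_pos hu
  set o := height g v / height g u with ho
  have e1 : phi2 s x₀ g ρ v v u = (term2 s x₀ g ρ 1 v v u + 4 * o ^ 2) +
      (term2 s x₀ g ρ (-1) v v u + 4 * o ^ 2) := by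
    unfold phi2; rw [ho]; field_simp; ring
  have e2 : phi3 s x₀ g ρ v u = term3 s x₀ g ρ 1 v u + term3 s x₀ g ρ (-1) v u - 16 * o ^ 3 := by
    unfold phi3; rw [ho, div_pow]
  have h1 := term3_le hρ hρ1 hu (ε := 1) (Or.inl rfl) v
  have h2 := term3_le hρ hρ1 hu (ε := -1) (Or.inr rfl) v
  have n1 := term2_nonneg hρ hρ1 hu (ε := 1) (Or.inl rfl) v
  have n2 := term2_nonneg hρ hρ1 hu (ε := -1) (Or.inr rfl) v
  rw [← ho] at h1 h2
  have h3 := Real.add_rpow_le_rpow_add (p := (3 / 2 : ℝ))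
    (by positivity : 0 ≤ term2 s x₀ g ρ 1 v v u + 4 * o ^ 2)
    (by positivity : 0 ≤ term2 s x₀ g ρ (-1) v v u + 4 * o ^ 2) (by norm_num)
  rw [e1, e2]
  have h4 : |term3 s x₀ g ρ 1 v u + term3 s x₀ g ρ (-1) v u - 16 * o ^ 3| ≤
      |term3 s x₀ g ρ 1 v u| + |term3 s x₀ g ρ (-1) v u| + 16 * |o| ^ 3 := by
    refine (abs_sub _ _).trans ?_
    have : |16 * o ^ 3| = 16 * |o| ^ 3 := by rw [abs_mul, abs_pow]; norm_num
    rw [this]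
    gcongr
    exact abs_add_le _ _
  linarith

/-- Cauchy–Schwarz for three logarithms with weights `1, 1, 8`; hence the barrier parameter `10`. -/
lemma grad_le (hρ : 0 < ρ) (hρ1 : ρ < 1) {u : ℝ × ℝ} (hu : u ∈ dom s x₀ g ρ) (v : ℝ × ℝ) :
    (D1 (phi s x₀ g ρ) v u) ^ 2 ≤ 10 * D2 (phi s x₀ g ρ) v v u := by
  rw [D1_phi hu, D2_phi hρ hu]
  have hC := height_pos hu
  unfold phi1 phi2 term1
  rw [term2_eq (slack_pos hu (Or.inl rfl)).ne', term2_eq (slack_pos hu (Or.inr rfl)).ne']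
  have n1 := curv_nonneg hρ hρ1 hu (ε := 1) (Or.inl rfl) v
  have n2 := curv_nonneg hρ hρ1 hu (ε := -1) (Or.inr rfl) v
  have e : height g v * height g v / height g u ^ 2 = (height g v / height g u) ^ 2 := by
    rw [div_pow, sq (height g v)]
  rw [e]
  set a := slackD s g ρ 1 v u / slack s x₀ g ρ 1 u
  set b := slackD s g ρ (-1) v u / slack s x₀ g ρ (-1) u
  set o := height g v / height g u
  nlinarith [sq_nonneg (a - b), sq_nonneg (a - o), sq_nonneg (b - o)]

lemma contDiffOn_phi : ContDiffOn ℝ 3 (phi s x₀ g ρ) (dom s x₀ g ρ) := by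
  have hh : ContDiff ℝ 3 (height g) := by unfold height; fun_prop
  have hz : ContDiff ℝ 3 (horiz s x₀) := by unfold horiz; fun_prop
  have hs : ∀ ε, ContDiffOn ℝ 3 (slack s x₀ g ρ ε) (dom s x₀ g ρ) := fun ε =>
    (hh.contDiffOn.rpow_const_of_ne fun u hu => (height_pos hu).ne').sub
      (contDiff_const.mul hz).contDiffOn
  have h1 := (hs 1).log fun u hu => (slack_pos hu (Or.inl rfl)).ne'
  have h2 := (hs (-1)).log fun u hu => (slack_pos hu (Or.inr rfl)).ne'
  have h3 := hh.contDiffOn.log fun u (hu : u ∈ dom s x₀ g ρ) => (height_pos hu).ne'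
  exact (h1.neg.sub h2).sub (contDiffOn_const.mul h3)

-- One logarithm tends to infinity while the other two arguments stay bounded above near `z`. Only
-- upper bounds are used for them, so points where several arguments vanish at once need no separate
-- treatment.
open Filter in
lemma tendsto_phi (hρ : 0 < ρ) {z : ℝ × ℝ} {ε : ℝ} (hε : ε = 1 ∨ ε = -1)
    (hz : slack s x₀ g ρ ε z = 0) :
    Tendsto (phi s x₀ g ρ) (𝓝[dom s x₀ g ρ] z) atTop := by
  have hdom : ∀ᶠ u in 𝓝[dom s x₀ g ρ] z, u ∈ dom s x₀ g ρ := self_mem_nhdsWithin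
  have key : ∀ f : ℝ × ℝ → ℝ, Continuous f → ∃ C : ℝ, ∀ᶠ u in 𝓝[dom s x₀ g ρ] z, f u ≤ C := by
    intro f hf
    refine ⟨f z + 1, ?_⟩
    have : ∀ᶠ u in 𝓝 z, f u < f z + 1 :=
      (hf.tendsto z).eventually_lt_const (by linarith)
    exact (this.filter_mono nhdsWithin_le_nhds).mono fun u hu => hu.le
  obtain ⟨C₁, h₁⟩ := key _ (continuous_slack (s := s) (x₀ := x₀) (g := g) hρ (-ε))
  obtain ⟨C₂, h₂⟩ := key _ (continuous_height (g := g))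
  have h0 : Tendsto (slack s x₀ g ρ ε) (𝓝[dom s x₀ g ρ] z) (𝓝[>] 0) := by
    rw [tendsto_nhdsWithin_iff]
    refine ⟨?_, hdom.mono fun u hu => slack_pos hu hε⟩
    rw [← hz]
    exact ((continuous_slack hρ ε).tendsto z).mono_left nhdsWithin_le_nhds
  have h3 : Tendsto (fun u => -Real.log (slack s x₀ g ρ ε u)) (𝓝[dom s x₀ g ρ] z) atTop :=
    tendsto_neg_atBot_atTop.comp (Real.tendsto_log_nhdsGT_zero.comp h0)
  have h4 := tendsto_atTop_add_const_right _ (-C₁ - 8 * C₂) h3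
  refine tendsto_atTop_mono' _ ?_ h4
  filter_upwards [hdom, h₁, h₂] with u hu hu1 hu2
  have hε' : -ε = 1 ∨ -ε = -1 := by
    rcases hε with rfl | rfl
    · right; rfl
    · left; norm_num
  have l1 : Real.log (slack s x₀ g ρ (-ε) u) ≤ C₁ := by
    have := Real.log_le_sub_one_of_pos (slack_pos hu hε')
    linarith
  have l2 : Real.log (height g u) ≤ C₂ := by
    have := Real.log_le_sub_one_of_pos (height_pos hu)
    linarith
  have e : phi s x₀ g ρ u = -Real.log (slack s x₀ g ρ ε u) - Real.log (slack s x₀ g ρ (-ε) u) -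
      8 * Real.log (height g u) := by
    unfold phi
    rcases hε with rfl | rfl
    · rfl
    · rw [neg_neg]; ring
  rw [e]
  linarith

/-! Expressions for the derivatives; the variables are `x, t, s, x₀, g, ρ` and the components
`s v₁`, `height v`, `s w₁`, `height w` of the directions. -/

def heightE : RExpr := .bin .sub (.var 1) (.bin .mul (.var 4) (.var 0))

def horizE : RExpr := .bin .mul (.var 2) (.bin .sub (.var 0) (.var 3))

def slackE : Bool → RExpr
  | true => .bin .sub (.bin .pow heightE (.var 5)) horizE
  | false => .bin .add (.bin .pow heightE (.var 5)) horizE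

def slackDE (b : Bool) (i : ℕ) : RExpr :=
  match b with
  | true => .bin .sub (.bin .mul (.bin .mul (.var 5)
      (.bin .pow heightE (.bin .sub (.var 5) (.lit 1)))) (.var (i + 1))) (.var i)
  | false => .bin .add (.bin .mul (.bin .mul (.var 5)
      (.bin .pow heightE (.bin .sub (.var 5) (.lit 1)))) (.var (i + 1))) (.var i)

def slackD2E : RExpr :=
  .bin .mul (.bin .mul (.bin .mul (.var 5) (.bin .sub (.var 5) (.lit 1)))
    (.bin .pow heightE (.bin .sub (.var 5) (.lit 2)))) (.bin .mul (.var 7) (.var 9))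

def phi1E : RExpr :=
  .bin .sub (.bin .add (.un .neg (.bin .div (slackDE true 6) (slackE true)))
    (.un .neg (.bin .div (slackDE false 6) (slackE false))))
    (.bin .mul (.lit 8) (.bin .div (.var 7) heightE))

def term2E (b : Bool) : RExpr :=
  .bin .sub (.bin .div (.bin .mul (slackDE b 6) (slackDE b 8)) (.bin .mul (slackE b) (slackE b)))
    (.bin .div slackD2E (slackE b))

def phi2E : RExpr :=
  .bin .add (.bin .add (term2E true) (term2E false))
    (.bin .mul (.lit 8) (.bin .div (.bin .mul (.var 7) (.var 9)) (.bin .mul heightE heightE)))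

def params (s x₀ g ρ : ℝ) (v w : ℝ × ℝ) : ℕ → ℝ :=
  listEnv [s, x₀, g, ρ, s * v.1, height g v, s * w.1, height g w]

lemma phi1E_eval {u : ℝ × ℝ} (hu : u ∈ dom s x₀ g ρ) (v w : ℝ × ℝ) :
    phi1E.eval (consEnv u.1 (consEnv u.2 (params s x₀ g ρ v w))) = phi1 s x₀ g ρ v u := by
  have hC := height_pos hu
  have hC' : |u.2 - g * u.1| = height g u := abs_of_pos hC
  simp [phi1E, slackDE, slackE, heightE, horizE, RExpr.eval, BinOp.eval, UnOp.eval, consEnv, params,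
    listEnv, hC', phi1, term1, slackD, slack, height, horiz]

lemma phi2E_eval {u : ℝ × ℝ} (hu : u ∈ dom s x₀ g ρ) (v w : ℝ × ℝ) :
    phi2E.eval (consEnv u.1 (consEnv u.2 (params s x₀ g ρ v w))) = phi2 s x₀ g ρ v w u := by
  have hC := height_pos hu
  have hC' : |u.2 - g * u.1| = height g u := abs_of_pos hC
  simp [phi2E, term2E, slackD2E, slackDE, slackE, heightE, horizE, RExpr.eval, BinOp.eval, consEnv,
    params, listEnv, hC', phi2, term2, slackD2, slackD, slack, height, horiz, sq]

lemma phi1E_size : phi1E.size ≤ 300 := by decide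

lemma phi2E_size : phi2E.size ≤ 300 := by decide

end PowBarrier

/-! ### Polylogarithmic bounds -/

lemma one_le_logFactor (m : ℕ) : 1 ≤ 1 + Real.log m := by
  have := Real.log_natCast_nonneg m
  linarith

lemma polylog_nonneg (a m : ℕ) : 0 ≤ polylog a m := by
  have := one_le_logFactor m
  unfold polylog; positivity

lemma polylog_mono {a b : ℕ} (h : a ≤ b) (m : ℕ) : polylog a m ≤ polylog b m := by
  have := one_le_logFactor m
  unfold polylog
  gcongr

lemma le_polylog (a m : ℕ) : (a : ℝ) ≤ polylog a m := by
  have := one_le_pow₀ (one_le_logFactor m) (n := a)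
  unfold polylog
  nlinarith [Nat.cast_nonneg (α := ℝ) a]

lemma polylog_add_le (a b m : ℕ) : polylog a m + polylog b m ≤ polylog (a + b) m := by
  have h := one_le_logFactor m
  have h1 : (1 + Real.log m) ^ a ≤ (1 + Real.log m) ^ (a + b) := by gcongr; omega
  have h2 : (1 + Real.log m) ^ b ≤ (1 + Real.log m) ^ (a + b) := by gcongr; omega
  unfold polylog
  push_cast
  rw [add_mul]
  gcongr

lemma nat_mul_polylog_le (n a m : ℕ) : n * polylog a m ≤ polylog (n * a) m := by
  induction n with
  | zero => simpa using polylog_nonneg 0 m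
  | succ n ih =>
    have := polylog_add_le (n * a) a m
    push_cast
    rw [Nat.succ_mul]
    linarith

lemma polylog_mul_le (a b m : ℕ) : polylog a m * polylog b m ≤ polylog (a * b + a + b) m := by
  have h := one_le_logFactor m
  have e : polylog a m * polylog b m = ((a * b : ℕ) : ℝ) * (1 + Real.log m) ^ (a + b) := by
    unfold polylog; push_cast; ring
  have h1 : (a * b : ℕ) ≤ a * b + a + b := by omega
  have h2 : a + b ≤ a * b + a + b := by omega
  rw [e]
  unfold polylog
  gcongr

/-! ### The functions `g x + w |x - x₀| ^ r` are computable -/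

/-- The function `g x + w |x - x₀| ^ r`. -/
def powFun (g w x₀ r x : ℝ) : ℝ := g * x + w * |x - x₀| ^ r

lemma convexOn_powFun {g w x₀ r : ℝ} (hw : 0 ≤ w) (hr : 1 < r) :
    ConvexOn ℝ Set.univ (powFun g w x₀ r) := by
  have h1 : ConvexOn ℝ Set.univ fun x : ℝ => |x - x₀| ^ r := by
    refine ⟨convex_univ, fun x _ y _ a b ha hb hab => ?_⟩
    have e : a • x + b • y - x₀ = a * (x - x₀) + b * (y - x₀) := by
      simp only [smul_eq_mul]; linear_combination x₀ * hab
    have h2 : |a • x + b • y - x₀| ≤ a * |x - x₀| + b * |y - x₀| := by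
      rw [e]
      refine (abs_add_le _ _).trans ?_
      rw [abs_mul, abs_mul, abs_of_nonneg ha, abs_of_nonneg hb]
    have h3 := (convexOn_rpow hr.le).2 (abs_nonneg (x - x₀)) (abs_nonneg (y - x₀)) ha hb hab
    simp only [smul_eq_mul] at h3 ⊢
    exact (Real.rpow_le_rpow (abs_nonneg _) h2 (by linarith)).trans h3
  have h2 : ConvexOn ℝ Set.univ fun x : ℝ => g * x :=
    ((LinearMap.mulLeft ℝ g).convexOn convex_univ)
  exact h2.add (h1.smul hw)

lemma epi_coe (f : ℝ → ℝ) : epi (fun x => (f x : WithTop ℝ)) = {z | f z.1 ≤ z.2} := by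
  ext z; simp [epi]

lemma isConvexFun_coe {f : ℝ → ℝ} (hf : ConvexOn ℝ Set.univ f) :
    IsConvexFun fun x => (f x : WithTop ℝ) := by
  unfold IsConvexFun
  rw [epi_coe]
  simpa using hf.convex_epigraph

/-- An interior point can be lowered slightly without leaving the epigraph, which forces strict
inequality; the converse is openness of the strict epigraph. -/
lemma interior_epi_coe {f : ℝ → ℝ} (hf : Continuous f) :
    interior (epi fun x => (f x : WithTop ℝ)) = {z | f z.1 < z.2} := by
  rw [epi_coe]
  apply subset_antisymm
  · intro z hz
    rw [mem_interior_iff_mem_nhds] at hz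
    have hc : Filter.Tendsto (fun h : ℝ => (z.1, z.2 - h)) (𝓝[>] 0) (𝓝 z) := by
      have : Continuous fun h : ℝ => (z.1, z.2 - h) := by fun_prop
      have h2 := this.tendsto 0
      simp only [sub_zero, Prod.mk.eta] at h2
      exact h2.mono_left nhdsWithin_le_nhds
    obtain ⟨h, h1, h2⟩ := ((hc.eventually hz).and self_mem_nhdsWithin).exists
    simp only [Set.mem_ofPred_eq] at h1 ⊢
    have : 0 < h := h2
    linarith
  · exact interior_maximal (fun z (hz : f z.1 < z.2) => hz.le)
      (isOpen_lt (hf.comp continuous_fst) continuous_snd)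

lemma continuous_powFun {g w x₀ r : ℝ} (hr : 1 < r) : Continuous (powFun g w x₀ r) := by
  unfold powFun
  exact (continuous_const.mul continuous_id).add (continuous_const.mul
    ((continuous_id.sub continuous_const).abs.rpow_const fun _ => Or.inr (by linarith)))

/-! ### The barrier on the actual epigraph and the bound on its Hessian. -/

namespace PowBarrier

variable {g w x₀ r : ℝ}

lemma abs_horiz_rpow (hw : 0 ≤ w) (hr : 1 < r) (u : ℝ × ℝ) :
    |horiz (w ^ (1 / r)) x₀ u| ^ r = w * |u.1 - x₀| ^ r := by
  unfold horiz
  have h := Real.rpow_nonneg hw (1 / r)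
  rw [abs_mul, abs_of_nonneg h, Real.mul_rpow h (abs_nonneg _), ← Real.rpow_mul hw,
    one_div_mul_cancel (by linarith), Real.rpow_one]

/-- Taking `r`-th roots with `s = w^(1/r)` and `ρ = 1/r` turns the strict epigraph into `|y| < τ^ρ`,
where the right side is concave in `τ`. -/
lemma dom_eq (hw : 0 ≤ w) (hr : 1 < r) :
    dom (w ^ (1 / r)) x₀ g (1 / r) = {z | powFun g w x₀ r z.1 < z.2} := by
  ext u
  have h := abs_horiz_rpow (x₀ := x₀) hw hr u
  have hr0 : 0 < r := by linarith
  simp only [dom, Set.mem_ofPred_eq, powFun]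
  have e : g * u.1 + w * |u.1 - x₀| ^ r < u.2 ↔ w * |u.1 - x₀| ^ r < height g u := by
    unfold height; constructor <;> intro h <;> linarith
  rw [e, ← h]
  constructor
  · rintro ⟨h1, h2⟩
    rw [one_div] at h2 ⊢
    exact (Real.lt_rpow_inv_iff_of_pos (abs_nonneg _) h1.le hr0).1 h2
  · intro h1
    have h2 : 0 < height g u := lt_of_le_of_lt (by positivity) h1
    refine ⟨h2, ?_⟩
    rw [one_div] at h1 ⊢
    exact (Real.lt_rpow_inv_iff_of_pos (abs_nonneg _) h2.le hr0).2 h1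

lemma slack_eq_zero (hw : 0 ≤ w) (hr : 1 < r) {z : ℝ × ℝ} (hz : powFun g w x₀ r z.1 = z.2) :
    ∃ ε : ℝ, (ε = 1 ∨ ε = -1) ∧ slack (w ^ (1 / r)) x₀ g (1 / r) ε z = 0 := by
  have h := abs_horiz_rpow (x₀ := x₀) hw hr z
  have hr0 : 0 < r := by linarith
  have e : height g z = |horiz (w ^ (1 / r)) x₀ z| ^ r := by
    rw [h]; unfold powFun at hz; unfold height; linarith
  have e2 : height g z ^ (1 / r) = |horiz (w ^ (1 / r)) x₀ z| := by
    rw [e, ← Real.rpow_mul (abs_nonneg _), mul_one_div_cancel hr0.ne', Real.rpow_one]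
  unfold slack
  rw [e2]
  rcases le_total 0 (horiz (w ^ (1 / r)) x₀ z) with h1 | h1
  · exact ⟨1, Or.inl rfl, by rw [abs_of_nonneg h1]; ring⟩
  · exact ⟨-1, Or.inr rfl, by rw [abs_of_nonpos h1]; ring⟩

lemma interior_epi (hw : 0 ≤ w) (hr : 1 < r) :
    interior (epi fun x => (powFun g w x₀ r x : WithTop ℝ)) =
      dom (w ^ (1 / r)) x₀ g (1 / r) := by
  rw [interior_epi_coe (continuous_powFun hr), dom_eq hw hr]

lemma isSelfConcordantBarrier (hw : 0 ≤ w) (hr : 1 < r) :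
    IsSelfConcordantBarrier (epi fun x => (powFun g w x₀ r x : WithTop ℝ))
      (phi (w ^ (1 / r)) x₀ g (1 / r)) 10 := by
  have hρ : 0 < 1 / r := by positivity
  have hρ1 : 1 / r < 1 := by rw [div_lt_one (by linarith)]; exact hr
  have hi := interior_epi (g := g) (x₀ := x₀) hw hr
  refine ⟨?_, ?_, ?_, ?_, by norm_num, ?_⟩
  · rw [interior_epi_coe (continuous_powFun hr)]
    exact ⟨(0, powFun g w x₀ r 0 + 1), by simp⟩
  · rw [hi]; exact contDiffOn_phi
  · intro z hz
    have hcl : IsClosed (epi fun x => (powFun g w x₀ r x : WithTop ℝ)) := by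
      rw [epi_coe]
      exact isClosed_le ((continuous_powFun hr).comp continuous_fst) continuous_snd
    rw [hcl.frontier_eq, interior_epi_coe (continuous_powFun hr), epi_coe] at hz
    obtain ⟨ε, h1, h2⟩ := slack_eq_zero (g := g) (x₀ := x₀) hw hr (le_antisymm hz.1 (not_lt.1 hz.2))
    rw [hi]
    exact tendsto_phi hρ h1 h2
  · rw [hi]; exact fun u hu v => third_le hρ hρ1 hu v
  · rw [hi]; exact fun u hu v => grad_le hρ hρ1 hu v

lemma rpow_le_of_inv_le {τ W : ℝ} (hτ : 0 < τ) (hW : 1 ≤ W) (h : 1 / τ ≤ W) {a b : ℝ}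
    (ha : 0 ≤ a) (hab : a ≤ b) : τ ^ (-a) ≤ W ^ b := by
  rw [Real.rpow_neg hτ.le, ← Real.inv_rpow hτ.le, ← one_div]
  exact (Real.rpow_le_rpow (by positivity) h ha).trans (Real.rpow_le_rpow_of_exponent_le hW hab)

/-- Every denominator in the Hessian is a slack or the height, and the exponents `ρ - 1` and `ρ - 2`
are negative, so everything is bounded by powers of `W`. -/
lemma phi2_le_of_inv_le {s x₀ g ρ W R : ℝ} (hρ : 0 < ρ) (hρ1 : ρ < 1) {u : ℝ × ℝ}
    (hu : u ∈ dom s x₀ g ρ) (hR : 1 ≤ R) (hs : 0 ≤ s) (hsR : s ≤ R) (hg : |g| ≤ R) (hW : 1 ≤ W)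
    (hA : ∀ ε : ℝ, ε = 1 ∨ ε = -1 → 1 / slack s x₀ g ρ ε u ≤ W) (hτ : 1 / height g u ≤ W)
    (v : ℝ × ℝ) : phi2 s x₀ g ρ v v u ≤ 32 * (W ^ 4 * R ^ 2) * (v.1 ^ 2 + v.2 ^ 2) := by
  have hC := height_pos hu
  set n := v.1 ^ 2 + v.2 ^ 2 with hn
  have hn0 : 0 ≤ n := by positivity
  have hgs : g ^ 2 ≤ R ^ 2 := sq_le_sq' (by linarith [abs_le.1 hg]) (abs_le.1 hg).2
  have hss : s ^ 2 ≤ R ^ 2 := by gcongr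
  have hR2 : 1 ≤ R ^ 2 := one_le_pow₀ hR
  have hh : height g v ^ 2 ≤ 2 * R ^ 2 * n := by
    have h1 : height g v ^ 2 ≤ (1 + g ^ 2) * n := by
      unfold height; rw [hn]; nlinarith [sq_nonneg (g * v.2 + v.1)]
    exact h1.trans (by gcongr; linarith)
  have hv : (s * v.1) ^ 2 ≤ R ^ 2 * n := by
    rw [mul_pow]
    have : v.1 ^ 2 ≤ n := by rw [hn]; nlinarith [sq_nonneg v.2]
    gcongr
  have t1 : height g u ^ (ρ - 1) ≤ W := by
    have := rpow_le_of_inv_le hC hW hτ (a := 1 - ρ) (b := 1) (by linarith) (by linarith)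
    rwa [neg_sub, Real.rpow_one] at this
  have t2 : height g u ^ (ρ - 2) ≤ W ^ 2 := by
    have := rpow_le_of_inv_le hC hW hτ (a := 2 - ρ) (b := 2) (by linarith) (by linarith)
    rw [neg_sub] at this
    exact_mod_cast this
  have hW2 : 1 ≤ W ^ 2 := one_le_pow₀ hW
  have key : ∀ ε : ℝ, ε = 1 ∨ ε = -1 → term2 s x₀ g ρ ε v v u ≤ 8 * (W ^ 4 * R ^ 2) * n := by
    intro ε hε
    have hS := slack_pos hu hε
    have hSW := hA ε hε
    have hε2 : ε ^ 2 = 1 := by rcases hε with rfl | rfl <;> norm_num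
    have hD : slackD s g ρ ε v u ^ 2 ≤ 6 * (W ^ 2 * R ^ 2) * n := by
      have h1 : slackD s g ρ ε v u ^ 2 ≤
          2 * (height g u ^ (ρ - 1)) ^ 2 * height g v ^ 2 + 2 * (s * v.1) ^ 2 := by
        have a1 : (ρ * height g u ^ (ρ - 1) * height g v) ^ 2 ≤
            (height g u ^ (ρ - 1)) ^ 2 * height g v ^ 2 := by
          rw [mul_pow, mul_pow, mul_assoc]
          exact mul_le_of_le_one_left (by positivity) (by nlinarith)
        have a2 : (ε * (s * v.1)) ^ 2 = (s * v.1) ^ 2 := by rw [mul_pow, hε2, one_mul]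
        unfold slackD
        nlinarith [sq_nonneg (ρ * height g u ^ (ρ - 1) * height g v + ε * (s * v.1))]
      have h2 : 2 * (height g u ^ (ρ - 1)) ^ 2 * height g v ^ 2 ≤ 2 * W ^ 2 * (2 * R ^ 2 * n) := by
        gcongr
      have h3 : R ^ 2 * n ≤ W ^ 2 * (R ^ 2 * n) := le_mul_of_one_le_left (by positivity) hW2
      linarith
    rw [term2_eq hS.ne']
    have p1 : (slackD s g ρ ε v u / slack s x₀ g ρ ε u) ^ 2 ≤ 6 * (W ^ 2 * R ^ 2) * n * W ^ 2 := by
      rw [div_eq_mul_one_div, mul_pow]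
      gcongr
    have p2 : -(slackD2 g ρ v v u / slack s x₀ g ρ ε u) ≤ W ^ 2 * (2 * R ^ 2 * n) * W := by
      have e : -(slackD2 g ρ v v u / slack s x₀ g ρ ε u) =
          (ρ * (1 - ρ)) * (height g u ^ (ρ - 2) * height g v ^ 2 * (1 / slack s x₀ g ρ ε u)) := by
        unfold slackD2; field_simp; ring
      rw [e]
      have : height g u ^ (ρ - 2) * height g v ^ 2 * (1 / slack s x₀ g ρ ε u) ≤
          W ^ 2 * (2 * R ^ 2 * n) * W := by gcongr
      refine (mul_le_of_le_one_left (by positivity) ?_).trans this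
      nlinarith
    have p3 : W ^ 2 * (2 * R ^ 2 * n) * W ≤ W ^ 2 * (2 * R ^ 2 * n) * W ^ 2 := by
      gcongr; nlinarith
    nlinarith
  have hlast : height g v * height g v / height g u ^ 2 ≤ 2 * (W ^ 4 * R ^ 2) * n := by
    have e : height g v * height g v / height g u ^ 2 = height g v ^ 2 * (1 / height g u) ^ 2 := by
      field_simp
    rw [e]
    have h1 : height g v ^ 2 * (1 / height g u) ^ 2 ≤ 2 * R ^ 2 * n * W ^ 2 := by gcongr
    have h2 : 2 * R ^ 2 * n * W ^ 2 ≤ 2 * R ^ 2 * n * W ^ 4 := by gcongr; norm_num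
    linarith
  unfold phi2
  have k1 := key 1 (Or.inl rfl)
  have k2 := key (-1) (Or.inr rfl)
  linarith

lemma inv_le_of_log {a L Q : ℝ} (ha : 0 < a) (hQ : 1 ≤ Q) (h : -Real.log a ≤ L + 9 * Real.log Q) :
    1 / a ≤ Real.exp L * Q ^ 9 := by
  have hQ0 : 0 < Q := by linarith
  rw [← Real.log_le_log_iff (by positivity) (by positivity), one_div, Real.log_inv,
    Real.log_mul (by positivity) (by positivity), Real.log_exp, Real.log_pow]
  exact_mod_cast h

/-- All three arguments of the logarithms are at most `Q`, so an upper bound on the barrier value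
forces each of them away from `0`: one logarithm is isolated and the others, of total weight at most
`9`, are replaced by `log Q`. -/
lemma phi2_le {s x₀ g ρ M R L : ℝ} (hρ : 0 < ρ) (hρ1 : ρ < 1) {u : ℝ × ℝ}
    (hu : u ∈ dom s x₀ g ρ) (hR : 1 ≤ R) (hs : 0 ≤ s) (hsR : s ≤ R) (hg : |g| ≤ R)
    (hx : |x₀| ≤ R) (hM : 1 ≤ M) (h1 : |u.1| ≤ M) (h2 : |u.2| ≤ M) (hL : 0 ≤ L)
    (hφ : phi s x₀ g ρ u ≤ L) (v : ℝ × ℝ) :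
    phi2 s x₀ g ρ v v u ≤
      32 * ((Real.exp L * (4 * R ^ 2 * M) ^ 9) ^ 4 * R ^ 2) * (v.1 ^ 2 + v.2 ^ 2) := by
  set Q := 4 * R ^ 2 * M with hQ
  have hR2 : R ≤ R ^ 2 := by nlinarith
  have hRM : R * M ≤ R ^ 2 * M := by gcongr
  have hRR : R ^ 2 ≤ R ^ 2 * M := le_mul_of_one_le_right (by positivity) hM
  have h1M : 1 ≤ R * M := by nlinarith
  have hQ1 : 1 ≤ Q := by rw [hQ]; linarith
  have hC := height_pos hu
  have hhM : height g u ≤ 2 * (R * M) := by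
    unfold height
    have a1 := (abs_le.1 h2).2
    have a2 : -(g * u.1) ≤ |g| * |u.1| := by rw [← abs_mul]; exact neg_le_abs _
    have a3 : |g| * |u.1| ≤ R * M := by gcongr
    have a4 : M ≤ R * M := le_mul_of_one_le_left (by linarith) hR
    linarith
  have hhρ : height g u ^ ρ ≤ 2 * (R * M) := by
    calc height g u ^ ρ ≤ (2 * (R * M)) ^ ρ := by gcongr
      _ ≤ (2 * (R * M)) ^ (1 : ℝ) := Real.rpow_le_rpow_of_exponent_le (by linarith) hρ1.le
      _ = _ := Real.rpow_one _
  have hz : |horiz s x₀ u| ≤ 2 * (R ^ 2 * M) := by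
    unfold horiz
    rw [abs_mul, abs_of_nonneg hs]
    calc s * |u.1 - x₀| ≤ R * (M + R) := by
          gcongr
          exact (abs_sub _ _).trans (add_le_add h1 hx)
      _ ≤ _ := by nlinarith
  have hS : ∀ ε : ℝ, ε = 1 ∨ ε = -1 → slack s x₀ g ρ ε u ≤ Q := by
    intro ε hε
    have hz' := abs_le.1 hz
    unfold slack
    rcases hε with rfl | rfl <;> rw [hQ] <;> linarith
  have l0 : Real.log (height g u) ≤ Real.log Q := Real.log_le_log hC (by rw [hQ]; linarith)
  have lS : ∀ ε : ℝ, ε = 1 ∨ ε = -1 → Real.log (slack s x₀ g ρ ε u) ≤ Real.log Q := fun ε hε =>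
    Real.log_le_log (slack_pos hu hε) (hS ε hε)
  have lQ : 0 ≤ Real.log Q := Real.log_nonneg hQ1
  have l1 := lS 1 (Or.inl rfl)
  have l2 := lS (-1) (Or.inr rfl)
  unfold phi at hφ
  refine phi2_le_of_inv_le hρ hρ1 hu hR hs hsR hg ?_ ?_ ?_ v
  · have := Real.one_le_exp hL
    have h9 : 1 ≤ Q ^ 9 := one_le_pow₀ hQ1
    nlinarith
  · intro ε hε
    refine inv_le_of_log (slack_pos hu hε) hQ1 ?_
    rcases hε with rfl | rfl <;> linarith
  · exact inv_le_of_log hC hQ1 (by linarith)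

end PowBarrier

/-- With `Y = max |x| R ≥ 2` one has `|x - x₀| ≤ 2 Y ≤ Y^2`, whence the exponent `2 r + 1`. -/
lemma growth_powFun {g w x₀ r R : ℝ} (hR : 2 ≤ R) (hg : |g| ≤ R) (hw : 0 ≤ w) (hwR : w ≤ R)
    (hx : |x₀| ≤ R) (hr : 1 < r) (x : ℝ) :
    |powFun g w x₀ r x| ≤ 2 * (R ^ (2 * r + 1) + |x| ^ (2 * r + 1)) := by
  set Y := max |x| R with hY
  have hYR : R ≤ Y := le_max_right _ _
  have hYx : |x| ≤ Y := le_max_left _ _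
  have hY1 : 1 ≤ Y := by linarith
  have hY0 : 0 < Y := by linarith
  have a1 : |g * x| ≤ Y ^ (2 * r + 1) := by
    calc |g * x| = |g| * |x| := abs_mul _ _
      _ ≤ Y * Y := by gcongr; linarith
      _ = Y ^ (2 : ℝ) := by rw [← sq]; exact_mod_cast rfl
      _ ≤ _ := Real.rpow_le_rpow_of_exponent_le hY1 (by linarith)
  have a2 : |w * |x - x₀| ^ r| ≤ Y ^ (2 * r + 1) := by
    rw [abs_of_nonneg (by positivity)]
    have : |x - x₀| ≤ Y ^ (2 : ℝ) := by
      have e : Y ^ (2 : ℝ) = Y ^ 2 := by exact_mod_cast rfl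
      rw [e]
      have := abs_sub x x₀
      nlinarith
    calc w * |x - x₀| ^ r ≤ Y * (Y ^ (2 : ℝ)) ^ r := by gcongr; linarith
      _ = _ := by rw [← Real.rpow_mul hY0.le, Real.rpow_add_one hY0.ne', mul_comm]
  have a3 : Y ^ (2 * r + 1) ≤ R ^ (2 * r + 1) + |x| ^ (2 * r + 1) := by
    have n1 : 0 ≤ R ^ (2 * r + 1) := Real.rpow_nonneg (by linarith) _
    have n2 : 0 ≤ |x| ^ (2 * r + 1) := Real.rpow_nonneg (abs_nonneg _) _
    rcases max_choice |x| R with h | h <;> rw [hY, h] <;> linarith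
  unfold powFun
  linarith [abs_add_le (g * x) (w * |x - x₀| ^ r)]

/-- The constant used for growth, barrier parameter and evaluation cost. -/
def compConst (A : ℕ) : ℕ := 300 + 6 * A ^ 2 + 3 * A

/-- The constant of the Hessian bound. -/
def hessConst (A a : ℕ) : ℕ := 4 * a + 77 + 74 * A + 36 * (compConst A + 1)

lemma half_le_log {m : ℕ} (hm : 2 ≤ m) : 1 / 2 ≤ Real.log m := by
  have h1 : Real.log 2 ≤ Real.log m := Real.log_le_log (by norm_num) (by exact_mod_cast hm)
  have := Real.log_two_gt_d9
  linarith

lemma isComputable_powFun {A m : ℕ} (hA : 1 ≤ A) (hm : 2 ≤ m) {g w x₀ r : ℝ}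
    (hg : |g| ≤ Real.exp (polylog A m)) (hw : 0 ≤ w) (hwR : w ≤ Real.exp (polylog A m))
    (hx : |x₀| ≤ Real.exp (polylog A m)) (hr : 1 < r) (hrA : r ≤ polylog A m) :
    IsComputable (compConst A) (hessConst A) m (polylog (compConst A) m)
      (fun x => (powFun g w x₀ r x : WithTop ℝ)) := by
  set C := compConst A with hC
  set K := polylog C m with hK
  set R := Real.exp (polylog A m) with hR
  set Λ := 1 + Real.log m with hΛ
  have hΛ1 : 1 ≤ Λ := one_le_logFactor m
  have hpl1 : 1 ≤ polylog A m := le_trans (by exact_mod_cast hA) (le_polylog A m)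
  have hR2 : 2 ≤ R := by
    have := Real.add_one_le_exp (polylog A m)
    linarith
  have hm0 : (0 : ℝ) < m := by positivity
  have hlog := half_le_log hm
  have hm1 : (1 : ℝ) ≤ m := by exact_mod_cast (by omega : 1 ≤ m)
  have hC300 : 300 ≤ C := by rw [hC]; unfold compConst; omega
  have hKC : (C : ℝ) ≤ K := le_polylog C m
  have hK300 : (300 : ℝ) ≤ K := le_trans (by exact_mod_cast hC300) hKC
  have hi := PowBarrier.interior_epi (g := g) (x₀ := x₀) hw hr
  have hρ : 0 < 1 / r := by positivity
  have hρ1 : 1 / r < 1 := by rw [div_lt_one (by linarith)]; exact hr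
  have hA2 : A ≤ A ^ 2 := by nlinarith
  refine ⟨isConvexFun_coe (convexOn_powFun hw hr), ?_, PowBarrier.phi (w ^ (1 / r)) x₀ g (1 / r),
    ⟨10, by linarith, PowBarrier.isSelfConcordantBarrier hw hr⟩, ?_, ?_, ?_⟩
  · intro x y hy
    have hy' : powFun g w x₀ r x = y := WithTop.coe_inj.1 hy
    rw [← hy']
    refine (growth_powFun hR2 hg hw hwR hx hr x).trans ?_
    have hbase : 2 * r + 1 ≤ K := by
      have h1 : 3 * polylog A m ≤ polylog (3 * A) m := by exact_mod_cast nat_mul_polylog_le 3 A m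
      have h2 : polylog (3 * A) m ≤ K := polylog_mono (by rw [hC]; unfold compConst; omega) m
      linarith
    -- Quasi-polynomial parameters fit under `m^K` because `K` exceeds `6` times the square of
    -- `polylog A m`, which accounts for `6 * A ^ 2` in `compConst`, and `log m ≥ 1/2`.
    have b1 : R ^ (2 * r + 1) ≤ (m : ℝ) ^ K := by
      rw [hR, ← Real.exp_mul, Real.rpow_def_of_pos hm0]
      apply Real.exp_le_exp.2
      have h1 : polylog A m * (2 * r + 1) ≤ 3 * polylog A m ^ 2 := by nlinarith
      have h2 : 3 * polylog A m ^ 2 ≤ K / 2 := by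
        have : 6 * polylog A m ^ 2 = (6 * A ^ 2 : ℕ) * Λ ^ (2 * A) := by
          unfold polylog; push_cast; ring
        have h3 : ((6 * A ^ 2 : ℕ) : ℝ) * Λ ^ (2 * A) ≤ K := by
          rw [hK]; unfold polylog
          have c1 : 6 * A ^ 2 ≤ C := by rw [hC]; unfold compConst; omega
          have c2 : 2 * A ≤ C := by rw [hC]; unfold compConst; omega
          gcongr
        linarith
      nlinarith
    have b2 : |x| ^ (2 * r + 1) ≤ (m : ℝ) ^ K + |x| ^ K := by
      have n1 : 1 ≤ (m : ℝ) ^ K := Real.one_le_rpow hm1 (by linarith)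
      have n2 : 0 ≤ |x| ^ K := Real.rpow_nonneg (abs_nonneg _) _
      rcases le_total |x| 1 with h | h
      · have := Real.rpow_le_one (abs_nonneg x) h (by linarith : 0 ≤ 2 * r + 1)
        linarith
      · have := Real.rpow_le_rpow_of_exponent_le h hbase
        linarith
    have n2 : 0 ≤ |x| ^ K := Real.rpow_nonneg (abs_nonneg _) _
    have n3 : (300 : ℝ) ≤ C := by exact_mod_cast hC300
    have n1 : 0 ≤ (m : ℝ) ^ K := by positivity
    nlinarith
  · intro a u hu h1 h2 hφ v
    rw [hi] at hu
    rw [PowBarrier.D2_phi hρ hu]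
    have hs : w ^ (1 / r) ≤ R := by
      calc w ^ (1 / r) ≤ R ^ (1 / r) := by gcongr
        _ ≤ R ^ (1 : ℝ) := Real.rpow_le_rpow_of_exponent_le (by linarith) hρ1.le
        _ = R := Real.rpow_one _
    refine (PowBarrier.phi2_le hρ hρ1 hu (by linarith) (Real.rpow_nonneg hw _) hs hg hx
      (Real.one_le_rpow hm1 (by linarith)) h1 h2 (polylog_nonneg a m) hφ v).trans ?_
    apply mul_le_mul_of_nonneg_right _ (by positivity)
    have hM : (m : ℝ) ^ K = Real.exp (Real.log m * K) := Real.rpow_def_of_pos hm0 K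
    -- Here `32 * 4^36 = 2^77`; the exponents `4, 77, 74, 36` are the coefficients in `hessConst`.
    have e : 32 * ((Real.exp (polylog a m) * (4 * R ^ 2 * (m : ℝ) ^ K) ^ 9) ^ 4 * R ^ 2) =
        2 ^ 77 * (Real.exp (polylog a m) ^ 4 * R ^ 74 * ((m : ℝ) ^ K) ^ 36) := by ring
    rw [e, hM, hR, ← Real.exp_nat_mul, ← Real.exp_nat_mul, ← Real.exp_nat_mul, ← Real.exp_add,
      ← Real.exp_add]
    have h77 : (2 : ℝ) ^ 77 ≤ Real.exp ((77 : ℕ) * 1) := by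
      rw [Real.exp_nat_mul]
      have := Real.exp_one_gt_d9
      gcongr
      linarith
    refine (mul_le_mul_of_nonneg_right h77 (Real.exp_pos _).le).trans ?_
    rw [← Real.exp_add]
    apply Real.exp_le_exp.2
    have c1 : Real.log m * K ≤ polylog (C + 1) m := by
      have : Real.log m * K ≤ C * Λ ^ (C + 1) := by
        have : Real.log m ≤ Λ := by rw [hΛ]; linarith
        calc Real.log m * K ≤ Λ * K := by gcongr
          _ = _ := by rw [hK]; unfold polylog; rw [← hΛ]; ring
      refine this.trans ?_
      unfold polylog
      rw [← hΛ]
      gcongr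
      omega
    have c2 := nat_mul_polylog_le 36 (C + 1) m
    have c3 := nat_mul_polylog_le 74 A m
    have c4 := nat_mul_polylog_le 4 a m
    have c5 := le_polylog 77 m
    have c6 := polylog_add_le (4 * a) 77 m
    have c7 := polylog_add_le (4 * a + 77) (74 * A) m
    have c8 := polylog_add_le (4 * a + 77 + 74 * A) (36 * (C + 1)) m
    unfold hessConst
    rw [← hC]
    push_cast at *
    linarith
  · intro b
    refine ⟨PowBarrier.phi1E, PowBarrier.params (w ^ (1 / r)) x₀ g (1 / r) (coordDir b) 0, ?_, ?_⟩
    · exact le_trans (by exact_mod_cast PowBarrier.phi1E_size) hK300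
    · intro z hz
      rw [hi] at hz
      rw [PowBarrier.phi1E_eval hz, PowBarrier.D1_phi hz]
  · intro b b'
    refine ⟨PowBarrier.phi2E,
      PowBarrier.params (w ^ (1 / r)) x₀ g (1 / r) (coordDir b) (coordDir b'), ?_, ?_⟩
    · exact le_trans (by exact_mod_cast PowBarrier.phi2E_size) hK300
    · intro z hz
      rw [hi] at hz
      rw [PowBarrier.phi2E_eval hz, PowBarrier.D2_phi hρ hz]

/-- The degenerate interval `[0, 0]` leaves only the decomposition `0 + x`. -/
lemma isSplit_of_isComputable {C : ℕ} {H : ℕ → ℕ} {m : ℕ} {K : ℝ} {f : ℝ → ℝ}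
    (hK : K ≤ polylog C m)
    (h0 : IsComputable C H m K fun _ => ((0 : ℝ) : WithTop ℝ))
    (hf : IsComputable C H m K fun x => (f x : WithTop ℝ)) :
    IsSplit C H m fun x => (f x : WithTop ℝ) := by
  refine ⟨0, 0, K, K, _, _, le_rfl, le_rfl, hK, hK, h0, hf, fun x => ?_⟩
  have e : {v : WithTop ℝ | ∃ a ∈ Set.Icc (0 : ℝ) 0, v = ((0 : ℝ) : WithTop ℝ) +
      (f (x - a) : WithTop ℝ)} = {(f x : WithTop ℝ)} := by
    ext v
    simp
  rw [e]
  exact isLeast_singleton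

/-- Sums of a linear function and two powers are decomposable. -/
lemma isDecomposable_powFun {A m : ℕ} (hA : 2 ≤ A) (hm : 2 ≤ m) {g w w' x₀ r r' : ℝ}
    (hg : |g| ≤ Real.exp (polylog A m)) (hw : 0 ≤ w) (hwR : w ≤ Real.exp (polylog A m))
    (hw' : 0 ≤ w') (hwR' : w' ≤ Real.exp (polylog A m))
    (hx : |x₀| ≤ Real.exp (polylog A m)) (hr : 1 < r) (hrA : r ≤ polylog A m)
    (hr' : 1 < r') (hrA' : r' ≤ polylog A m) :
    IsDecomposable (compConst A) (hessConst A) m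
      (fun x => ((powFun g w 0 r x + powFun 0 w' x₀ r' x : ℝ) : WithTop ℝ)) := by
  have hA1 : 1 ≤ A := by omega
  have hz : |(0 : ℝ)| ≤ Real.exp (polylog A m) := by rw [abs_zero]; positivity
  have h0 : IsComputable (compConst A) (hessConst A) m (polylog (compConst A) m)
      (fun _ => ((0 : ℝ) : WithTop ℝ)) := by
    have h2 : (2 : ℝ) ≤ polylog A m := le_trans (by exact_mod_cast hA) (le_polylog A m)
    have := isComputable_powFun hA1 hm hz le_rfl (Real.exp_pos _).le hz one_lt_two h2
    simpa [powFun] using this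
  refine ⟨isConvexFun_coe ((convexOn_powFun hw hr).add (convexOn_powFun hw' hr')), 2,
    ![fun x => (powFun g w 0 r x : WithTop ℝ), fun x => (powFun 0 w' x₀ r' x : WithTop ℝ)],
    by unfold compConst; omega, ?_, fun x => by simp⟩
  intro l
  fin_cases l
  · exact isSplit_of_isComputable le_rfl h0 (isComputable_powFun hA1 hm hg hw hwR hz hr hrA)
  · exact isSplit_of_isComputable le_rfl h0 (isComputable_powFun hA1 hm hz hw' hwR' hx hr' hrA')

/-! ### Loops of the machine -/

section Machine

variable {m k : ℕ} {O : Fin k → Oracle m}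

/-- A loop with `n` rounds that maintains the invariant `I`. -/
lemma exec_while {b : Test} {P : Cmd} {I : ℕ → State → Prop} {n : ℕ}
    (htrue : ∀ i s, i < n → I i s → b.holds s) (hfalse : ∀ s, I n s → ¬ b.holds s)
    (hstep : ∀ i s, i < n → I i s → ∃ s', Exec O P (s.tick 1) s' ∧ I (i + 1) s') {s : State}
    (h0 : I 0 s) : ∃ s', Exec O (.while b P) s (s'.tick 1) ∧ I n s' := by
  suffices h : ∀ d i s, i + d = n → I i s → ∃ s', Exec O (.while b P) s (s'.tick 1) ∧ I n s' from
    h n 0 s (zero_add n) h0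
  intro d
  induction d with
  | zero =>
    intro i s hi hs
    obtain rfl : i = n := by omega
    exact ⟨s, .whileFalse (hfalse s hs), hs⟩
  | succ d ih =>
    intro i s hi hs
    obtain ⟨s₁, h₁, h₂⟩ := hstep i s (by omega) hs
    obtain ⟨s₂, h₃, h₄⟩ := ih (i + 1) s₁ (by omega) h₂
    exact ⟨s₂, .whileTrue (htrue i s (by omega) hs) h₁ h₃, h₄⟩

/-- Replace the first `m` entries of column `c` of array `b` by the values of `f`. -/
def setCol (m b c : ℕ) (f : ℕ → ℝ) (r : ℕ → ℕ → ℕ → ℝ) : ℕ → ℕ → ℕ → ℝ :=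
  fun b' i l => if b' = b ∧ i < m ∧ l = c then f i else r b' i l

lemma setCol_same {m b c : ℕ} {f : ℕ → ℝ} {r : ℕ → ℕ → ℕ → ℝ} {i : ℕ} (hi : i < m) :
    setCol m b c f r b i c = f i := by simp [setCol, hi]

lemma setCol_arr {m b c : ℕ} {f : ℕ → ℝ} {r : ℕ → ℕ → ℕ → ℝ} {b' : ℕ} (h : b' ≠ b) :
    setCol m b c f r b' = r b' := by
  funext i l; simp [setCol, h]

lemma setCol_col {m b c : ℕ} {f : ℕ → ℝ} {r : ℕ → ℕ → ℕ → ℝ} {b' i l : ℕ} (h : l ≠ c) :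
    setCol m b c f r b' i l = r b' i l := by simp [setCol, h]

/-- The content of a cell when register `3` holds `i`. -/
def State.readRow (s : State) (i : ℕ) (a : Ref) : ℝ :=
  s.real a.arr (Function.update s.nat 3 i a.row) (Function.update s.nat 3 i a.col)

/-- For all rows `i`, assign the value of `e` to the entry `i` of the column of array `dst` given by
register `c`. -/
def mapCol (dst c : ℕ) (args : List Ref) (e : RExpr) : Cmd :=
  .seq (.setNat 3 0) (.while (.natLt 3 0)
    (.seq (.setReal ⟨dst, 3, c⟩ args e) (.addNat 3 3 5)))

/-- The hypothesis `hargs` lets an argument read the array being overwritten only in the current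
row, so assignments made in earlier rounds are never seen. -/
lemma exec_mapCol {dst c : ℕ} {args : List Ref} {e : RExpr} (hc : c ≠ 3)
    (hargs : ∀ a ∈ args, a.arr = dst → a.row = 3) {s : State} (h5 : s.nat 5 = 1)
    (hm : s.nat 0 = m) :
    ∃ s', Exec O (mapCol dst c args e) s s' ∧ (∀ n, n ≠ 3 → s'.nat n = s.nat n) ∧
      s'.calls = s.calls ∧ s'.steps = s.steps + (2 + m * (3 + args.length + e.size)) ∧
      s'.real = setCol m dst (s.nat c) (fun i => e.eval (listEnv (args.map (s.readRow i))))
        s.real := by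
  set f : ℕ → ℝ := fun i => e.eval (listEnv (args.map (s.readRow i))) with hf
  let I : ℕ → State → Prop := fun i t => t.nat = Function.update s.nat 3 i ∧ t.calls = s.calls ∧
    t.steps = s.steps + (1 + i * (3 + args.length + e.size)) ∧
    t.real = setCol i dst (s.nat c) f s.real
  obtain ⟨t, h1, h2, h3, h4, h5'⟩ := exec_while (O := O) (b := .natLt 3 0)
    (P := .seq (.setReal ⟨dst, 3, c⟩ args e) (.addNat 3 3 5)) (I := I) (n := m)
    (s := ({ s with nat := Function.update s.nat 3 0 }.tick 1))
    (by
      rintro i t hi ⟨h1, -⟩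
      simp [Test.holds, h1, hm, hi])
    (by
      rintro t ⟨h1, -⟩
      simp [Test.holds, h1, hm])
    (by
      rintro i t hi ⟨h1, h2, h3, h4⟩
      refine ⟨_, .seq (.setReal _ _ _ _) (.addNat _ _ _ _), ?_, ?_, ?_, ?_⟩
      · simp [State.tick, State.write, h1, h5]
      · simp [State.tick, State.write, h2]
      · simp [State.tick, State.write, h3]; ring
      · have hread : args.map (t.tick 1).read = args.map (s.readRow i) := by
          refine List.map_congr_left fun a ha => ?_
          simp only [State.read, State.tick, State.readRow, h1, h4]
          by_cases hd : a.arr = dst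
          · have hr := hargs a ha hd
            simp [setCol, hr]
          · rw [setCol_arr hd]
        simp only [State.tick, State.write, h1, h4, Function.update_self,
          Function.update_of_ne hc]
        simp only [State.tick, h1, h4] at hread
        rw [hread]
        funext b' i' l
        simp only [setCol]
        by_cases hb : b' = dst <;> by_cases hl : l = s.nat c <;> simp [hb, hl, hf]
        rcases lt_trichotomy i' i with h | h | h
        · simp [h, h.ne, h.le]
        · simp [h]
        · simp [h.ne', not_lt.2 h.le, not_le.2 h])
    ⟨rfl, rfl, by simp [State.tick], by funext b' i l; simp [setCol, State.tick]⟩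
  refine ⟨_, .seq (.setNat _ _ _) h1, ?_, ?_, ?_, ?_⟩
  · intro n hn
    simp [State.tick, h2, Function.update_of_ne hn]
  · simp [State.tick, h3]
  · simp [State.tick, h4]; ring
  · simp [State.tick, h5']

lemma exec_query {r : ℕ} {params : List ℕ} {e : RExpr} {dst : ℕ} {s : State} {j : Fin k}
    (hj : s.nat r = j) :
    ∃ s', Exec O (.query r params e dst) s s' ∧ s'.nat = s.nat ∧
      s'.calls = Function.update s.calls j (s.calls j + 1) ∧
      s'.steps = s.steps + (1 + m * (1 + params.length + e.size)) ∧
      (∀ b, b ≠ dst → s'.real b = s.real b) ∧ (∀ i l : ℕ, l ≠ j → s'.real dst i l = s.real dst i l) ∧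
      (fun i : Fin m => s'.real dst i j) = O j (queryFun m s j params e) := by
  refine ⟨_, .query s r params e dst j hj, rfl, rfl, rfl, ?_, ?_, ?_⟩
  · intro b hb
    funext i l
    simp [State.tick, State.answer, hb]
  · intro i l hl
    simp [State.tick, State.answer, hl]
  · funext i
    simp [State.tick, State.answer]

/-! ### One pass -/

/-- The function charged to an entry, with general weights. -/
def passCost (q : ℝ) (p : ℕ) (μ ω u x v : ℝ) : ℝ :=
  μ * p * u ^ (p - 1) / 2 * (powDeriv q x * v + |v| ^ q) + ω * |v - x| ^ ((p : ℝ) * q)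

/-- `xh` collects the answers to the queries made along a pass that starts at `x`. -/
def IsAnswer (O : Fin k → Oracle m) (q : ℝ) (p : ℕ) (β μ ω : ℝ) (x xh : ℕ → ℕ → ℝ) (j : Fin k) :
    Prop :=
  (fun i : Fin m => xh i j) = O j fun i v =>
    ((passCost q p μ ω (rowLoad q k β x xh i j) (x i j) v : ℝ) : WithTop ℝ)

def slopeE : RExpr := .bin .mul (.bin .mul (.var 1) (.var 0))
  (.bin .pow (.var 0) (.bin .sub (.var 1) (.lit 2)))

def weightE : RExpr := .bin .div (.bin .mul (.bin .mul (.var 0) (.var 1))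
  (.bin .pow (.var 2) (.bin .sub (.var 1) (.lit 1)))) (.lit 2)

def costE : RExpr := .bin .add
  (.bin .mul (.var 3) (.bin .add (.bin .mul (.var 2) (.var 0)) (.bin .pow (.var 0) (.var 5))))
  (.bin .mul (.var 4) (.bin .pow (.bin .sub (.var 0) (.var 1)) (.var 6)))

def moveE : RExpr := .bin .add (.var 0) (.bin .mul (.var 2) (.bin .sub (.var 1) (.var 0)))

def loadE : RExpr := .bin .add (.var 4)
  (.bin .sub (.bin .pow moveE (.var 3)) (.bin .pow (.var 0) (.var 3)))

/-- The work on one block. Array `1` holds the matrix, `2` the answers, `8` the row loads; the scalars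
`q, p, β, pq, μ, ω` are at the origin of the arrays `0, 10, 12, 13, 14, 15`. -/
def blockProg : Cmd :=
  .seq (mapCol 3 4 [⟨1, 3, 4⟩, ⟨0, 7, 7⟩] slopeE)
  (.seq (mapCol 4 4 [⟨14, 7, 7⟩, ⟨10, 7, 7⟩, ⟨8, 3, 7⟩] weightE)
  (.seq (mapCol 5 4 [⟨15, 7, 7⟩] (.var 0))
  (.seq (mapCol 6 4 [⟨0, 7, 7⟩] (.var 0))
  (.seq (mapCol 7 4 [⟨13, 7, 7⟩] (.var 0))
  (.seq (.query 4 [1, 3, 4, 5, 6, 7] costE 2)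
  (.seq (mapCol 8 7 [⟨1, 3, 4⟩, ⟨2, 3, 4⟩, ⟨12, 7, 7⟩, ⟨0, 7, 7⟩, ⟨8, 3, 7⟩] loadE)
  (.seq (mapCol 1 4 [⟨1, 3, 4⟩, ⟨2, 3, 4⟩, ⟨12, 7, 7⟩] moveE)
    (.addNat 4 4 5))))))))

def passProg : Cmd := .seq (.setNat 4 0) (.while (.natLt 4 1) blockProg)

/-- The registers and scalars a pass relies on. -/
structure Ready (m k : ℕ) (q : ℝ) (p : ℕ) (β μ ω : ℝ) (s : State) : Prop where
  rows : s.nat 0 = m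
  cols : s.nat 1 = k
  one : s.nat 5 = 1
  zero : s.nat 7 = 0
  q_eq : s.real 0 0 0 = q
  p_eq : s.real 10 0 0 = p
  step_eq : s.real 12 0 0 = β
  exponent_eq : s.real 13 0 0 = p * q
  main_eq : s.real 14 0 0 = μ
  tail_eq : s.real 15 0 0 = ω

lemma Ready.of_frame {q : ℝ} {p : ℕ} {β μ ω : ℝ} {s s' : State} (h : Ready m k q p β μ ω s)
    (hn : ∀ n, n ≠ 3 → n ≠ 4 → s'.nat n = s.nat n)
    (hr : ∀ b, b = 0 ∨ 10 ≤ b → s'.real b = s.real b) : Ready m k q p β μ ω s' := by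
  constructor
  · rw [hn 0 (by decide) (by decide), h.rows]
  · rw [hn 1 (by decide) (by decide), h.cols]
  · rw [hn 5 (by decide) (by decide), h.one]
  · rw [hn 7 (by decide) (by decide), h.zero]
  · rw [hr 0 (Or.inl rfl), h.q_eq]
  · rw [hr 10 (by norm_num), h.p_eq]
  · rw [hr 12 (by norm_num), h.step_eq]
  · rw [hr 13 (by norm_num), h.exponent_eq]
  · rw [hr 14 (by norm_num), h.main_eq]
  · rw [hr 15 (by norm_num), h.tail_eq]

/-- Array `1` holds `x` and array `8` the loads of its rows. -/
structure Holds (m k : ℕ) (q : ℝ) (x : ℕ → ℕ → ℝ) (s : State) : Prop where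
  entry : ∀ i j, i < m → j < k → s.real 1 i j = x i j
  load : ∀ i, i < m → s.real 8 i 0 = ∑ l ∈ Finset.range k, |x i l| ^ q

/-- A query reads its parameters at row `i`, column `j`, so even the scalars `ω, q, p q` are copied
down a column first. The loads are updated before the matrix because the update needs the old entry.
Nonnegative loads are required since the machine's power takes absolute values. -/
lemma exec_blockProg {q : ℝ} {p : ℕ} {β μ ω : ℝ} (hp : 1 ≤ p) {s : State}
    (h : Ready m k q p β μ ω s) (j : Fin k) (hj : s.nat 4 = j)
    (hload : ∀ i, i < m → 0 ≤ s.real 8 i 0) :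
    ∃ s', Exec O blockProg s s' ∧ (∀ n, n ≠ 3 → n ≠ 4 → s'.nat n = s.nat n) ∧ s'.nat 4 = j + 1 ∧
      s'.calls = Function.update s.calls j (s.calls j + 1) ∧ s'.steps ≤ s.steps + 200 * (m + 1) ∧
      (∀ b, b = 0 ∨ 10 ≤ b → s'.real b = s.real b) ∧
      (∀ i l : ℕ, l ≠ j → s'.real 1 i l = s.real 1 i l) ∧
      (∀ i l : ℕ, l ≠ j → s'.real 2 i l = s.real 2 i l) ∧
      (fun i : Fin m => s'.real 2 i j) = O j (fun i v =>
        ((passCost q p μ ω (s.real 8 i 0) (s.real 1 i j) v : ℝ) : WithTop ℝ)) ∧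
      (∀ i, i < m → s'.real 1 i j = s.real 1 i j + β * (s'.real 2 i j - s.real 1 i j)) ∧
      (∀ i, i < m → s'.real 8 i 0 = s.real 8 i 0 +
        (|s.real 1 i j + β * (s'.real 2 i j - s.real 1 i j)| ^ q - |s.real 1 i j| ^ q)) := by
  obtain ⟨s1, e1, n1, c1, t1, r1⟩ := exec_mapCol (O := O) (dst := 3) (c := 4)
    (args := [⟨1, 3, 4⟩, ⟨0, 7, 7⟩]) (e := slopeE) (by decide) (by simp) h.one h.rows
  have H1 : Ready m k q p β μ ω s1 := h.of_frame (fun n hn _ => n1 n hn)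
    (fun b hb => by rw [r1, setCol_arr (by omega)])
  obtain ⟨s2, e2, n2, c2, t2, r2⟩ := exec_mapCol (O := O) (dst := 4) (c := 4)
    (args := [⟨14, 7, 7⟩, ⟨10, 7, 7⟩, ⟨8, 3, 7⟩]) (e := weightE) (by decide) (by simp) H1.one H1.rows
  have H2 : Ready m k q p β μ ω s2 := H1.of_frame (fun n hn _ => n2 n hn)
    (fun b hb => by rw [r2, setCol_arr (by omega)])
  obtain ⟨s3, e3, n3, c3, t3, r3⟩ := exec_mapCol (O := O) (dst := 5) (c := 4)
    (args := [⟨15, 7, 7⟩]) (e := .var 0) (by decide) (by simp) H2.one H2.rows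
  have H3 : Ready m k q p β μ ω s3 := H2.of_frame (fun n hn _ => n3 n hn)
    (fun b hb => by rw [r3, setCol_arr (by omega)])
  obtain ⟨s4, e4, n4, c4, t4, r4⟩ := exec_mapCol (O := O) (dst := 6) (c := 4)
    (args := [⟨0, 7, 7⟩]) (e := .var 0) (by decide) (by simp) H3.one H3.rows
  have H4 : Ready m k q p β μ ω s4 := H3.of_frame (fun n hn _ => n4 n hn)
    (fun b hb => by rw [r4, setCol_arr (by omega)])
  obtain ⟨s5, e5, n5, c5, t5, r5⟩ := exec_mapCol (O := O) (dst := 7) (c := 4)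
    (args := [⟨13, 7, 7⟩]) (e := .var 0) (by decide) (by simp) H4.one H4.rows
  have H5 : Ready m k q p β μ ω s5 := H4.of_frame (fun n hn _ => n5 n hn)
    (fun b hb => by rw [r5, setCol_arr (by omega)])
  have j1 : s1.nat 4 = j := by rw [n1 4 (by decide), hj]
  have j2 : s2.nat 4 = j := by rw [n2 4 (by decide), j1]
  have j3 : s3.nat 4 = j := by rw [n3 4 (by decide), j2]
  have j4 : s4.nat 4 = j := by rw [n4 4 (by decide), j3]
  have j5 : s5.nat 4 = j := by rw [n5 4 (by decide), j4]
  obtain ⟨s6, e6, n6, c6, t6, f6, g6, a6⟩ := exec_query (O := O) (params := [1, 3, 4, 5, 6, 7])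
    (e := costE) (dst := 2) j5
  have H6 : Ready m k q p β μ ω s6 := H5.of_frame (fun n _ _ => by rw [n6])
    (fun b hb => f6 b (by omega))
  have j6 : s6.nat 4 = j := by rw [n6, j5]
  obtain ⟨s7, e7, n7, c7, t7, r7⟩ := exec_mapCol (O := O) (dst := 8) (c := 7)
    (args := [⟨1, 3, 4⟩, ⟨2, 3, 4⟩, ⟨12, 7, 7⟩, ⟨0, 7, 7⟩, ⟨8, 3, 7⟩]) (e := loadE) (by decide)
    (by simp) H6.one H6.rows
  have H7 : Ready m k q p β μ ω s7 := H6.of_frame (fun n hn _ => n7 n hn)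
    (fun b hb => by rw [r7, setCol_arr (by omega)])
  have j7 : s7.nat 4 = j := by rw [n7 4 (by decide), j6]
  obtain ⟨s8, e8, n8, c8, t8, r8⟩ := exec_mapCol (O := O) (dst := 1) (c := 4)
    (args := [⟨1, 3, 4⟩, ⟨2, 3, 4⟩, ⟨12, 7, 7⟩]) (e := moveE) (by decide) (by simp) H7.one H7.rows
  have H8 : Ready m k q p β μ ω s8 := H7.of_frame (fun n hn _ => n8 n hn)
    (fun b hb => by rw [r8, setCol_arr (by omega)])
  have j8 : s8.nat 4 = j := by rw [n8 4 (by decide), j7]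
  rw [j7] at r8
  rw [H6.zero] at r7
  -- arrays before the query
  have A1 : s5.real 1 = s.real 1 := by
    rw [r5, setCol_arr (by decide), r4, setCol_arr (by decide), r3, setCol_arr (by decide), r2,
      setCol_arr (by decide), r1, setCol_arr (by decide)]
  have A8 : s5.real 8 = s.real 8 := by
    rw [r5, setCol_arr (by decide), r4, setCol_arr (by decide), r3, setCol_arr (by decide), r2,
      setCol_arr (by decide), r1, setCol_arr (by decide)]
  have A2 : s5.real 2 = s.real 2 := by
    rw [r5, setCol_arr (by decide), r4, setCol_arr (by decide), r3, setCol_arr (by decide), r2,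
      setCol_arr (by decide), r1, setCol_arr (by decide)]
  have A81 : s1.real 8 = s.real 8 := by rw [r1, setCol_arr (by decide)]
  have A3 : ∀ i, i < m → s5.real 3 i j = powDeriv q (s.real 1 i j) := by
    intro i hi
    rw [r5, setCol_arr (by decide), r4, setCol_arr (by decide), r3, setCol_arr (by decide), r2,
      setCol_arr (by decide), r1, hj, setCol_same hi]
    simp [State.readRow, slopeE, RExpr.eval, BinOp.eval, listEnv, hj, h.zero, h.q_eq, powDeriv]
  have A4 : ∀ i, i < m → s5.real 4 i j = μ * p * s.real 8 i 0 ^ (p - 1) / 2 := by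
    intro i hi
    rw [r5, setCol_arr (by decide), r4, setCol_arr (by decide), r3, setCol_arr (by decide), r2,
      j1, setCol_same hi]
    have hpow : |s.real 8 i 0| ^ ((p : ℝ) - 1) = s.real 8 i 0 ^ (p - 1) := by
      rw [abs_of_nonneg (hload i hi), ← Real.rpow_natCast, Nat.cast_sub hp, Nat.cast_one]
    simp [State.readRow, weightE, RExpr.eval, BinOp.eval, listEnv, H1.zero, H1.main_eq, H1.p_eq, A81,
      hpow]
  have A5 : ∀ i, i < m → s5.real 5 i j = ω := by
    intro i hi
    rw [r5, setCol_arr (by decide), r4, setCol_arr (by decide), r3, j2, setCol_same hi]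
    simp [State.readRow, RExpr.eval, listEnv, H2.zero, H2.tail_eq]
  have A6 : ∀ i, i < m → s5.real 6 i j = q := by
    intro i hi
    rw [r5, setCol_arr (by decide), r4, j3, setCol_same hi]
    simp [State.readRow, RExpr.eval, listEnv, H3.zero, H3.q_eq]
  have A7 : ∀ i, i < m → s5.real 7 i j = p * q := by
    intro i hi
    rw [r5, j4, setCol_same hi]
    simp [State.readRow, RExpr.eval, listEnv, H4.zero, H4.exponent_eq]
  have B1 : s6.real 1 = s.real 1 := by rw [f6 1 (by decide), A1]
  have B8 : s6.real 8 = s.real 8 := by rw [f6 8 (by decide), A8]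
  have C1 : s7.real 1 = s.real 1 := by rw [r7, setCol_arr (by decide), B1]
  have C2 : s7.real 2 = s6.real 2 := by rw [r7, setCol_arr (by decide)]
  have D2' : s8.real 2 = s6.real 2 := by rw [r8, setCol_arr (by decide), C2]
  refine ⟨_, .seq e1 (.seq e2 (.seq e3 (.seq e4 (.seq e5 (.seq e6 (.seq e7 (.seq e8
    (.addNat s8 4 4 5)))))))), ?_, ?_, ?_, ?_, ?_, ?_, ?_, ?_, ?_, ?_⟩
  · intro n h3 h4
    simp only [State.tick, Function.update_of_ne h4]
    rw [n8 n h3, n7 n h3, n6, n5 n h3, n4 n h3, n3 n h3, n2 n h3, n1 n h3]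
  · simp [State.tick, j8, H8.one]
  · simp only [State.tick]
    rw [c8, c7, c6, c5, c4, c3, c2, c1]
  · simp only [State.tick]
    rw [t8, t7, t6, t5, t4, t3, t2, t1]
    simp [slopeE, weightE, costE, moveE, loadE, RExpr.size]
    ring_nf
    omega
  · intro b hb
    simp only [State.tick]
    rw [r8, setCol_arr (by omega), r7, setCol_arr (by omega), f6 b (by omega), r5,
      setCol_arr (by omega), r4, setCol_arr (by omega), r3, setCol_arr (by omega), r2,
      setCol_arr (by omega), r1, setCol_arr (by omega)]
  · intro i l hl
    simp only [State.tick]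
    rw [r8, setCol_col hl, C1]
  · intro i l hl
    simp only [State.tick]
    rw [D2', g6 i l hl, A2]
  · simp only [State.tick]
    rw [D2', a6]
    congr 1
    funext i v
    simp [queryFun, costE, RExpr.eval, BinOp.eval, consEnv, listEnv, passCost, A1, A3 i i.2, A4 i i.2,
      A5 i i.2, A6 i i.2, A7 i i.2]
  · intro i hi
    simp only [State.tick]
    rw [D2', r8, setCol_same hi]
    simp [State.readRow, moveE, RExpr.eval, BinOp.eval, listEnv, j7, C1, C2, H7.zero, H7.step_eq]
  · intro i hi
    simp only [State.tick]
    rw [D2', r8, setCol_arr (by decide), r7, setCol_same hi]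
    simp [State.readRow, loadE, moveE, RExpr.eval, BinOp.eval, listEnv, j6, B1, B8, H6.zero,
      H6.step_eq, H6.q_eq]

lemma passLoad_congr {q : ℝ} {k : ℕ} {β : ℝ} {x e e' : ℕ → ℝ} {j : ℕ}
    (h : ∀ l, l < j → e l = e' l) : passLoad q k β x e j = passLoad q k β x e' j := by
  unfold passLoad
  refine Finset.sum_congr rfl fun l _ => ?_
  by_cases hl : l < j
  · rw [if_pos hl, if_pos hl, h l hl]
  · rw [if_neg hl, if_neg hl]

/-- The load at block `j` depends only on answers to earlier blocks, so it may be expressed through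
the complete matrix of answers, as in `IsAnswer`, although that is only known after the pass. -/
lemma rowLoad_congr {q : ℝ} {k : ℕ} {β : ℝ} {x xh xh' : ℕ → ℕ → ℝ} {i j : ℕ}
    (h : ∀ l, l < j → xh i l = xh' i l) : rowLoad q k β x xh i j = rowLoad q k β x xh' i j :=
  passLoad_congr fun l hl => by rw [h l hl]

lemma exec_passProg {q : ℝ} {p : ℕ} {β μ ω : ℝ} (hp : 1 ≤ p) {x : ℕ → ℕ → ℝ} {s : State}
    (h : Ready m k q p β μ ω s) (hx : Holds m k q x s) :
    ∃ s' xh, Exec O passProg s s' ∧ (∀ n, n ≠ 3 → n ≠ 4 → s'.nat n = s.nat n) ∧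
      (∀ j : Fin k, s'.calls j = s.calls j + 1) ∧
      s'.steps ≤ s.steps + (2 + k * (201 * (m + 1))) ∧
      (∀ b, b = 0 ∨ 10 ≤ b → s'.real b = s.real b) ∧
      Holds m k q (damped β x xh) s' ∧ ∀ j, IsAnswer O q p β μ ω x xh j := by
  let I : ℕ → State → Prop := fun j t => (∀ n, n ≠ 3 → n ≠ 4 → t.nat n = s.nat n) ∧ t.nat 4 = j ∧
    (∀ l : Fin k, t.calls l = s.calls l + if (l : ℕ) < j then 1 else 0) ∧
    t.steps ≤ s.steps + (1 + j * (201 * (m + 1))) ∧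
    (∀ b, b = 0 ∨ 10 ≤ b → t.real b = s.real b) ∧
    (∀ i l, i < m → l < k → t.real 1 i l = if l < j then damped β x (t.real 2) i l else x i l) ∧
    (∀ i, i < m → t.real 8 i 0 = rowLoad q k β x (t.real 2) i j) ∧
    ∀ l : Fin k, (l : ℕ) < j → IsAnswer O q p β μ ω x (t.real 2) l
  obtain ⟨t, e, n, -, c, st, fr, en, lo, an⟩ := exec_while (O := O) (b := .natLt 4 1)
    (P := blockProg) (I := I) (n := k) (s := ({ s with nat := Function.update s.nat 4 0 }.tick 1))
    (by
      rintro i t hi ⟨h1, h2, -⟩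
      simpa [Test.holds, h2, h1 1, h.cols] using hi)
    (by
      rintro t ⟨h1, h2, -⟩
      simp [Test.holds, h2, h1 1, h.cols])
    (by
      rintro j t hj ⟨n, n4, c, st, fr, en, lo, an⟩
      have H : Ready m k q p β μ ω (t.tick 1) := h.of_frame n fr
      obtain ⟨t', e', n', n4', c', st', fr', f1, f2, an', en', lo'⟩ := exec_blockProg (O := O) hp H
        ⟨j, hj⟩ n4 (fun i hi => by
          have : (t.tick 1).real 8 i 0 = _ := lo i hi
          rw [this]
          exact passLoad_nonneg _ _ _ _ _ _)
      simp only [State.tick] at n' c' st' fr' f1 f2 an' en' lo'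
      -- Later queries do not overwrite earlier answers; with `rowLoad_congr` this preserves the
      -- statements about earlier blocks.
      have hold : ∀ i l, l < j → t'.real 2 i l = t.real 2 i l := fun i l hl => f2 i l hl.ne
      have hx0 : ∀ i, i < m → t.real 1 i j = x i j := fun i hi => by
        rw [en i j hi hj, if_neg (lt_irrefl j)]
      have hrow : ∀ i, rowLoad q k β x (t'.real 2) i j = rowLoad q k β x (t.real 2) i j :=
        fun i => rowLoad_congr fun l hl => hold i l hl
      refine ⟨t', e', ?_, n4', ?_, ?_, ?_, ?_, ?_, ?_⟩
      · intro a h3 h4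
        rw [n' a h3 h4, n a h3 h4]
      · intro l
        rw [c']
        by_cases hl : (l : ℕ) = j
        · rw [hl, Function.update_self, ← hl, c l]
          simp [hl]
        · rw [Function.update_of_ne hl, c l]
          have : (l : ℕ) < j ↔ (l : ℕ) < j + 1 := by omega
          simp [this]
      · refine st'.trans ?_
        rw [add_one_mul j]
        omega
      · intro b hb
        rw [fr' b hb, fr b hb]
      · intro i l hi hl
        by_cases hlj : l = j
        · subst hlj
          rw [if_pos (Nat.lt_succ_self l), en' i hi, hx0 i hi]
          rfl
        · rw [f1 i l hlj, en i l hi hl]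
          by_cases hl' : l < j
          · rw [if_pos hl', if_pos (by omega)]
            simp only [damped]
            rw [hold i l hl']
          · rw [if_neg hl', if_neg (by omega)]
      · intro i hi
        rw [lo' i hi, lo i hi, hx0 i hi, ← hrow]
        exact (passLoad_succ q β (x i) (fun l => t'.real 2 i l - x i l) hj).symm
      · intro l hl
        unfold IsAnswer
        by_cases hlj : (l : ℕ) = j
        · obtain rfl : l = ⟨j, hj⟩ := Fin.ext hlj
          rw [an']
          congr 1
          funext i v
          rw [lo i i.2, hx0 i i.2, hrow]
        · have hl' : (l : ℕ) < j := by omega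
          have h1 := an l hl'
          unfold IsAnswer at h1
          have e1 : (fun i : Fin m => t'.real 2 i l) = fun i : Fin m => t.real 2 i l := by
            funext i; exact hold i l hl'
          rw [e1, h1]
          congr 1
          funext i v
          rw [rowLoad_congr (xh := t'.real 2) (xh' := t.real 2)
            fun a ha => hold i a (lt_trans ha hl')])
    (by
      refine ⟨?_, ?_, ?_, ?_, ?_, ?_, ?_, ?_⟩
      · intro n h3 h4; simp [State.tick, h4]
      · simp [State.tick]
      · intro l; simp [State.tick]
      · simp [State.tick]
      · intro b _; rfl
      · intro i l hi hl
        simpa [State.tick] using hx.entry i l hi hl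
      · intro i hi
        rw [rowLoad, passLoad_zero]
        exact hx.load i hi
      · intro l hl; omega)
  refine ⟨t.tick 1, t.real 2, .seq (.setNat _ _ _) e, n, ?_, ?_, fr, ⟨?_, ?_⟩, fun j => an j j.2⟩
  · intro j
    have := c j
    rw [if_pos j.2] at this
    exact this
  · simp only [State.tick]; omega
  · intro i j hi hj
    have := en i j hi hj
    rw [if_pos hj] at this
    exact this
  · intro i hi
    have := lo i hi
    rw [rowLoad, passLoad_last] at this
    exact this

end Machine

/-! ### The program -/

section Machine

variable {m k : ℕ} {O : Fin k → Oracle m}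

/-- The step size. -/
def stepSize (q : ℝ) (p : ℕ) : ℝ := ((q - 1) / (16 * p)) ^ (16 / (q - 1))

lemma stepSize_pos {q : ℝ} {p : ℕ} (hq : 1 < q) (hp : 1 ≤ p) : 0 < stepSize q p := by
  have h1 : (0 : ℝ) < p := by exact_mod_cast hp
  have h2 : 0 < q - 1 := by linarith
  unfold stepSize; positivity

lemma stepSize_le_one {q : ℝ} {p : ℕ} (hq : 1 < q) (hq2 : q ≤ 2) (hp : 1 ≤ p) :
    stepSize q p ≤ 1 := by
  have h1 : (1 : ℝ) ≤ p := by exact_mod_cast hp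
  have h2 : 0 < q - 1 := by linarith
  refine Real.rpow_le_one (by positivity) ?_ (by positivity)
  rw [div_le_one (by positivity)]
  linarith

/-- The number of passes determined from the value `F` of the row cost. -/
def rounds (q : ℝ) (p k : ℕ) (lam δ F : ℝ) : ℝ :=
  1 / stepSize q p * Real.log (((k : ℝ) ^ (p - 1) * lam * F / (k * δ) + 2) / stepSize q p)

lemma rounds_nonneg {q : ℝ} {p : ℕ} (hq : 1 < q) (hq2 : q ≤ 2) (hp : 1 ≤ p) {lam δ F : ℝ} {k : ℕ}
    (hlam : 0 < lam) (hδ : 0 < δ) (hF : 0 ≤ F) : 0 ≤ rounds q p k lam δ F := by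
  have h1 := stepSize_pos hq hp
  have h2 := stepSize_le_one hq hq2 hp
  have h3 : 0 ≤ (k : ℝ) ^ (p - 1) * lam * F / (k * δ) := by positivity
  refine mul_nonneg (by positivity) (Real.log_nonneg ?_)
  rw [le_div_iff₀ h1]
  linarith

/-- The cost of the rows. -/
def rowCost (m k : ℕ) (q : ℝ) (p : ℕ) (x : ℕ → ℕ → ℝ) : ℝ :=
  ∑ i ∈ Finset.range m, (∑ l ∈ Finset.range k, |x i l| ^ q) ^ p

lemma rowCost_nonneg (m k : ℕ) (q : ℝ) (p : ℕ) (x : ℕ → ℕ → ℝ) : 0 ≤ rowCost m k q p x :=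
  Finset.sum_nonneg fun i _ => pow_nonneg (Finset.sum_nonneg fun l _ => by positivity) _

/-- `y` arises from `x` by `n` passes. -/
inductive Passes (O : Fin k → Oracle m) (q : ℝ) (p : ℕ) (β μ ω : ℝ) :
    ℕ → (ℕ → ℕ → ℝ) → (ℕ → ℕ → ℝ) → Prop
  | refl (x : ℕ → ℕ → ℝ) : Passes O q p β μ ω 0 x x
  | step {n : ℕ} {x y yh : ℕ → ℕ → ℝ} (h : Passes O q p β μ ω n x y)
      (hy : ∀ j, IsAnswer O q p β μ ω y yh j) : Passes O q p β μ ω (n + 1) x (damped β y yh)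

def weightInitE : RExpr := .bin .mul (.var 0) (.bin .pow (.var 1) (.bin .sub (.var 2) (.lit 1)))

def stepE : RExpr := .bin .pow (.bin .div (.bin .sub (.var 0) (.lit 1)) (.bin .mul (.lit 16) (.var 1)))
  (.bin .div (.lit 16) (.bin .sub (.var 0) (.lit 1)))

def tailE : RExpr := .bin .mul (.var 0) (.bin .div (.bin .sub (.var 1) (.lit 1))
  (.bin .pow (.lit 64) (.var 2)))

/-- The variables are `β, k, p, lam, F, δ`. -/
def roundsE : RExpr := .bin .mul (.bin .div (.lit 1) (.var 0)) (.un .log (.bin .div (.bin .add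
  (.bin .div (.bin .mul (.bin .mul (.bin .pow (.var 1) (.bin .sub (.var 2) (.lit 1))) (.var 3))
    (.var 4)) (.bin .mul (.var 1) (.var 5))) (.lit 2)) (.var 0)))

def setupProg : Cmd :=
  .seq (.setNat 5 1) (.seq (.setNat 6 2) (.seq (.cast ⟨10, 7, 7⟩ 2) (.seq (.cast ⟨11, 7, 7⟩ 1)
  (.seq (.setReal ⟨13, 7, 7⟩ [⟨10, 7, 7⟩, ⟨0, 7, 7⟩] (.bin .mul (.var 0) (.var 1)))
  (.seq (.setReal ⟨12, 7, 7⟩ [] (.lit 1))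
    (.setReal ⟨15, 7, 7⟩ [⟨0, 7, 5⟩, ⟨11, 7, 7⟩, ⟨10, 7, 7⟩] weightInitE))))))

def tuneProg : Cmd :=
  .seq (.setReal ⟨12, 7, 7⟩ [⟨0, 7, 7⟩, ⟨10, 7, 7⟩] stepE)
  (.seq (.setReal ⟨14, 7, 7⟩ [⟨0, 7, 5⟩] (.var 0))
    (.setReal ⟨15, 7, 7⟩ [⟨0, 7, 5⟩, ⟨0, 7, 7⟩, ⟨10, 7, 7⟩] tailE))

def rowCostProg : Cmd :=
  .seq (.setNat 3 0) (.while (.natLt 3 0)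
    (.seq (.setReal ⟨18, 7, 7⟩ [⟨18, 7, 7⟩, ⟨8, 3, 7⟩, ⟨10, 7, 7⟩]
      (.bin .add (.var 0) (.bin .pow (.var 1) (.var 2)))) (.addNat 3 3 5)))

def roundsProg : Cmd :=
  .setReal ⟨16, 7, 7⟩ [⟨12, 7, 7⟩, ⟨11, 7, 7⟩, ⟨10, 7, 7⟩, ⟨0, 7, 5⟩, ⟨18, 7, 7⟩, ⟨0, 7, 6⟩] roundsE

def loopProg : Cmd :=
  .while (.realLe ⟨17, 7, 7⟩ ⟨16, 7, 7⟩)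
    (.seq passProg (.setReal ⟨17, 7, 7⟩ [⟨17, 7, 7⟩] (.bin .add (.var 0) (.lit 1))))

def mainProg : Cmd :=
  .seq setupProg (.seq passProg (.seq tuneProg (.seq passProg (.seq rowCostProg
    (.seq roundsProg loopProg)))))

/-- The registers and scalars used outside the passes. -/
structure Inputs (k : ℕ) (lam δ : ℝ) (s : State) : Prop where
  two : s.nat 6 = 2
  lam_eq : s.real 0 0 1 = lam
  δ_eq : s.real 0 0 2 = δ
  k_eq : s.real 11 0 0 = k

lemma Inputs.of_frame {lam δ : ℝ} {s s' : State} (h : Inputs k lam δ s)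
    (hn : ∀ n, n ≠ 3 → n ≠ 4 → s'.nat n = s.nat n)
    (hr : ∀ b, b = 0 ∨ b = 11 → s'.real b = s.real b) : Inputs k lam δ s' := by
  constructor
  · rw [hn 6 (by decide) (by decide), h.two]
  · rw [hr 0 (Or.inl rfl), h.lam_eq]
  · rw [hr 0 (Or.inl rfl), h.δ_eq]
  · rw [hr 11 (Or.inr rfl), h.k_eq]

lemma Holds.of_frame {q : ℝ} {x : ℕ → ℕ → ℝ} {s s' : State} (h : Holds m k q x s)
    (h1 : s'.real 1 = s.real 1) (h8 : s'.real 8 = s.real 8) : Holds m k q x s' :=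
  ⟨fun i j hi hj => by rw [h1, h.entry i j hi hj], fun i hi => by rw [h8, h.load i hi]⟩

lemma exec_assign {b : ℕ} {args : List Ref} {e : RExpr} {s : State} (h7 : s.nat 7 = 0) :
    ∃ s', Exec O (.setReal ⟨b, 7, 7⟩ args e) s s' ∧ s'.nat = s.nat ∧ s'.calls = s.calls ∧
      s'.steps = s.steps + (1 + args.length + e.size) ∧ (∀ b', b' ≠ b → s'.real b' = s.real b') ∧
      s'.real b 0 0 = e.eval (listEnv (args.map s.read)) := by
  refine ⟨_, .setReal _ _ _ _, rfl, rfl, rfl, ?_, ?_⟩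
  · intro b' hb
    funext i l
    simp [State.tick, State.write, hb]
  · simp [State.tick, State.write, h7]

lemma natCast_rpow_pred (a : ℕ) {p : ℕ} (hp : 1 ≤ p) :
    |(a : ℝ)| ^ ((p : ℝ) - 1) = (a : ℝ) ^ (p - 1) := by
  rw [Nat.abs_cast, ← Real.rpow_natCast, Nat.cast_sub hp, Nat.cast_one]

lemma exec_setupProg {p : ℕ} (hp : 1 ≤ p) {q lam δ : ℝ} (hq : 0 < q) :
    ∃ s, Exec O setupProg (initState m k p q lam δ) s ∧
      Ready m k q p 1 0 (lam * (k : ℝ) ^ (p - 1)) s ∧ Inputs k lam δ s ∧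
      Holds m k q (fun _ _ => 0) s ∧ s.real 17 0 0 = 0 ∧ s.real 18 0 0 = 0 ∧
      (∀ j, s.calls j = 0) ∧ s.steps ≤ 100 := by
  refine ⟨_, .seq (.setNat _ _ _) (.seq (.setNat _ _ _) (.seq (.cast _ _ _) (.seq (.cast _ _ _)
    (.seq (.setReal _ _ _ _) (.seq (.setReal _ _ _ _) (.setReal _ _ _ _)))))), ⟨?_, ?_, ?_, ?_, ?_,
      ?_, ?_, ?_, ?_, ?_⟩, ⟨?_, ?_, ?_, ?_⟩, ⟨?_, ?_⟩, ?_, ?_, ?_, ?_⟩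
  all_goals simp [State.tick, State.write, State.read, initState, Function.update, listEnv,
    RExpr.eval, RExpr.size, BinOp.eval, weightInitE, hq.ne', ← natCast_rpow_pred k hp]

lemma exec_tuneProg {p : ℕ} (hp : 1 ≤ p) {q lam δ β μ ω : ℝ} (hq : 1 < q) {s : State}
    (h : Ready m k q p β μ ω s) (hi : Inputs k lam δ s) :
    ∃ s', Exec O tuneProg s s' ∧ Ready m k q p (stepSize q p) lam (lam * tailWeight q p) s' ∧
      s'.nat = s.nat ∧ s'.calls = s.calls ∧ s'.steps ≤ s.steps + 100 ∧
      ∀ b, b ≠ 12 → b ≠ 14 → b ≠ 15 → s'.real b = s.real b := by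
  have hp0 : (0 : ℝ) < p := by exact_mod_cast hp
  obtain ⟨s1, e1, n1, c1, t1, f1, v1⟩ := exec_assign (O := O) (b := 12)
    (args := [⟨0, 7, 7⟩, ⟨10, 7, 7⟩]) (e := stepE) h.zero
  have z1 : s1.nat 7 = 0 := by rw [n1, h.zero]
  obtain ⟨s2, e2, n2, c2, t2, f2, v2⟩ := exec_assign (O := O) (b := 14)
    (args := [⟨0, 7, 5⟩]) (e := .var 0) z1
  have z2 : s2.nat 7 = 0 := by rw [n2, z1]
  obtain ⟨s3, e3, n3, c3, t3, f3, v3⟩ := exec_assign (O := O) (b := 15)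
    (args := [⟨0, 7, 5⟩, ⟨0, 7, 7⟩, ⟨10, 7, 7⟩]) (e := tailE) z2
  have fr : ∀ b, b ≠ 12 → b ≠ 14 → b ≠ 15 → s3.real b = s.real b := fun b h1 h2 h3 => by
    rw [f3 b h3, f2 b h2, f1 b h1]
  have nn : s3.nat = s.nat := by rw [n3, n2, n1]
  refine ⟨s3, .seq e1 (.seq e2 e3), ?_, nn, by rw [c3, c2, c1], ?_, fr⟩
  · constructor
    · rw [nn, h.rows]
    · rw [nn, h.cols]
    · rw [nn, h.one]
    · rw [nn, h.zero]
    · rw [fr 0 (by decide) (by decide) (by decide), h.q_eq]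
    · rw [fr 10 (by decide) (by decide) (by decide), h.p_eq]
    · rw [f3 12 (by decide), f2 12 (by decide), v1]
      have h0 : 0 ≤ (q - 1) / (16 * p) := div_nonneg (by linarith) (by positivity)
      simp [stepE, RExpr.eval, BinOp.eval, listEnv, State.read, h.zero, h.q_eq, h.p_eq, stepSize,
        abs_of_nonneg h0]
    · rw [fr 13 (by decide) (by decide) (by decide), h.exponent_eq]
    · rw [f3 14 (by decide), v2]
      simp [RExpr.eval, listEnv, State.read, n1, h.zero, h.one, f1, hi.lam_eq]
    · rw [v3]
      simp [tailE, RExpr.eval, BinOp.eval, listEnv, State.read, n2, n1, h.zero, h.one, f2, f1,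
        hi.lam_eq, h.q_eq, h.p_eq, tailWeight]
  · rw [t3, t2, t1]
    simp [stepE, tailE, RExpr.size]

lemma exec_rowCostProg {p : ℕ} {q β μ ω : ℝ} {x : ℕ → ℕ → ℝ} {s : State}
    (h : Ready m k q p β μ ω s) (hx : Holds m k q x s) (h0 : s.real 18 0 0 = 0) :
    ∃ s', Exec O rowCostProg s s' ∧ (∀ n, n ≠ 3 → s'.nat n = s.nat n) ∧ s'.calls = s.calls ∧
      s'.steps = s.steps + (2 + m * 11) ∧ (∀ b, b ≠ 18 → s'.real b = s.real b) ∧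
      s'.real 18 0 0 = rowCost m k q p x := by
  let I : ℕ → State → Prop := fun i t => t.nat = Function.update s.nat 3 i ∧ t.calls = s.calls ∧
    t.steps = s.steps + (1 + i * 11) ∧ (∀ b, b ≠ 18 → t.real b = s.real b) ∧
    t.real 18 0 0 = rowCost i k q p x
  obtain ⟨t, e, n, c, st, fr, v⟩ := exec_while (O := O) (b := .natLt 3 0)
    (P := .seq (.setReal ⟨18, 7, 7⟩ [⟨18, 7, 7⟩, ⟨8, 3, 7⟩, ⟨10, 7, 7⟩]
      (.bin .add (.var 0) (.bin .pow (.var 1) (.var 2)))) (.addNat 3 3 5)) (I := I) (n := m)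
    (s := ({ s with nat := Function.update s.nat 3 0 }.tick 1))
    (by
      rintro i t hi ⟨h1, -⟩
      simp [Test.holds, h1, h.rows, hi])
    (by
      rintro t ⟨h1, -⟩
      simp [Test.holds, h1, h.rows])
    (by
      rintro i t hi ⟨n, c, st, fr, v⟩
      obtain ⟨s1, e1, n1, c1, t1, f1, v1⟩ := exec_assign (O := O) (b := 18) (s := t.tick 1)
        (args := [⟨18, 7, 7⟩, ⟨8, 3, 7⟩, ⟨10, 7, 7⟩])
        (e := .bin .add (.var 0) (.bin .pow (.var 1) (.var 2))) (by simp [State.tick, n, h.zero])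
      refine ⟨_, .seq e1 (.addNat _ _ _ _), ?_, ?_, ?_, ?_, ?_⟩
      · simp [State.tick, n1, n, h.one]
      · simp only [State.tick, c1, c]
      · simp [State.tick, t1, st, RExpr.size]; ring
      · intro b hb
        simp only [State.tick]
        rw [f1 b hb]
        exact fr b hb
      · simp only [State.tick]
        rw [v1]
        have hl := hx.load i hi
        have hnn : 0 ≤ ∑ l ∈ Finset.range k, |x i l| ^ q :=
          Finset.sum_nonneg fun l _ => by positivity
        simp [RExpr.eval, BinOp.eval, listEnv, State.read, State.tick, n, h.zero, v, fr, h.p_eq, hl,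
          abs_of_nonneg hnn, rowCost, Finset.sum_range_succ])
    (by
      refine ⟨rfl, rfl, by simp [State.tick], fun b _ => rfl, ?_⟩
      simpa [State.tick, rowCost] using h0)
  refine ⟨_, .seq (.setNat _ _ _) e, ?_, c, ?_, fr, v⟩
  · intro a ha
    simp [State.tick, n, ha]
  · simp only [State.tick, st]; ring

lemma exec_loopProg {p : ℕ} (hp : 1 ≤ p) {q β μ ω : ℝ} {x : ℕ → ℕ → ℝ} {s : State}
    (h : Ready m k q p β μ ω s) (hx : Holds m k q x s) (h0 : s.real 17 0 0 = 0) {r : ℝ}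
    (h16 : s.real 16 0 0 = r) (hr : 0 ≤ r) :
    ∃ s' y, Exec O loopProg s s' ∧ Passes O q p β μ ω (⌊r⌋₊ + 1) x y ∧ Holds m k q y s' ∧
      (∀ j : Fin k, s'.calls j = s.calls j + (⌊r⌋₊ + 1)) ∧
      s'.steps ≤ s.steps + (1 + (⌊r⌋₊ + 1) * (8 + k * (201 * (m + 1)))) := by
  let I : ℕ → State → Prop := fun n t => Ready m k q p β μ ω t ∧ t.real 17 0 0 = n ∧
    t.real 16 0 0 = r ∧ (∀ j : Fin k, t.calls j = s.calls j + n) ∧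
    t.steps ≤ s.steps + n * (8 + k * (201 * (m + 1))) ∧
    ∃ y, Passes O q p β μ ω n x y ∧ Holds m k q y t
  obtain ⟨t, e, -, -, -, c, st, y, hy, hyt⟩ := exec_while (O := O)
    (b := .realLe ⟨17, 7, 7⟩ ⟨16, 7, 7⟩) (P := .seq passProg
      (.setReal ⟨17, 7, 7⟩ [⟨17, 7, 7⟩] (.bin .add (.var 0) (.lit 1)))) (I := I) (n := ⌊r⌋₊ + 1)
    (s := s)
    (by
      rintro i t hi ⟨h1, h2, h3, -⟩
      simp only [Test.holds, State.read, h1.zero, h2, h3]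
      -- The counter starts at `0` and the test is `≤`, so there are exactly `⌊r⌋₊ + 1` rounds,
      -- strictly more than `r`.
      exact (Nat.le_floor_iff hr).1 (by omega))
    (by
      rintro t ⟨h1, h2, h3, -⟩
      simp only [Test.holds, State.read, h1.zero, h2, h3, not_le]
      push_cast
      exact Nat.lt_floor_add_one r)
    (by
      rintro i t hi ⟨h1, h2, h3, c, st, y, hy, hyt⟩
      have H : Ready m k q p β μ ω (t.tick 1) := h1.of_frame (fun _ _ _ => rfl) fun _ _ => rfl
      obtain ⟨s1, yh, e1, n1, c1, t1, f1, x1, a1⟩ := exec_passProg (O := O) (s := t.tick 1) hp H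
        (hyt.of_frame rfl rfl)
      have H1 : Ready m k q p β μ ω s1 := H.of_frame n1 f1
      obtain ⟨s2, e2, n2, c2, t2, f2, v2⟩ := exec_assign (O := O) (b := 17) (args := [⟨17, 7, 7⟩])
        (e := .bin .add (.var 0) (.lit 1)) H1.zero
      refine ⟨s2, .seq e1 e2, ?_, ?_, ?_, ?_, ?_, _, .step hy a1, ?_⟩
      · constructor
        · rw [n2, H1.rows]
        · rw [n2, H1.cols]
        · rw [n2, H1.one]
        · rw [n2, H1.zero]
        · rw [f2 0 (by decide), H1.q_eq]
        · rw [f2 10 (by decide), H1.p_eq]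
        · rw [f2 12 (by decide), H1.step_eq]
        · rw [f2 13 (by decide), H1.exponent_eq]
        · rw [f2 14 (by decide), H1.main_eq]
        · rw [f2 15 (by decide), H1.tail_eq]
      · rw [v2]
        have : s1.real 17 0 0 = i := by rw [f1 17 (by norm_num)]; exact h2
        simp [RExpr.eval, BinOp.eval, listEnv, State.read, H1.zero, this]
      · rw [f2 16 (by decide), f1 16 (by norm_num)]
        exact h3
      · intro j
        rw [c2, c1 j]
        simp only [State.tick, c j]
        ring
      · rw [t2]
        simp only [State.tick] at t1
        simp only [List.length, RExpr.size]
        rw [add_one_mul i]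
        omega
      · exact x1.of_frame (f2 1 (by decide)) (f2 8 (by decide)))
    ⟨h, by simpa using h0, h16, fun _ => rfl, by simp, x, .refl x, hx⟩
  exact ⟨_, y, e, hy, hyt.of_frame rfl rfl, c, by simp only [State.tick]; omega⟩

theorem exec_mainProg (hm : 1 ≤ m) (hk : 1 ≤ k) {p : ℕ} (hp : 1 ≤ p) {q lam δ : ℝ} (hq : 1 < q)
    (hq2 : q ≤ 2) (hlam : 0 < lam) (hδ : 0 < δ) :
    ∃ s xh₀ xh₁ y N, Exec O mainProg (initState m k p q lam δ) s ∧
      (∀ j, IsAnswer O q p 1 0 (lam * (k : ℝ) ^ (p - 1)) (fun _ _ => 0) xh₀ j) ∧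
      (∀ j, IsAnswer O q p (stepSize q p) lam (lam * tailWeight q p)
        (damped 1 (fun _ _ => 0) xh₀) xh₁ j) ∧
      N = ⌊rounds q p k lam δ (rowCost m k q p
        (damped (stepSize q p) (damped 1 (fun _ _ => 0) xh₀) xh₁))⌋₊ + 1 ∧
      Passes O q p (stepSize q p) lam (lam * tailWeight q p) N
        (damped (stepSize q p) (damped 1 (fun _ _ => 0) xh₀) xh₁) y ∧
      s.output m k = matOf m k y ∧ (∀ j : Fin k, s.calls j = N + 2) ∧
      s.steps ≤ 1000 * (k * m) * (N + 2) := by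
  obtain ⟨s1, e1, r1, i1, x1, z1, w1, c1, t1⟩ := exec_setupProg (m := m) (k := k) (O := O)
    (lam := lam) (δ := δ) hp (by linarith : 0 < q)
  obtain ⟨s2, xh₀, e2, n2, c2, t2, f2, x2, a2⟩ := exec_passProg (O := O) hp r1 x1
  have r2 := r1.of_frame n2 f2
  have i2 := i1.of_frame n2 fun b hb => f2 b (by omega)
  obtain ⟨s3, e3, r3, n3, c3, t3, f3⟩ := exec_tuneProg (O := O) hp hq r2 i2
  have i3 := i2.of_frame (fun n _ _ => by rw [n3]) fun b hb => f3 b (by omega) (by omega) (by omega)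
  have x3 := x2.of_frame (f3 1 (by decide) (by decide) (by decide))
    (f3 8 (by decide) (by decide) (by decide))
  obtain ⟨s4, xh₁, e4, n4, c4, t4, f4, x4, a4⟩ := exec_passProg (O := O) hp r3 x3
  have r4 := r3.of_frame n4 f4
  have i4 := i3.of_frame n4 fun b hb => f4 b (by omega)
  have w4 : s4.real 18 0 0 = 0 := by
    rw [f4 18 (by norm_num), f3 18 (by decide) (by decide) (by decide), f2 18 (by norm_num), w1]
  have z4 : s4.real 17 0 0 = 0 := by
    rw [f4 17 (by norm_num), f3 17 (by decide) (by decide) (by decide), f2 17 (by norm_num), z1]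
  obtain ⟨s5, e5, n5, c5, t5, f5, v5⟩ := exec_rowCostProg (O := O) r4 x4 w4
  have i5 := i4.of_frame (fun n h _ => n5 n h) fun b hb => f5 b (by omega)
  have x5 := x4.of_frame (f5 1 (by decide)) (f5 8 (by decide))
  have r5 : Ready m k q p (stepSize q p) lam (lam * tailWeight q p) s5 := by
    constructor
    · rw [n5 0 (by decide), r4.rows]
    · rw [n5 1 (by decide), r4.cols]
    · rw [n5 5 (by decide), r4.one]
    · rw [n5 7 (by decide), r4.zero]
    · rw [f5 0 (by decide), r4.q_eq]
    · rw [f5 10 (by decide), r4.p_eq]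
    · rw [f5 12 (by decide), r4.step_eq]
    · rw [f5 13 (by decide), r4.exponent_eq]
    · rw [f5 14 (by decide), r4.main_eq]
    · rw [f5 15 (by decide), r4.tail_eq]
  set F := rowCost m k q p (damped (stepSize q p) (damped 1 (fun _ _ => 0) xh₀) xh₁) with hF
  obtain ⟨s6, e6, n6, c6, t6, f6, v6⟩ := exec_assign (O := O) (b := 16)
    (args := [⟨12, 7, 7⟩, ⟨11, 7, 7⟩, ⟨10, 7, 7⟩, ⟨0, 7, 5⟩, ⟨18, 7, 7⟩, ⟨0, 7, 6⟩]) (e := roundsE)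
    r5.zero
  have x6 := x5.of_frame (f6 1 (by decide)) (f6 8 (by decide))
  have r6 : Ready m k q p (stepSize q p) lam (lam * tailWeight q p) s6 := by
    constructor
    · rw [n6, r5.rows]
    · rw [n6, r5.cols]
    · rw [n6, r5.one]
    · rw [n6, r5.zero]
    · rw [f6 0 (by decide), r5.q_eq]
    · rw [f6 10 (by decide), r5.p_eq]
    · rw [f6 12 (by decide), r5.step_eq]
    · rw [f6 13 (by decide), r5.exponent_eq]
    · rw [f6 14 (by decide), r5.main_eq]
    · rw [f6 15 (by decide), r5.tail_eq]
  have v6' : s6.real 16 0 0 = rounds q p k lam δ F := by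
    rw [v6]
    have hpow := natCast_rpow_pred k hp
    rw [Nat.abs_cast] at hpow
    simp [roundsE, RExpr.eval, BinOp.eval, UnOp.eval, listEnv, State.read, r5.zero, r5.one, i5.two,
      r5.step_eq, i5.k_eq, r5.p_eq, i5.lam_eq, v5, i5.δ_eq, rounds, hpow]
  have z6 : s6.real 17 0 0 = 0 := by rw [f6 17 (by decide), f5 17 (by decide), z4]
  obtain ⟨s7, y, e7, p7, x7, c7, t7⟩ := exec_loopProg (O := O) hp r6 x6 z6 v6'
    (rounds_nonneg hq hq2 hp hlam hδ (rowCost_nonneg m k q p _))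
  refine ⟨s7, xh₀, xh₁, y, ⌊rounds q p k lam δ F⌋₊ + 1,
    .seq e1 (.seq e2 (.seq e3 (.seq e4 (.seq e5 (.seq e6 e7))))), a2, a4, rfl, p7, ?_, ?_, ?_⟩
  · funext i j
    exact x7.entry i j i.2 j.2
  · intro j
    rw [c7, c6, c5, c4, c3, c2, c1]
    ring
  · set N := ⌊rounds q p k lam δ F⌋₊ + 1
    have hkm : 1 ≤ k * m := Nat.one_le_iff_ne_zero.2 (by positivity)
    have hkm1 : k * (201 * (m + 1)) ≤ 402 * (k * m) := by nlinarith
    have hmk : m ≤ k * m := Nat.le_mul_of_pos_left m hk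
    have t6' : s6.steps ≤ s5.steps + 100 := by
      rw [t6]; simp [roundsE, RExpr.size]
    have hN : N * (8 + k * (201 * (m + 1))) ≤ N * (410 * (k * m)) :=
      Nat.mul_le_mul_left N (by omega)
    have e : 1000 * (k * m) * (N + 2) = 1000 * (N * (k * m)) + 2000 * (k * m) := by ring
    have e' : N * (410 * (k * m)) = 410 * (N * (k * m)) := by ring
    omega

end Machine

/-! ### The step size is admissible -/

/-- With `t = (q-1)/(16 p)` the exponent `16/(q-1)` gives `β^(q-1) = t^16` exactly, and `β ≤ t^16`
because `q - 1 ≤ 1`. Both conditions become polynomial in `t` and `p`, settled by `t p ≤ 1/16` and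
`t ≤ 1/48`. -/
lemma stepSize_spec {q : ℝ} {p : ℕ} (hq : 1 < q) (hq2 : q ≤ 2) (hp : 3 ≤ p) :
    StepSize q p (stepSize q p) := by
  have hp3 : (3 : ℝ) ≤ p := by exact_mod_cast hp
  have hs : 0 < q - 1 := by linarith
  have hp0 : (0 : ℝ) < p := by linarith
  set t := (q - 1) / (16 * p) with ht
  have ht0 : 0 < t := by positivity
  have htp : t * p ≤ 1 / 16 := by
    rw [ht]; field_simp; linarith
  have ht48 : t ≤ 1 / 48 := by nlinarith
  have ht1 : t ≤ 1 := by linarith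
  have hsq : q - 1 = 16 * p * t := by rw [ht]; field_simp
  have hpow : stepSize q p ≤ t ^ 16 := by
    have h16 : (16 : ℝ) ≤ 16 / (q - 1) := by
      rw [le_div_iff₀ hs]; linarith
    calc stepSize q p = t ^ (16 / (q - 1)) := rfl
      _ ≤ t ^ (16 : ℝ) := Real.rpow_le_rpow_of_exponent_ge ht0 ht1 h16
      _ = t ^ 16 := by exact_mod_cast rfl
  refine ⟨hq, hq2, hp, stepSize_pos hq (by omega), stepSize_le_one hq hq2 (by omega), ?_, ?_⟩
  · have e : stepSize q p ^ (q - 1) = t ^ 16 := by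
      unfold stepSize
      rw [← ht, ← Real.rpow_mul ht0.le, div_mul_cancel₀ _ hs.ne']
      exact_mod_cast rfl
    rw [e, hsq, le_div_iff₀ (by positivity)]
    have h13 : t ^ 13 ≤ 1 := pow_le_one₀ ht0.le ht1
    have h2 : (t * p) ^ 2 ≤ 1 / 256 := by
      calc (t * p) ^ 2 ≤ (1 / 16) ^ 2 := by gcongr
        _ = _ := by norm_num
    calc t ^ 16 * (2048 * p ^ 2) = 2048 * t * (t ^ 13 * (t * p) ^ 2) := by ring
      _ ≤ 2048 * t * (1 * (1 / 256)) := by gcongr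
      _ = 8 * 1 * t := by ring
      _ ≤ 16 * p * t := by gcongr <;> linarith
  · have h12 : t ^ 12 ≤ (1 / 48) ^ 12 := by gcongr
    have e : 32 / (q - 1) = 2 / (p * t) := by rw [hsq]; field_simp; norm_num
    calc stepSize q p * (30000000 * p ^ 3 * (32 / (q - 1)) ^ 4)
        ≤ t ^ 16 * (30000000 * p ^ 3 * (32 / (q - 1)) ^ 4) := by gcongr
      _ = 480000000 * t ^ 12 / p := by rw [e]; field_simp; norm_num
      _ ≤ 480000000 * (1 / 48) ^ 12 / 1 := by gcongr; linarith
      _ ≤ 1 := by norm_num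

/-! ### The queries are decomposable -/

/-- The constant for the parameters of the queries. -/
def queryConst (A : ℕ) : ℕ := 7 * (A * A + A + A) + 2

lemma abs_powDeriv_le {q x M : ℝ} (hq : 1 < q) (hq2 : q ≤ 2) (hM : 1 ≤ M) (hx : |x| ≤ M) :
    |powDeriv q x| ≤ 2 * M := by
  rcases eq_or_ne x 0 with rfl | h0
  · simp [powDeriv]; linarith
  have hx0 : 0 < |x| := abs_pos.2 h0
  have e : |powDeriv q x| = q * |x| ^ (q - 1) := by
    unfold powDeriv
    rw [abs_mul, abs_mul, abs_of_pos (by linarith : 0 < q), abs_of_nonneg (by positivity : 0 ≤ |x| ^ (q - 2)),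
      mul_assoc, ← Real.rpow_one_add' hx0.le (by linarith)]
    ring_nf
  rw [e]
  have : |x| ^ (q - 1) ≤ M := by
    calc |x| ^ (q - 1) ≤ M ^ (q - 1) := by gcongr
      _ ≤ M ^ (1 : ℝ) := Real.rpow_le_rpow_of_exponent_le hM (by linarith)
      _ = M := Real.rpow_one M
  gcongr

lemma passCost_eq (q : ℝ) (p : ℕ) (μ ω u x v : ℝ) :
    passCost q p μ ω u x v = powFun (μ * p * u ^ (p - 1) / 2 * powDeriv q x)
      (μ * p * u ^ (p - 1) / 2) 0 q v + powFun 0 ω x (p * q) v := by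
  unfold passCost powFun
  rw [sub_zero]
  ring

/-- Raising loads to the power `p - 1` multiplies the exponent of a quasi-polynomial bound by at
most `p ≤ L`, where `L = polylog A m`. All parameters are thus at most `exp (7 L^2)`, again
quasi-polynomial, with constant `queryConst A`. -/
lemma isDecomposable_passCost {A m p : ℕ} (hA : 1 ≤ A) (hm : 2 ≤ m) {q μ ω u x : ℝ} (hq : 1 < q)
    (hq2 : q ≤ 2) (hp : 1 ≤ p) (hpA : (p : ℝ) ≤ polylog A m) (hμ : 0 ≤ μ)
    (hμA : μ ≤ Real.exp (polylog A m)) (hω : 0 ≤ ω)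
    (hωA : ω ≤ Real.exp (polylog A m * p)) (hu : 0 ≤ u)
    (huA : u ≤ Real.exp (3 * polylog A m)) (hx : |x| ≤ Real.exp (polylog A m)) :
    IsDecomposable (compConst (queryConst A)) (hessConst (queryConst A)) m
      (fun v => ((passCost q p μ ω u x v : ℝ) : WithTop ℝ)) := by
  set L := polylog A m with hL
  have hL1 : 1 ≤ L := le_trans (by exact_mod_cast hA) (le_polylog A m)
  have hp1 : (1 : ℝ) ≤ p := by exact_mod_cast hp
  have hLL : L ≤ L * L := by nlinarith
  have hq0 : 7 * (L * L) ≤ polylog (queryConst A) m := by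
    have h1 := polylog_mul_le A A m
    have h2 := nat_mul_polylog_le 7 (A * A + A + A) m
    have h3 : polylog (7 * (A * A + A + A)) m ≤ polylog (queryConst A) m :=
      polylog_mono (by unfold queryConst; omega) m
    push_cast at h2
    rw [← hL] at h1
    linarith
  have hE : Real.exp (7 * (L * L)) ≤ Real.exp (polylog (queryConst A) m) := Real.exp_le_exp.2 hq0
  set w := μ * p * u ^ (p - 1) / 2 with hw
  have hw0 : 0 ≤ w := by positivity
  have hpe : (p : ℝ) ≤ Real.exp L := by
    have := Real.add_one_le_exp L
    linarith
  have hup : u ^ (p - 1) ≤ Real.exp (3 * (L * L) - 3 * L) := by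
    calc u ^ (p - 1) ≤ Real.exp (3 * L) ^ (p - 1) := by gcongr
      _ = Real.exp ((p - 1 : ℕ) * (3 * L)) := by rw [Real.exp_nat_mul]
      _ ≤ _ := by
        apply Real.exp_le_exp.2
        rw [Nat.cast_sub hp, Nat.cast_one]
        nlinarith
  have hwE : w ≤ Real.exp (3 * (L * L) - L) := by
    calc w ≤ μ * p * u ^ (p - 1) := by
          rw [hw]
          have : 0 ≤ μ * p * u ^ (p - 1) := by positivity
          linarith
      _ ≤ Real.exp L * Real.exp L * Real.exp (3 * (L * L) - 3 * L) := by gcongr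
      _ = _ := by rw [← Real.exp_add, ← Real.exp_add]; ring_nf
  have hb : |powDeriv q x| ≤ Real.exp (2 * L) := by
    refine (abs_powDeriv_le hq hq2 (Real.one_le_exp (by linarith)) hx).trans ?_
    have h2 : 2 ≤ Real.exp L := by
      have := Real.add_one_le_exp L
      linarith
    calc 2 * Real.exp L ≤ Real.exp L * Real.exp L := by gcongr
      _ = _ := by rw [← Real.exp_add]; ring_nf
  simp only [passCost_eq]
  refine isDecomposable_powFun (by unfold queryConst; omega) hm ?_ hw0 ?_ hω ?_ ?_ hq ?_ ?_ ?_
  · rw [abs_mul, abs_of_nonneg hw0]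
    refine le_trans ?_ hE
    calc w * |powDeriv q x| ≤ Real.exp (3 * (L * L) - L) * Real.exp (2 * L) := by gcongr
      _ = Real.exp (3 * (L * L) + L) := by rw [← Real.exp_add]; ring_nf
      _ ≤ _ := Real.exp_le_exp.2 (by linarith)
  · exact hwE.trans (le_trans (Real.exp_le_exp.2 (by linarith)) hE)
  · refine hωA.trans (le_trans (Real.exp_le_exp.2 ?_) hE)
    nlinarith
  · exact hx.trans (le_trans (Real.exp_le_exp.2 (by linarith)) hE)
  · linarith
  · nlinarith
  · nlinarith

lemma rowLoad_le {q β M : ℝ} {k : ℕ} {x xh : ℕ → ℕ → ℝ} {i j : ℕ} (hq : 1 < q) (hq2 : q ≤ 2)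
    (hβ : 0 ≤ β) (hβ1 : β ≤ 1) (hM : 1 ≤ M) (hx : ∀ l, l < k → |x i l| ≤ M)
    (hxh : ∀ l, l < k → l < j → |xh i l| ≤ M) : rowLoad q k β x xh i j ≤ k * M ^ 2 := by
  unfold rowLoad passLoad
  have h : ∀ l ∈ Finset.range k,
      |if l < j then x i l + β * (xh i l - x i l) else x i l| ^ q ≤ M ^ 2 := by
    intro l hl
    rw [Finset.mem_range] at hl
    have h1 : |if l < j then x i l + β * (xh i l - x i l) else x i l| ≤ M := by
      split_ifs with hlj
      · have a1 := abs_le.1 (hx l hl)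
        have a2 := abs_le.1 (hxh l hl hlj)
        rw [abs_le]
        constructor <;> nlinarith
      · exact hx l hl
    calc _ ≤ M ^ q := by gcongr
      _ ≤ M ^ (2 : ℝ) := Real.rpow_le_rpow_of_exponent_le hM hq2
      _ = M ^ 2 := by exact_mod_cast rfl
  calc _ ≤ ∑ _l ∈ Finset.range k, M ^ 2 := Finset.sum_le_sum h
    _ = _ := by simp

/-- The standing assumptions on an instance. -/
structure Instance {m k : ℕ} (A p : ℕ) (q lam δ : ℝ) (X : Fin k → Set (Fin m → ℝ))
    (ψ : Fin k → (Fin m → ℝ) → ℝ) (O : Fin k → Oracle m) : Prop where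
  one_le_A : 1 ≤ A
  two_le_m : 2 ≤ m
  one_le_k : 1 ≤ k
  k_le : (k : ℝ) ≤ Real.exp (polylog A m)
  one_lt_q : 1 < q
  q_le_two : q ≤ 2
  three_le_p : 3 ≤ p
  p_le : (p : ℝ) ≤ polylog A m
  lam_pos : 0 < lam
  lam_le : lam ≤ Real.exp (polylog A m)
  convex : ∀ j, Convex ℝ (X j)
  bound : ∀ j, ∀ x ∈ X j, ∀ i, |x i| ≤ Real.exp (polylog A m)
  convexOn : ∀ j, ConvexOn ℝ (X j) (ψ j)
  δ_pos : 0 < δ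
  oracle : ∀ j, IsSCO (compConst (queryConst A)) (hessConst (queryConst A)) δ (X j) (ψ j) (O j)

/-! ### Feasibility and optimality of the answers along the passes. -/

section Answers

variable {m k A p : ℕ} {q lam δ : ℝ} {X : Fin k → Set (Fin m → ℝ)} {ψ : Fin k → (Fin m → ℝ) → ℝ}
  {O : Fin k → Oracle m}

/-- Along a pass that starts in the box, all answers are feasible and `δ`-optimal. -/
lemma Instance.answer (hI : Instance A p q lam δ X ψ O) {β μ ω : ℝ} (hβ : 0 ≤ β) (hβ1 : β ≤ 1)
    (hμ : 0 ≤ μ) (hμA : μ ≤ Real.exp (polylog A m)) (hω : 0 ≤ ω)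
    (hωA : ω ≤ Real.exp (polylog A m * p)) {x xh : ℕ → ℕ → ℝ}
    (hx : ∀ i j, i < m → j < k → |x i j| ≤ Real.exp (polylog A m))
    (h : ∀ j, IsAnswer O q p β μ ω x xh j) (j : Fin k) :
    (fun i : Fin m => xh i j) ∈ X j ∧ ∀ y ∈ X j,
      ψ j (fun i => xh i j) +
        ∑ i : Fin m, passCost q p μ ω (rowLoad q k β x xh i j) (x i j) (xh i j) ≤
      ψ j y + ∑ i : Fin m, passCost q p μ ω (rowLoad q k β x xh i j) (x i j) (y i) + δ := by
  obtain ⟨j, hj⟩ := j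
  induction j using Nat.strong_induction_on with
  | _ j ih =>
    set L := polylog A m with hL
    have hL1 : 1 ≤ L := le_trans (by exact_mod_cast hI.one_le_A) (le_polylog A m)
    -- Legality of the query and feasibility of the answer support each other: earlier answers lie
    -- in the box by induction, so the current load is bounded and the query is decomposable, and
    -- only then does the oracle guarantee anything for block `j`.
    have hload : ∀ i : Fin m, rowLoad q k β x xh i j ≤ Real.exp (3 * L) := by
      intro i
      refine (rowLoad_le hI.one_lt_q hI.q_le_two hβ hβ1 (Real.one_le_exp (by linarith : 0 ≤ L))
        (fun l hl => hx i l i.2 hl)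
        (fun l hl hlj => hI.bound ⟨l, hl⟩ _ (ih l hlj hl).1 i)).trans ?_
      calc (k : ℝ) * Real.exp L ^ 2 ≤ Real.exp L * Real.exp L ^ 2 := by
            gcongr; exact hI.k_le
        _ = Real.exp (3 * L) := by
            rw [← Real.exp_nat_mul, ← Real.exp_add]; push_cast; ring_nf
    have hans := h ⟨j, hj⟩
    unfold IsAnswer at hans
    obtain ⟨h1, h2⟩ := hI.oracle ⟨j, hj⟩ _ fun i : Fin m =>
      isDecomposable_passCost (u := rowLoad q k β x xh i j) (x := x i j) hI.one_le_A hI.two_le_m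
        hI.one_lt_q hI.q_le_two (by have := hI.three_le_p; omega) hI.p_le hμ hμA hω hωA
        (passLoad_nonneg _ _ _ _ _ _) (hload i) (hx i j i.2 hj)
    rw [← hans] at h1 h2
    refine ⟨h1, fun y hy => ?_⟩
    have h3 := h2 y hy
    exact_mod_cast h3

lemma Instance.entry_le (hI : Instance A p q lam δ X ψ O) {x : ℕ → ℕ → ℝ}
    (hx : matOf m k x ∈ feasible X) {i j : ℕ} (hi : i < m) (hj : j < k) :
    |x i j| ≤ Real.exp (polylog A m) :=
  hI.bound ⟨j, hj⟩ _ (hx ⟨j, hj⟩) ⟨i, hi⟩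

lemma Instance.isPass (hI : Instance A p q lam δ X ψ O) {x xh : ℕ → ℕ → ℝ}
    (hx : matOf m k x ∈ feasible X)
    (h : ∀ j, IsAnswer O q p (stepSize q p) lam (lam * tailWeight q p) x xh j) :
    IsPass X ψ q p lam δ (stepSize q p) x xh := by
  have hs := stepSize_spec hI.one_lt_q hI.q_le_two hI.three_le_p
  have hlam := hI.lam_pos
  have ht := tailWeight_pos hI.one_lt_q p
  have ht1 : tailWeight q p ≤ 1 := by
    unfold tailWeight
    rw [div_le_one (by positivity)]
    have : (1 : ℝ) ≤ 64 ^ p := one_le_pow₀ (by norm_num)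
    linarith [hI.q_le_two]
  have hω : lam * tailWeight q p ≤ Real.exp (polylog A m * p) := by
    have h3 : (1 : ℝ) ≤ p := by exact_mod_cast (by have := hI.three_le_p; omega : 1 ≤ p)
    calc lam * tailWeight q p ≤ lam * 1 := by gcongr
      _ ≤ Real.exp (polylog A m) := by rw [mul_one]; exact hI.lam_le
      _ ≤ _ := Real.exp_le_exp.2 (le_mul_of_one_le_right (polylog_nonneg A m) h3)
  -- `modelCost` unfolds to `passCost` with the weights `lam` and `lam * tailWeight q p`.
  exact fun j => hI.answer hs.pos.le hs.le_one hlam.le hI.lam_le (by positivity) hω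
    (fun i l hi hl => hI.entry_le hx hi hl) h j

/-- One pass keeps the matrix feasible and contracts the gap. -/
lemma Instance.pass (hI : Instance A p q lam δ X ψ O) {x xh : ℕ → ℕ → ℝ}
    (hx : matOf m k x ∈ feasible X)
    (h : ∀ j, IsAnswer O q p (stepSize q p) lam (lam * tailWeight q p) x xh j) :
    matOf m k (damped (stepSize q p) x xh) ∈ feasible X ∧
      ∀ y, matOf m k y ∈ feasible X →
        objective ψ q p lam (matOf m k (damped (stepSize q p) x xh)) -
            objective ψ q p lam (matOf m k y) ≤
          (1 - stepSize q p) * (objective ψ q p lam (matOf m k x) -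
            objective ψ q p lam (matOf m k y)) + stepSize q p * (k * δ) := by
  have hs := stepSize_spec hI.one_lt_q hI.q_le_two hI.three_le_p
  have hp := hI.isPass hx h
  exact ⟨damped_mem hs hI.convex hx fun j => (hp j).1,
    fun y hy => pass_contraction hs hI.lam_pos hI.convexOn hx hp y hy⟩

lemma Instance.passes (hI : Instance A p q lam δ X ψ O) {n : ℕ} {x z : ℕ → ℕ → ℝ}
    (h : Passes O q p (stepSize q p) lam (lam * tailWeight q p) n x z)
    (hx : matOf m k x ∈ feasible X) :
    matOf m k z ∈ feasible X ∧
      ∀ y, matOf m k y ∈ feasible X →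
        objective ψ q p lam (matOf m k z) - objective ψ q p lam (matOf m k y) ≤
          (1 - stepSize q p) ^ n * (objective ψ q p lam (matOf m k x) -
            objective ψ q p lam (matOf m k y)) + k * δ := by
  have hs := stepSize_spec hI.one_lt_q hI.q_le_two hI.three_le_p
  have hδ := hI.δ_pos
  induction h with
  | refl x => exact ⟨hx, fun y _ => by
      rw [pow_zero, one_mul]
      have : 0 ≤ (k : ℝ) * δ := by positivity
      linarith⟩
  | step h hy ih =>
    obtain ⟨h1, h2⟩ := ih hx
    obtain ⟨h3, h4⟩ := hI.pass h1 hy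
    refine ⟨h3, fun y hyf => ?_⟩
    have h5 := h4 y hyf
    have h6 := mul_le_mul_of_nonneg_left (h2 y hyf) (by linarith [hs.le_one] : 0 ≤ 1 - stepSize q p)
    rw [pow_succ]
    linarith

end Answers

/-! ### The starting point and the number of passes -/

lemma exists_matOf {m k : ℕ} (Y : Fin m → Fin k → ℝ) : ∃ y, matOf m k y = Y := by
  refine ⟨fun i j => if hi : i < m then if hj : j < k then Y ⟨i, hi⟩ ⟨j, hj⟩ else 0 else 0, ?_⟩
  funext i j
  simp [matOf]

lemma sum_pow_le_pow_sum_of_nonneg {ι : Type*} {s : Finset ι} {f : ι → ℝ} (hf : ∀ i ∈ s, 0 ≤ f i)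
    {p : ℕ} (hp : 1 ≤ p) : ∑ i ∈ s, f i ^ p ≤ (∑ i ∈ s, f i) ^ p := by
  obtain ⟨n, rfl⟩ : ∃ n, p = n + 1 := ⟨p - 1, by omega⟩
  calc ∑ i ∈ s, f i ^ (n + 1) ≤ ∑ i ∈ s, (∑ j ∈ s, f j) ^ n * f i := by
        refine Finset.sum_le_sum fun i hi => ?_
        rw [pow_succ]
        have h1 := Finset.single_le_sum hf hi
        have h2 := hf i hi
        gcongr
    _ = _ := by rw [← Finset.mul_sum, pow_succ]

lemma pow_sum_le_card_mul_sum_pow {ι : Type*} {s : Finset ι} {f : ι → ℝ} (hf : ∀ i ∈ s, 0 ≤ f i)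
    {p : ℕ} (hp : 1 ≤ p) : (∑ i ∈ s, f i) ^ p ≤ (s.card : ℝ) ^ (p - 1) * ∑ i ∈ s, f i ^ p := by
  rcases s.eq_empty_or_nonempty with rfl | hs
  · rw [Finset.sum_empty, zero_pow (by omega)]; simp
  obtain ⟨n, rfl⟩ : ∃ n, p = n + 1 := ⟨p - 1, by omega⟩
  have h := pow_sum_div_card_le_sum_pow hf n
  have hc : (0 : ℝ) < s.card := by exact_mod_cast hs.card_pos
  rw [div_le_iff₀' (by positivity)] at h
  simpa using h

/-- The separable surrogate of the row cost. -/
def sepCost (m k : ℕ) (q : ℝ) (p : ℕ) (x : ℕ → ℕ → ℝ) : ℝ :=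
  ∑ j : Fin k, ∑ i : Fin m, |x i j| ^ ((p : ℝ) * q)

section Bounds

variable {m k p : ℕ} {q : ℝ}

lemma sepCost_eq (m k : ℕ) (q : ℝ) (p : ℕ) (x : ℕ → ℕ → ℝ) :
    sepCost m k q p x = ∑ i ∈ Finset.range m, ∑ j ∈ Finset.range k, (|x i j| ^ q) ^ p := by
  unfold sepCost
  rw [Finset.sum_comm, Finset.sum_range]
  refine Finset.sum_congr rfl fun i _ => ?_
  rw [Finset.sum_range]
  refine Finset.sum_congr rfl fun j _ => ?_
  rw [← Real.rpow_natCast, ← Real.rpow_mul (abs_nonneg _), mul_comm]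

lemma sepCost_le_rowCost (hp : 1 ≤ p) (x : ℕ → ℕ → ℝ) :
    sepCost m k q p x ≤ rowCost m k q p x := by
  rw [sepCost_eq]
  exact Finset.sum_le_sum fun i _ =>
    sum_pow_le_pow_sum_of_nonneg (fun j _ => by positivity) hp

lemma rowCost_le_sepCost (hp : 1 ≤ p) (x : ℕ → ℕ → ℝ) :
    rowCost m k q p x ≤ (k : ℝ) ^ (p - 1) * sepCost m k q p x := by
  rw [sepCost_eq, Finset.mul_sum]
  refine Finset.sum_le_sum fun i _ => ?_
  have := pow_sum_le_card_mul_sum_pow (s := Finset.range k) (f := fun l => |x i l| ^ q)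
    (fun j _ => by positivity) hp
  rwa [Finset.card_range] at this

lemma objective_matOf_eq (ψ : Fin k → (Fin m → ℝ) → ℝ) (hq : 1 < q) (hp : 3 ≤ p) (lam : ℝ)
    (x : ℕ → ℕ → ℝ) : objective ψ q p lam (matOf m k x) =
      totalCost ψ (matOf m k x) + lam * rowCost m k q p x := by
  rw [objective_eq ψ hq hp]
  simp only [matOf, rowCost, Finset.sum_range]

variable {A : ℕ} {lam δ : ℝ} {X : Fin k → Set (Fin m → ℝ)} {ψ : Fin k → (Fin m → ℝ) → ℝ}
  {O : Fin k → Oracle m}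

/-- The first pass minimizes the separable surrogate of the objective. -/
lemma Instance.first_pass (hI : Instance A p q lam δ X ψ O) {xh : ℕ → ℕ → ℝ}
    (h : ∀ j, IsAnswer O q p 1 0 (lam * (k : ℝ) ^ (p - 1)) (fun _ _ => 0) xh j) :
    matOf m k (damped 1 (fun _ _ => 0) xh) ∈ feasible X ∧
      ∀ y, matOf m k y ∈ feasible X →
        totalCost ψ (matOf m k (damped 1 (fun _ _ => 0) xh)) +
            lam * (k : ℝ) ^ (p - 1) * sepCost m k q p (damped 1 (fun _ _ => 0) xh) ≤
          totalCost ψ (matOf m k y) + lam * (k : ℝ) ^ (p - 1) * sepCost m k q p y + k * δ := by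
  -- A full step forgets the starting point, so the zero matrix need not be feasible.
  have hd : damped 1 (fun _ _ => 0) xh = xh := by funext i j; simp [damped]
  have hlam := hI.lam_pos
  have hp := hI.three_le_p
  have hω : lam * (k : ℝ) ^ (p - 1) ≤ Real.exp (polylog A m * p) := by
    calc lam * (k : ℝ) ^ (p - 1) ≤ Real.exp (polylog A m) * Real.exp (polylog A m) ^ (p - 1) := by
          gcongr
          · exact hI.lam_le
          · exact hI.k_le
      _ = Real.exp (polylog A m) ^ p := by
          rw [← pow_succ']; congr 1; omega
      _ = _ := by rw [← Real.exp_nat_mul, mul_comm]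
  have ha := hI.answer (β := 1) (μ := 0) zero_le_one le_rfl le_rfl (Real.exp_pos _).le
    (by positivity) hω (fun i j _ _ => by rw [abs_zero]; positivity) h
  rw [hd]
  refine ⟨fun j => (ha j).1, fun y hy => ?_⟩
  have hsum := Finset.sum_le_sum fun j (_ : j ∈ (Finset.univ : Finset (Fin k))) =>
    (ha j).2 _ (hy j)
  -- With `μ = 0` and start `0`, only `ω |v|^(p q)` survives; the blocks decouple and their errors
  -- add up to `k δ`.
  simp only [passCost, zero_mul, zero_div, sub_zero, zero_add, ← Finset.mul_sum,
    Finset.sum_add_distrib, Finset.sum_const, Finset.card_univ, Fintype.card_fin,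
    nsmul_eq_mul] at hsum
  exact hsum

/-- A near-minimizer of `ψ` plus a surrogate that is bounded on the box bounds `ψ` from below.
Boundedness is needed because a real `sInf` says nothing about an unbounded set. -/
lemma Instance.bddBelow (hI : Instance A p q lam δ X ψ O) {xh : ℕ → ℕ → ℝ}
    (h : ∀ j, IsAnswer O q p 1 0 (lam * (k : ℝ) ^ (p - 1)) (fun _ _ => 0) xh j) :
    BddBelow (totalCost ψ '' feasible X) := by
  obtain ⟨-, h2⟩ := hI.first_pass h
  have hlam := hI.lam_pos
  have hq := hI.one_lt_q
  set S := ∑ _j : Fin k, ∑ _i : Fin m, Real.exp (polylog A m) ^ ((p : ℝ) * q) with hS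
  refine ⟨totalCost ψ (matOf m k (damped 1 (fun _ _ => 0) xh)) +
    lam * (k : ℝ) ^ (p - 1) * sepCost m k q p (damped 1 (fun _ _ => 0) xh) -
      lam * (k : ℝ) ^ (p - 1) * S - k * δ, ?_⟩
  rintro _ ⟨Y, hY, rfl⟩
  obtain ⟨y, rfl⟩ := exists_matOf Y
  have h3 := h2 y hY
  have h4 : sepCost m k q p y ≤ S := by
    refine Finset.sum_le_sum fun j _ => Finset.sum_le_sum fun i _ => ?_
    have := hI.entry_le hY i.2 j.2
    gcongr
  have h5 : lam * (k : ℝ) ^ (p - 1) * sepCost m k q p y ≤ lam * (k : ℝ) ^ (p - 1) * S := by gcongr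
  linarith

lemma neg_costDeficit_le (hb : BddBelow (totalCost ψ '' feasible X)) {Y : Fin m → Fin k → ℝ}
    (hY : Y ∈ feasible X) : -costDeficit X ψ ≤ totalCost ψ Y := by
  have h1 := csInf_le hb ⟨Y, hY, rfl⟩
  have h2 := le_max_right 0 (-sInf (totalCost ψ '' feasible X))
  unfold costDeficit
  linarith

/-- The row cost after two passes, in terms of the optimal value. -/
lemma Instance.rowCost_le (hI : Instance A p q lam δ X ψ O) {xh₀ xh₁ : ℕ → ℕ → ℝ}
    (h₀ : ∀ j, IsAnswer O q p 1 0 (lam * (k : ℝ) ^ (p - 1)) (fun _ _ => 0) xh₀ j)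
    (h₁ : ∀ j, IsAnswer O q p (stepSize q p) lam (lam * tailWeight q p)
      (damped 1 (fun _ _ => 0) xh₀) xh₁ j) :
    lam * rowCost m k q p (damped (stepSize q p) (damped 1 (fun _ _ => 0) xh₀) xh₁) ≤
      5 * (k : ℝ) ^ (p - 1) * (|optVal X ψ q p lam| + costDeficit X ψ + k * δ) := by
  have hs := stepSize_spec hI.one_lt_q hI.q_le_two hI.three_le_p
  have hlam := hI.lam_pos
  have hδ := hI.δ_pos
  have hp := hI.three_le_p
  have hk : (1 : ℝ) ≤ k := by exact_mod_cast hI.one_le_k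
  have hkp : 1 ≤ (k : ℝ) ^ (p - 1) := one_le_pow₀ hk
  have hkδ : 0 < (k : ℝ) * δ := by positivity
  obtain ⟨f0, g0⟩ := hI.first_pass h₀
  have hb := hI.bddBelow h₀
  set x0 := damped 1 (fun _ _ => 0) xh₀
  obtain ⟨f1, g1⟩ := hI.pass f0 h₁
  set x1 := damped (stepSize q p) x0 xh₁
  have hne : (objective ψ q p lam '' feasible X).Nonempty := ⟨_, _, f0, rfl⟩
  -- A near-optimal point suffices; no lower semicontinuity of the `ψ_j` is available to give a
  -- minimizer.
  obtain ⟨_, ⟨Y, hY, rfl⟩, hYo⟩ := Real.lt_sInf_add_pos hne hkδ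
  obtain ⟨y, rfl⟩ := exists_matOf Y
  have hYo' : objective ψ q p lam (matOf m k y) < optVal X ψ q p lam + k * δ := hYo
  have e0 := objective_matOf_eq ψ hI.one_lt_q hp lam x0
  have e1 := objective_matOf_eq ψ hI.one_lt_q hp lam x1
  have ey := objective_matOf_eq ψ hI.one_lt_q hp lam y
  have d1 := neg_costDeficit_le hb f1
  have dy := neg_costDeficit_le hb hY
  have hD : 0 ≤ costDeficit X ψ := le_max_left _ _
  have ho := le_abs_self (optVal X ψ q p lam)
  have hoa := abs_nonneg (optVal X ψ q p lam)
  have i0 := g0 y hY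
  have i1 := g1 y hY
  have s0 := mul_le_mul_of_nonneg_left (rowCost_le_sepCost (m := m) (k := k) (q := q)
    (by omega : 1 ≤ p) x0) hlam.le
  have sy := mul_le_mul_of_nonneg_left (sepCost_le_rowCost (m := m) (k := k) (q := q)
    (by omega : 1 ≤ p) y) (by positivity : 0 ≤ lam * (k : ℝ) ^ (p - 1))
  have ry := rowCost_nonneg m k q p y
  have hry : 0 ≤ lam * rowCost m k q p y := by positivity
  set Θ := |optVal X ψ q p lam| + costDeficit X ψ + k * δ with hΘ
  set κ := (k : ℝ) ^ (p - 1)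
  have hΘ0 : 0 ≤ Θ := by positivity
  have hFy : lam * rowCost m k q p y ≤ Θ := by linarith
  have hκF : lam * κ * rowCost m k q p y ≤ κ * Θ := by
    calc _ = κ * (lam * rowCost m k q p y) := by ring
      _ ≤ _ := by gcongr
  have hE0 : objective ψ q p lam (matOf m k x0) ≤ (Θ + κ * Θ) + k * δ := by linarith
  have hβ := hs.pos
  have hβ1 := hs.le_one
  have hκΘ : Θ ≤ κ * Θ := le_mul_of_one_le_left hΘ0 hkp
  have hE1 : objective ψ q p lam (matOf m k x1) ≤ (Θ + κ * Θ) + 2 * (k * δ) := by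
    have hEy : objective ψ q p lam (matOf m k y) ≤ (Θ + κ * Θ) + k * δ := by linarith
    have b1 := mul_le_mul_of_nonneg_left hE0 (by linarith : 0 ≤ 1 - stepSize q p)
    have b2 := mul_le_mul_of_nonneg_left hEy hβ.le
    have b3 : stepSize q p * (k * δ) ≤ 1 * (k * δ) := by gcongr
    linarith
  linarith

/-- The gap after the second pass. -/
lemma Instance.gap_le (hI : Instance A p q lam δ X ψ O) {xh₀ xh₁ : ℕ → ℕ → ℝ}
    (h₀ : ∀ j, IsAnswer O q p 1 0 (lam * (k : ℝ) ^ (p - 1)) (fun _ _ => 0) xh₀ j)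
    (h₁ : ∀ j, IsAnswer O q p (stepSize q p) lam (lam * tailWeight q p)
      (damped 1 (fun _ _ => 0) xh₀) xh₁ j) {y : ℕ → ℕ → ℝ} (hy : matOf m k y ∈ feasible X) :
    objective ψ q p lam
        (matOf m k (damped (stepSize q p) (damped 1 (fun _ _ => 0) xh₀) xh₁)) -
      objective ψ q p lam (matOf m k y) ≤
      k * δ * (((k : ℝ) ^ (p - 1) * lam * rowCost m k q p
        (damped (stepSize q p) (damped 1 (fun _ _ => 0) xh₀) xh₁) / (k * δ) + 2) /
          stepSize q p) := by
  have hs := stepSize_spec hI.one_lt_q hI.q_le_two hI.three_le_p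
  have hlam := hI.lam_pos
  have hδ := hI.δ_pos
  have hp := hI.three_le_p
  have hk : (1 : ℝ) ≤ k := by exact_mod_cast hI.one_le_k
  have hkδ : 0 < (k : ℝ) * δ := by positivity
  obtain ⟨f0, g0⟩ := hI.first_pass h₀
  set x0 := damped 1 (fun _ _ => 0) xh₀
  obtain ⟨f1, g1⟩ := hI.pass f0 h₁
  set x1 := damped (stepSize q p) x0 xh₁
  have e0 := objective_matOf_eq ψ hI.one_lt_q hp lam x0
  have e1 := objective_matOf_eq ψ hI.one_lt_q hp lam x1
  have i0 := g0 x1 f1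
  have i1 := g1 y hy
  have s0 := mul_le_mul_of_nonneg_left (rowCost_le_sepCost (m := m) (k := k) (q := q)
    (by omega : 1 ≤ p) x0) hlam.le
  have s1 := mul_le_mul_of_nonneg_left (sepCost_le_rowCost (m := m) (k := k) (q := q)
    (by omega : 1 ≤ p) x1) (by positivity : 0 ≤ lam * (k : ℝ) ^ (p - 1))
  have r1 : 0 ≤ lam * rowCost m k q p x1 := mul_nonneg hlam.le (rowCost_nonneg m k q p x1)
  set F := rowCost m k q p x1
  set β := stepSize q p
  have hβ := hs.pos
  have hβ1 := hs.le_one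
  set D := (k : ℝ) ^ (p - 1) * lam * F + k * δ with hD
  -- The values of `ψ` cancel: `x0` nearly minimizes `ψ` plus the surrogate, and the surrogate at
  -- `x1` is at most `lam k^(p-1) F`. So the decrease is bounded by computable quantities.
  have hdec : objective ψ q p lam (matOf m k x0) - objective ψ q p lam (matOf m k x1) ≤ D := by
    rw [hD]; linarith
  have hD0 : 0 ≤ D := by
    have : 0 ≤ (k : ℝ) ^ (p - 1) * (lam * F) := by positivity
    rw [hD]; linarith
  set a := objective ψ q p lam (matOf m k x0) - objective ψ q p lam (matOf m k y)
  set b := objective ψ q p lam (matOf m k x1) - objective ψ q p lam (matOf m k y)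
  have hab : a - b ≤ D := by linarith
  have e : k * δ * (((k : ℝ) ^ (p - 1) * lam * F / (k * δ) + 2) / β) = (D + k * δ) / β := by
    rw [hD]; field_simp; ring
  rw [e, le_div_iff₀ hβ]
  -- Contraction read backwards: `b ≤ (1 - β) a + β k δ` and `a ≤ b + D` bound the gap `b` after the
  -- pass by the decrease alone.
  have h1 : β * b ≤ (1 - β) * D + β * (k * δ) := by nlinarith
  have h2 : (1 - β) * D ≤ D := by nlinarith
  have h3 : β * (k * δ) ≤ 1 * (k * δ) := by gcongr
  linarith

/-- After the prescribed number of passes the gap is at most `2 k δ`. -/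
lemma Instance.final_gap (hI : Instance A p q lam δ X ψ O) {xh₀ xh₁ z : ℕ → ℕ → ℝ}
    (h₀ : ∀ j, IsAnswer O q p 1 0 (lam * (k : ℝ) ^ (p - 1)) (fun _ _ => 0) xh₀ j)
    (h₁ : ∀ j, IsAnswer O q p (stepSize q p) lam (lam * tailWeight q p)
      (damped 1 (fun _ _ => 0) xh₀) xh₁ j) {N : ℕ}
    (hN : rounds q p k lam δ (rowCost m k q p
      (damped (stepSize q p) (damped 1 (fun _ _ => 0) xh₀) xh₁)) ≤ N)
    (h : Passes O q p (stepSize q p) lam (lam * tailWeight q p) N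
      (damped (stepSize q p) (damped 1 (fun _ _ => 0) xh₀) xh₁) z) :
    matOf m k z ∈ feasible X ∧ ∀ Y ∈ feasible X,
      objective ψ q p lam (matOf m k z) ≤ objective ψ q p lam Y + 3 * k * δ := by
  have hs := stepSize_spec hI.one_lt_q hI.q_le_two hI.three_le_p
  have hlam := hI.lam_pos
  have hδ := hI.δ_pos
  have hk : (1 : ℝ) ≤ k := by exact_mod_cast hI.one_le_k
  have hkδ : 0 < (k : ℝ) * δ := by positivity
  have hβ := hs.pos
  have hβ1 := hs.le_one
  obtain ⟨f1, -⟩ := hI.pass (hI.first_pass h₀).1 h₁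
  obtain ⟨fz, gz⟩ := hI.passes h f1
  refine ⟨fz, fun Y hY => ?_⟩
  obtain ⟨y, rfl⟩ := exists_matOf Y
  have i1 := gz y hY
  have i2 := hI.gap_le h₀ h₁ hY
  set F := rowCost m k q p (damped (stepSize q p) (damped 1 (fun _ _ => 0) xh₀) xh₁)
  have hF : 0 ≤ F := rowCost_nonneg _ _ _ _ _
  set β := stepSize q p with hβd
  set V := ((k : ℝ) ^ (p - 1) * lam * F / (k * δ) + 2) / β with hV
  have hV0 : 0 < V := by positivity
  -- `rounds` is `log V / β`, and the starting gap is at most `k δ V`, so these passes reduce its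
  -- contribution to `k δ`.
  have hpow : (1 - β) ^ N ≤ 1 / V := by
    have h1 : 1 - β ≤ Real.exp (-β) := by linarith [Real.add_one_le_exp (-β)]
    calc (1 - β) ^ N ≤ Real.exp (-β) ^ N := by
          gcongr
      _ = Real.exp (-(N * β)) := by rw [← Real.exp_nat_mul]; ring_nf
      _ ≤ Real.exp (-Real.log V) := by
          apply Real.exp_le_exp.2
          have h2 : 1 / β * Real.log V ≤ N := hN
          rw [one_div_mul_eq_div, div_le_iff₀ hβ] at h2
          linarith
      _ = 1 / V := by rw [Real.exp_neg, Real.exp_log hV0, one_div]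
  have i3 : (1 - β) ^ N * (k * δ * V) ≤ 1 / V * (k * δ * V) := by gcongr
  have i4 : 1 / V * (k * δ * V) = k * δ := by field_simp
  have i5 := mul_le_mul_of_nonneg_left i2 (pow_nonneg (by linarith : 0 ≤ 1 - β) N)
  linarith

/-- The number of passes in terms of the optimal value. -/
lemma Instance.rounds_le (hI : Instance A p q lam δ X ψ O) {F : ℝ} (hF : 0 ≤ F)
    (h : lam * F ≤ 5 * (k : ℝ) ^ (p - 1) *
      (|optVal X ψ q p lam| + costDeficit X ψ + k * δ)) :
    rounds q p k lam δ F + 3 ≤ roundBound 72 X ψ q p lam δ := by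
  have hq := hI.one_lt_q
  have hq2 := hI.q_le_two
  have hs : 0 < q - 1 := by linarith
  have hp : 3 ≤ p := hI.three_le_p
  have hp3 : (3 : ℝ) ≤ p := by exact_mod_cast hp
  have hlam := hI.lam_pos
  have hδ := hI.δ_pos
  have hk : (1 : ℝ) ≤ k := by exact_mod_cast hI.one_le_k
  have hβ := stepSize_pos hq (by omega : 1 ≤ p)
  have hD : 0 ≤ costDeficit X ψ := le_max_left _ _
  unfold roundBound
  push_cast
  set Θ := |optVal X ψ q p lam| + costDeficit X ψ with hΘ
  have hΘ0 : 0 ≤ Θ := by positivity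
  set a := (p : ℝ) / (q - 1) with ha
  have hpa : (p : ℝ) ≤ a := by
    rw [ha, le_div_iff₀ hs]; nlinarith
  have ha3 : 3 ≤ a := by linarith
  have ha0 : 0 < a := by linarith
  set Z := 2 + k * (1 + Θ / δ) with hZ
  have hΘδ : 0 ≤ Θ / δ := by positivity
  have hZ1 : 1 + Θ / δ ≤ k * (1 + Θ / δ) := le_mul_of_one_le_left (by linarith) hk
  have hZk : (k : ℝ) ≤ k * (1 + Θ / δ) := le_mul_of_one_le_right (by linarith) (by linarith)
  have hZ3 : 3 ≤ Z := by rw [hZ]; linarith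
  have hlogZ : 1 ≤ Real.log Z := by
    rw [Real.le_log_iff_exp_le (by linarith)]
    linarith [Real.exp_one_lt_d9]
  set W := (k : ℝ) ^ (p - 1) * lam * F / (k * δ) + 2 with hW
  have hW0 : 0 < W := by positivity
  -- The surrogate loses `k^(p-1)` twice, once in `F` and once in the gap. Inside the logarithm this
  -- costs only a factor linear in `p`.
  have hWZ : W ≤ Z ^ (2 * p + 1) := by
    have h1 : (k : ℝ) ^ (p - 1) * lam * F / (k * δ) ≤ 5 * k ^ (2 * p - 2) * (1 + Θ / δ) := by
      rw [div_le_iff₀ (by positivity)]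
      have e1 : (k : ℝ) ^ (2 * p - 2) = k ^ (p - 1) * k ^ (p - 1) := by
        rw [← pow_add]; congr 1; omega
      calc (k : ℝ) ^ (p - 1) * lam * F = k ^ (p - 1) * (lam * F) := by ring
        _ ≤ k ^ (p - 1) * (5 * (k : ℝ) ^ (p - 1) * (Θ + k * δ)) := by gcongr
        _ ≤ k ^ (p - 1) * (5 * (k : ℝ) ^ (p - 1) * (k * Θ + k * δ)) := by
            gcongr
            exact le_mul_of_one_le_left hΘ0 hk
        _ = _ := by rw [e1]; field_simp; ring
    have h2 : (1 : ℝ) ≤ k ^ (2 * p - 2) := one_le_pow₀ hk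
    have h3 : W ≤ 7 * (k ^ (2 * p - 2) * (1 + Θ / δ)) := by
      have : (1 : ℝ) ≤ k ^ (2 * p - 2) * (1 + Θ / δ) := by
        have h4 : (1 : ℝ) ≤ 1 + Θ / δ := by linarith
        nlinarith
      rw [hW]; linarith
    calc W ≤ 7 * (k ^ (2 * p - 2) * (1 + Θ / δ)) := h3
      _ ≤ Z ^ 2 * (Z ^ (2 * p - 2) * Z) := by
          gcongr
          · nlinarith
          · rw [hZ]; linarith
          · rw [hZ]; linarith
      _ = Z ^ (2 * p + 1) := by
          rw [← pow_succ, ← pow_add]; congr 1; omega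
  have hβe : 1 / stepSize q p = (16 * a) ^ (16 / (q - 1)) := by
    unfold stepSize
    rw [one_div, ← Real.inv_rpow (by positivity), inv_div, ha]
    ring_nf
  have hlogβ : Real.log (1 / stepSize q p) ≤ 256 * a ^ 2 := by
    rw [hβe, Real.log_rpow (by positivity)]
    have h1 : Real.log (16 * a) ≤ 16 * a := by
      linarith [Real.log_le_sub_one_of_pos (by positivity : 0 < 16 * a)]
    have h2 : 16 / (q - 1) ≤ 16 * a := by
      rw [ha, ← mul_div_assoc]
      gcongr
      linarith
    have h3 : 0 ≤ Real.log (16 * a) := Real.log_nonneg (by linarith)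
    calc 16 / (q - 1) * Real.log (16 * a) ≤ 16 * a * (16 * a) := by gcongr
      _ = _ := by ring
  have hlogV : Real.log (W / stepSize q p) ≤ (3 * a + 256 * a ^ 2) * Real.log Z := by
    rw [div_eq_mul_one_div, Real.log_mul hW0.ne' (by positivity)]
    have h1 : Real.log W ≤ 3 * a * Real.log Z := by
      calc Real.log W ≤ Real.log (Z ^ (2 * p + 1)) := Real.log_le_log hW0 hWZ
        _ = (2 * p + 1) * Real.log Z := by rw [Real.log_pow]; push_cast; ring
        _ ≤ _ := by gcongr; linarith
    have h2 : 256 * a ^ 2 ≤ 256 * a ^ 2 * Real.log Z := le_mul_of_one_le_right (by positivity) hlogZ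
    linarith
  have hβ1 : 1 ≤ 1 / stepSize q p := by
    rw [le_div_iff₀ hβ, one_mul]
    exact stepSize_le_one hq hq2 (by omega)
  have hr : rounds q p k lam δ F + 3 ≤ 1 / stepSize q p * (a ^ 8 * Real.log Z) := by
    have h1 : rounds q p k lam δ F ≤
        1 / stepSize q p * ((3 * a + 256 * a ^ 2) * Real.log Z) := by
      unfold rounds
      gcongr
    have h2 : 3 ≤ 1 / stepSize q p * (3 * Real.log Z) := by
      calc (3 : ℝ) = 1 * (3 * 1) := by norm_num
        _ ≤ _ := by gcongr
    have h3 : 3 + 3 * a + 256 * a ^ 2 ≤ a ^ 8 := by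
      have h4 : (3 : ℝ) ^ 6 ≤ a ^ 6 := by gcongr
      have h5 : a ^ 8 = a ^ 6 * a ^ 2 := by ring
      nlinarith
    calc rounds q p k lam δ F + 3
        ≤ _ := add_le_add h1 h2
      _ = 1 / stepSize q p * ((3 + 3 * a + 256 * a ^ 2) * Real.log Z) := by ring
      _ ≤ _ := by gcongr
  refine hr.trans ?_
  rw [← mul_assoc]
  gcongr
  have ha1 : 1 ≤ a := by linarith
  have h1s : 1 ≤ 1 / (q - 1) := by rw [le_div_iff₀ hs]; linarith
  have h16 : 16 * a ≤ a ^ (4 : ℝ) := by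
    have e : a ^ (4 : ℝ) = a ^ 3 * a := by
      rw [← pow_succ]; exact_mod_cast rfl
    rw [e]
    have : (3 : ℝ) ^ 3 ≤ a ^ 3 := by gcongr
    gcongr
    linarith
  -- The exponent `72` is `64 + 8`: the inverse step is `(16 a)^(16/(q-1))` with `16 a ≤ a^4`, and
  -- the polynomial factors fit into `a^8`.
  calc 1 / stepSize q p * a ^ 8 ≤ a ^ (64 / (q - 1)) * a ^ (8 / (q - 1)) := by
        gcongr
        · rw [hβe]
          calc (16 * a) ^ (16 / (q - 1)) ≤ (a ^ (4 : ℝ)) ^ (16 / (q - 1)) := by gcongr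
            _ = a ^ (64 / (q - 1)) := by rw [← Real.rpow_mul ha0.le]; ring_nf
        · calc a ^ 8 = a ^ (8 : ℝ) := by exact_mod_cast rfl
            _ ≤ _ := Real.rpow_le_rpow_of_exponent_le ha1 (by
                rw [div_eq_mul_one_div]; linarith)
    _ = a ^ (72 / (q - 1)) := by rw [← Real.rpow_add ha0]; ring_nf

lemma Instance.roundBound_le (hI : Instance A p q lam δ X ψ O) {B : ℕ} (hB : 72 ≤ B) :
    roundBound 72 X ψ q p lam δ ≤ roundBound B X ψ q p lam δ := by
  have hq := hI.one_lt_q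
  have hq2 := hI.q_le_two
  have hs : 0 < q - 1 := by linarith
  have hp3 : (3 : ℝ) ≤ p := by exact_mod_cast hI.three_le_p
  have hδ := hI.δ_pos
  have hD : 0 ≤ costDeficit X ψ := le_max_left _ _
  have h1 : 0 ≤ (k : ℝ) * (1 + (|optVal X ψ q p lam| + costDeficit X ψ) / δ) := by positivity
  have h2 : (1 : ℝ) ≤ p / (q - 1) := by rw [le_div_iff₀ hs]; linarith
  have h3 : 0 ≤ Real.log (2 + k * (1 + (|optVal X ψ q p lam| + costDeficit X ψ) / δ)) :=
    Real.log_nonneg (by linarith)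
  unfold roundBound
  gcongr

end Bounds

/-- The bound `p ≤ A √(log m)` with `p ≥ 2` excludes the degenerate cases `A = 0` and `m ≤ 1`, in
which its right side vanishes. -/
lemma size_bounds {A m p : ℕ} (hp : 2 ≤ p) (h : (p : ℝ) ≤ A * Real.sqrt (Real.log m)) :
    1 ≤ A ∧ 2 ≤ m ∧ (p : ℝ) ≤ polylog A m := by
  have hp2 : (2 : ℝ) ≤ p := by exact_mod_cast hp
  have hA : 1 ≤ A := by
    rcases Nat.eq_zero_or_pos A with rfl | hA
    · rw [Nat.cast_zero, zero_mul] at h; linarith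
    · exact hA
  have hm : 2 ≤ m := by
    by_contra hm
    have hlog : Real.log m = 0 := by
      rcases (by omega : m = 0 ∨ m = 1) with rfl | rfl <;> simp
    rw [hlog, Real.sqrt_zero, mul_zero] at h
    linarith
  refine ⟨hA, hm, h.trans ?_⟩
  have h1 := one_le_logFactor m
  have h2 : Real.sqrt (Real.log m) ≤ (1 + Real.log m) ^ A := by
    calc Real.sqrt (Real.log m) ≤ 1 + Real.log m := by
          rw [Real.sqrt_le_left (by linarith)]
          nlinarith
      _ ≤ _ := le_self_pow₀ h1 (by omega)
  unfold polylog
  gcongr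

lemma State.time_le {m k : ℕ} {s : State} {T : Fin k → ℝ} (hT : ∀ j, 0 ≤ T j) {n : ℕ}
    (hc : ∀ j : Fin k, s.calls j = n) (hs : s.steps ≤ 1000 * (k * m) * n) :
    s.time T ≤ 1000 * (∑ j, (T j + m)) * n := by
  have h1 : (s.steps : ℝ) ≤ 1000 * (k * m) * n := by exact_mod_cast hs
  have h2 : 0 ≤ (n : ℝ) * ∑ j, T j :=
    mul_nonneg (Nat.cast_nonneg n) (Finset.sum_nonneg fun j _ => hT j)
  unfold State.time
  simp only [hc, ← Finset.mul_sum, Finset.sum_add_distrib, Finset.sum_const, Finset.card_univ,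
    Fintype.card_fin, nsmul_eq_mul]
  linarith

end LqpRegression

end

/-! ### Assembly of the theorem. -/

open LqpRegression in
theorem mainTheorem5 :
    ∃ (P : Cmd) (B : ℕ), ∀ A : ℕ, ∃ (C : ℕ) (H : ℕ → ℕ),
      ∀ (m k p : ℕ) (q lam δ : ℝ) (X : Fin k → Set (Fin m → ℝ))
        (ψ : Fin k → (Fin m → ℝ) → ℝ) (T : Fin k → ℝ) (O : Fin k → Oracle m),
        1 ≤ k → (k : ℝ) ≤ Real.exp (polylog A m) →
        1 < q → q ≤ 2 → 2 ≤ p → Odd p → (p : ℝ) ≤ A * Real.sqrt (Real.log m) →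
        0 < lam → lam ≤ Real.exp (polylog A m) →
        (∀ j, (X j).Nonempty ∧ Convex ℝ (X j) ∧ IsCompact (X j)) →
        (∀ j, ∀ x ∈ X j, ∀ i, |x i| ≤ Real.exp (polylog A m)) →
        (∀ j, ConvexOn ℝ (X j) (ψ j)) →
        0 < δ → (∀ j, 0 ≤ T j) →
        (∀ j, IsSCO C H δ (X j) (ψ j) (O j)) →
        ∃ s : State, Exec O P (initState m k p q lam δ) s ∧
          s.output m k ∈ feasible X ∧
          (∀ Y ∈ feasible X,
            objective ψ q p lam (s.output m k) ≤ objective ψ q p lam Y + 3 * k * δ) ∧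
          s.time T ≤ B * (∑ j, (T j + m)) * roundBound B X ψ q p lam δ ∧
          ∀ j : Fin k, (s.calls j : ℝ) ≤ B * roundBound B X ψ q p lam δ := by

  refine ⟨mainProg, 1000, fun A => ⟨compConst (queryConst A), hessConst (queryConst A), ?_⟩⟩
  intro m k p q lam δ X ψ T O hk hkA hq hq2 hp hodd hpA hlam hlamA hX hbd hψ hδ hT hO
  obtain ⟨hA, hm, hpl⟩ := size_bounds hp hpA
  -- Oddness enters only here, to exclude `p = 2`.
  have hp3 : 3 ≤ p := by
    obtain ⟨n, rfl⟩ := hodd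
    omega
  have hI : Instance A p q lam δ X ψ O :=
    ⟨hA, hm, hk, hkA, hq, hq2, hp3, hpl, hlam, hlamA, fun j => (hX j).2.1, hbd, hψ, hδ, hO⟩
  obtain ⟨s, xh₀, xh₁, y, N, hex, h₀, h₁, hN, hpass, hout, hcalls, hsteps⟩ :=
    exec_mainProg (O := O) (by omega : 1 ≤ m) hk (by omega : 1 ≤ p) hq hq2 hlam hδ
  have hF := rowCost_nonneg m k q p (damped (stepSize q p) (damped 1 (fun _ _ => 0) xh₀) xh₁)
  have hr0 := rounds_nonneg (k := k) hq hq2 (by omega : 1 ≤ p) hlam hδ hF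
  have hr := hI.rounds_le hF (hI.rowCost_le h₀ h₁)
  have hN' := (Nat.lt_floor_add_one (rounds q p k lam δ (rowCost m k q p
    (damped (stepSize q p) (damped 1 (fun _ _ => 0) xh₀) xh₁)))).le
  -- Each oracle is queried once per pass: `N` passes of the loop and the two preliminary ones, with
  -- `N ≤ rounds + 1`.
  have hNle : ((N + 2 : ℕ) : ℝ) ≤ roundBound 1000 X ψ q p lam δ := by
    refine le_trans ?_ (hI.roundBound_le (by norm_num : 72 ≤ 1000))
    refine le_trans ?_ hr
    rw [hN]
    push_cast
    linarith [Nat.floor_le hr0]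
  obtain ⟨hfeas, hopt⟩ := hI.final_gap h₀ h₁ (by rw [hN]; exact_mod_cast hN') hpass
  refine ⟨s, hex, by rw [hout]; exact hfeas, fun Y hY => by rw [hout]; exact hopt Y hY, ?_, ?_⟩
  · refine (State.time_le hT hcalls hsteps).trans ?_
    have hsum : 0 ≤ ∑ j, (T j + m) :=
      Finset.sum_nonneg fun j _ => add_nonneg (hT j) (Nat.cast_nonneg m)
    push_cast at hNle ⊢
    gcongr
  · intro j
    rw [hcalls]
    have : (0 : ℝ) ≤ roundBound 1000 X ψ q p lam δ := le_trans (Nat.cast_nonneg _) hNle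
    push_cast at hNle ⊢
    linarith
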